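/- Let $d\ge 1$, $k\in\mathbb{N}=\{0,1,2,\dots\}$ and $p>1$. For a square matrix $M$ and $c\in\mathbb{R}$ write $\operatorname{diag}(c,M)=\begin{pmatrix}c&0\\0&M\end{pmatrix}$. Let $G=(0,\infty)\times SO(d-1)\times\mathbb{R}^d$, a manifold of dimension $\dim\mathfrak g$ with $\mathfrak g=T_{\mathbb 1}G=\mathbb{R}\times\mathfrak{so}(d-1)\times\mathbb{R}^d$, where $\mathbb 1=(1,I,0)$. For $g=(\alpha,Q,b)\in G$ and $v:\mathbb{R}^d\to\mathbb{R}$ put $$(a(g)v)(x)=\alpha^{-1}\,v\bigl(\alpha^{1-p}\operatorname{diag}(1,Q)^{\top}(x-b)\bigr),\qquad x\in\mathbb{R}^d .$$ Fix $\kappa\in\mathbb{R}$ and let $\exp:\mathfrak g\to G$ be the exponential map of the Lie group structure $(\alpha_1,Q_1,b_1)\bullet(\alpha_2,Q_2,b_2)=(\alpha_1\alpha_2,\,Q_1Q_2,\,b_1+\alpha_1^{\kappa}\operatorname{diag}(1,Q_1)b_2)$ on $G$, i.e. $$\exp(\mu_1,S,w)=\Bigl(e^{\mu_1},\,e^{S},\,\sum_{j=0}^\infty\tfrac1{(j+1)!}\operatorname{diag}(\kappa\mu_1,\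 \kappa\mu_1 I+S)^j\,w\Bigr).$$ (For $\kappa=p-1$ the map $a$ is a left action of $(G,\bullet)$; the assertions hold for every $\kappa$.) Let $X$ be either $\mathcal C_0^k(\mathbb{R}^d)$, the space of real-valued $u\in \mathcal C^k(\mathbb{R}^d)$ with $D^\beta u(x)\to0$ as $|x|\to\infty$ for all $|\beta|\le k$, with the norm $\max_{|\beta|\le k}\|D^\beta u\|_\infty$, or $H^k(\mathbb{R}^d)$, the $L^2$-Sobolev space of real-valued functions with the norm $\bigl(\sum_{|\beta|\le k}\|D^\beta u\|_{L^2}^2\bigr)^{1/2}$. Let $\epsilon_1,\dots,\epsilon_N$ be any basis of $\mathfrak g$ and $$Y_0=\Bigl\{v\in X:\ T_{\mathbb 1}a\,v[\epsilon_j]:=\lim_{t\to0}\tfrac1t\bigl(a(\exp(t\epsilon_j))v-v\bigr)\ \text{exists in }X\text{ for } j=1,\dots,N\Bigr\},$$ $$\|v\|_{Y_0}=\|v\|_X+\max_{j}\|T_{\mathbb 1}a\,v[\epsilon_j]\|_X .$$ Then $Y_0$ is dense in $X$, $(Y_0,\|\cdot\|_{Y_0})$ is a Banach space, and: (a) for every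 $g\in G$, $a(g)$ maps $X$ into $X$ and $Y_0$ into $Y_0$, and it is a bounded linear operator on $(X,\|\cdot\|_X)$ and on $(Y_0,\|\cdot\|_{Y_0})$; (b) for every $v\in X$ the map $G\ni g\mapsto a(g)v\in X$ is continuous, and for every $v\in Y_0$ the map $G\ni g\mapsto a(g)v\in Y_0$ is continuous; (c) for every $v\in Y_0$ the map $G\ni g\mapsto a(g)v\in X$ is continuously differentiable. -/

import Mathlib

open MeasureTheory Filter Topology

noncomputable section

namespace BurgersSymmetry

/-! ### The symmetry group, its Lie algebra and the action on functions

The space dimension is `d = n + 1`, so that `d - 1 = n`. -/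

/-- `ℝᵈ` with `d = n + 1` and the Euclidean norm. -/
abbrev Rd (n : ℕ) := EuclideanSpace ℝ (Fin (n + 1))

/-- The underlying manifold of the symmetry group: triples `(α, Q, b)` with `α ∈ (0, ∞)`,
`Q ∈ SO(d - 1)`, `b ∈ ℝᵈ`, with the product topology. -/
abbrev SymGroup (n : ℕ) :=
  Set.Ioi (0 : ℝ) × Matrix.specialOrthogonalGroup (Fin n) ℝ × Rd n

/-- The Lie algebra `ℝ × 𝔰𝔬(d - 1) × ℝᵈ`; here `𝔰𝔬` is the space of skew-symmetric matrices. -/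
abbrev SymAlg (n : ℕ) := ℝ × LieAlgebra.Orthogonal.so (Fin n) ℝ × Rd n

/-- The block matrix `(c 0; 0 M)`. -/
def augment {n : ℕ} (c : ℝ) (M : Matrix (Fin n) (Fin n) ℝ) :
    Matrix (Fin (n + 1)) (Fin (n + 1)) ℝ :=
  Matrix.of (Fin.cons (Fin.cons c 0) fun i => Fin.cons 0 (M i))

/-- `(a(α, Q, b) v)(x) = α⁻¹ v(α^(1-p) (1 0; 0 Q)ᵀ (x - b))`. -/
def act {n : ℕ} (p : ℝ) (g : SymGroup n) (v : Rd n → ℝ) : Rd n → ℝ := fun x =>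
  (g.1 : ℝ)⁻¹ * v (((g.1 : ℝ) ^ (1 - p)) •
    WithLp.toLp 2 (Matrix.mulVec (augment 1 (g.2.1 : Matrix (Fin n) (Fin n) ℝ)).transpose
      (x - g.2.2).ofLp))

theorem exp_mem_specialOrthogonal {n : ℕ} (S : LieAlgebra.Orthogonal.so (Fin n) ℝ) :
    NormedSpace.exp (S : Matrix (Fin n) (Fin n) ℝ) ∈
      Matrix.specialOrthogonalGroup (Fin n) ℝ := by
  have key : ∀ A : Matrix (Fin n) (Fin n) ℝ, A.transpose = -A →
      (NormedSpace.exp A).transpose * NormedSpace.exp A = 1 := by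
    intro A hA
    rw [← Matrix.exp_transpose, hA, ← Matrix.exp_add_of_commute _ _ (Commute.neg_left (Commute.refl A))]
    simp
  have hS : (S : Matrix (Fin n) (Fin n) ℝ).transpose = -(S : Matrix (Fin n) (Fin n) ℝ) :=
    (LieAlgebra.Orthogonal.mem_so (Fin n) ℝ _).1 S.2
  rw [Matrix.mem_specialOrthogonalGroup_iff]
  refine ⟨?_, ?_⟩
  · rw [Matrix.mem_orthogonalGroup_iff']
    exact key _ hS
  · set H : Matrix (Fin n) (Fin n) ℝ := (2⁻¹ : ℝ) • (S : Matrix (Fin n) (Fin n) ℝ) with hH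
    have hHt : H.transpose = -H := by rw [hH, Matrix.transpose_smul, hS, smul_neg]
    have hSH : (S : Matrix (Fin n) (Fin n) ℝ) = H + H := by
      rw [hH, ← add_smul]; norm_num
    have h2 := congrArg Matrix.det (key H hHt)
    rw [Matrix.det_mul, Matrix.det_transpose, Matrix.det_one] at h2
    rw [hSH, Matrix.exp_add_of_commute _ _ (Commute.refl H), Matrix.det_mul, h2]

/-- The exponential map
`exp(a, S, w) = (exp a, exp S, ∑ₖ 1/(k+1)! (κa 0; 0 κaI + S)ᵏ w)`
of the group law `(α₁,Q₁,b₁) • (α₂,Q₂,b₂) = (α₁α₂, Q₁Q₂, b₁ + α₁^κ (1 0; 0 Q₁) b₂)`. -/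
def expG {n : ℕ} (κ : ℝ) (μ : SymAlg n) : SymGroup n :=
  (⟨Real.exp μ.1, Real.exp_pos μ.1⟩,
   ⟨NormedSpace.exp (μ.2.1 : Matrix (Fin n) (Fin n) ℝ), exp_mem_specialOrthogonal μ.2.1⟩,
   WithLp.toLp 2 (Matrix.mulVec
      (∑' k : ℕ, (1 / (Nat.factorial (k + 1) : ℝ)) •
        augment (κ * μ.1) ((κ * μ.1) • (1 : Matrix (Fin n) (Fin n) ℝ) + (μ.2.1 : Matrix (Fin n) (Fin n) ℝ)) ^ k)
      μ.2.2.ofLp))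

/-- The inclusion of the group as a submanifold of `ℝ × ℝ^(n×n) × ℝᵈ`. -/
def embed {n : ℕ} (g : SymGroup n) : ℝ × (Fin n → Fin n → ℝ) × Rd n :=
  (g.1, fun i j => (g.2.1 : Matrix (Fin n) (Fin n) ℝ) i j, g.2.2)

/-- Continuous differentiability of a map from the embedded submanifold
`(0, ∞) × SO(d - 1) × ℝᵈ ⊆ ℝ × ℝ^(n×n) × ℝᵈ` to a normed space: near every point it extends to a
`C¹` map on an open subset of the ambient space. -/
def IsC1 {n : ℕ} {X : Type*} [NormedAddCommGroup X] [NormedSpace ℝ X]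
    (f : SymGroup n → X) : Prop :=
  ∀ g : SymGroup n, ∃ (U : Set (ℝ × (Fin n → Fin n → ℝ) × Rd n))
    (F : ℝ × (Fin n → Fin n → ℝ) × Rd n → X),
    IsOpen U ∧ embed g ∈ U ∧ ContDiffOn ℝ 1 F U ∧
      ∀ h : SymGroup n, embed h ∈ U → F (embed h) = f h

/-! ### The spaces `C₀ᵏ(ℝᵈ)` and `Hᵏ(ℝᵈ)` -/

/-- Multi-indices `β ∈ ℕᵈ` with `|β| ≤ k`. -/
abbrev MultiIdx (n k : ℕ) := {β : Fin (n + 1) → Fin (k + 1) // ∑ i, (β i : ℕ) ≤ k}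

/-- The multi-index `0`. -/
def zeroIdx (n k : ℕ) : MultiIdx n k := ⟨0, by simp⟩

/-- The order `|β|`. -/
def order {n k : ℕ} (β : MultiIdx n k) : ℕ := ∑ i, (β.1 i : ℕ)

/-- The list `(e₁, …, e₁, e₂, …, e_d)` in which `eᵢ` is repeated `βᵢ` times. -/
def directions {n k : ℕ} (β : MultiIdx n k) : Fin (order β) → Rd n := fun j =>
  EuclideanSpace.single (finSigmaFinEquiv.symm j).1 (1 : ℝ)

/-- The partial derivative `D^β u` of a function `u` of class `C^|β|`. -/
def partialDeriv {n k : ℕ} (β : MultiIdx n k) (u : Rd n → ℝ) : Rd n → ℝ := fun x =>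
  iteratedFDeriv ℝ (order β) u x (directions β)

/-- `g` is the weak derivative `D^β u`. -/
def IsWeakDeriv {n k : ℕ} (β : MultiIdx n k) (u g : Rd n → ℝ) : Prop :=
  ∀ φ : Rd n → ℝ, ContDiff ℝ (⊤ : ℕ∞) φ → HasCompactSupport φ →
    ∫ x, u x * partialDeriv β φ x = (-1) ^ order β * ∫ x, g x * φ x

theorem contDiff_order {n k : ℕ} (β : MultiIdx n k) {u : Rd n → ℝ} (hu : ContDiff ℝ k u) :
    ContDiff ℝ (order β) u :=
  hu.of_le (by exact_mod_cast β.2)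

/-- `C₀ᵏ(ℝᵈ)`, the `k` times continuously differentiable functions all of whose partial
derivatives of order at most `k` vanish at infinity. An element is stored as the family
`(D^β u)` for `|β| ≤ k`, so that the norm (a maximum of sup norms) is `max ‖D^β u‖_∞`. -/
def C0kSubmodule (n k : ℕ) : Submodule ℝ (MultiIdx n k → ZeroAtInftyContinuousMap (Rd n) ℝ) where
  carrier := {u | ContDiff ℝ k (u (zeroIdx n k)) ∧
    ∀ β, ∀ x, u β x = partialDeriv β (u (zeroIdx n k)) x}
  add_mem' := by
    rintro u v ⟨hu, hu'⟩ ⟨hv, hv'⟩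
    refine ⟨hu.add hv, fun β x => ?_⟩
    have h : (⇑((u + v) (zeroIdx n k)) : Rd n → ℝ) =
      ⇑(u (zeroIdx n k)) + ⇑(v (zeroIdx n k)) := rfl
    simp only [partialDeriv] at hu' hv' ⊢
    rw [h, iteratedFDeriv_add_apply (contDiff_order β hu).contDiffAt
      (contDiff_order β hv).contDiffAt, add_apply, ← hu', ← hv']
    rfl
  zero_mem' := by
    refine ⟨contDiff_const (c := (0 : ℝ)), fun β x => ?_⟩
    simp [partialDeriv]
  smul_mem' := by
    rintro c u ⟨hu, hu'⟩
    refine ⟨hu.const_smul c, fun β x => ?_⟩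
    have h : (⇑((c • u) (zeroIdx n k)) : Rd n → ℝ) = c • ⇑(u (zeroIdx n k)) := rfl
    simp only [partialDeriv] at hu' ⊢
    rw [h, iteratedFDeriv_const_smul_apply (contDiff_order β hu).contDiffAt,
      smul_apply, ← hu']
    rfl

/-- The space `C₀ᵏ(ℝᵈ)`, with the norm `max ‖D^β u‖_∞` over `|β| ≤ k`. -/
abbrev C0k (n k : ℕ) : Type := C0kSubmodule n k

/-- The function `u : ℝᵈ → ℝ` given by an element of `C₀ᵏ(ℝᵈ)`. -/
def C0k.fn {n k : ℕ} (u : C0k n k) : Rd n → ℝ := u.1 (zeroIdx n k)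

theorem continuous_partialDeriv {n k : ℕ} (β : MultiIdx n k) {φ : Rd n → ℝ}
    (hφ : ContDiff ℝ (⊤ : ℕ∞) φ) : Continuous (partialDeriv β φ) :=
  (ContinuousMultilinearMap.apply ℝ (fun _ => Rd n) ℝ (directions β)).continuous.comp
    (hφ.continuous_iteratedFDeriv (by exact_mod_cast le_top))

theorem hasCompactSupport_partialDeriv {n k : ℕ} (β : MultiIdx n k) {φ : Rd n → ℝ}
    (hφ : HasCompactSupport φ) : HasCompactSupport (partialDeriv β φ) :=
  (hφ.iteratedFDeriv (𝕜 := ℝ) (order β)).comp_left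
    (g := fun L : ContinuousMultilinearMap ℝ (fun _ : Fin (order β) => Rd n) ℝ =>
      L (directions β)) rfl

theorem integrable_L2_mul {n : ℕ} (u : Lp ℝ 2 (volume : Measure (Rd n))) {ψ : Rd n → ℝ}
    (hψ : Continuous ψ) (hc : HasCompactSupport ψ) :
    Integrable fun x => u x * ψ x :=
  ((Lp.memLp u).locallyIntegrable (by norm_num)).integrable_smul_right_of_hasCompactSupport hψ hc

/-- `Hᵏ(ℝᵈ)`, the (classes of) functions in `L²` all of whose weak derivatives of order at most `k`
exist and lie in `L²`. An element is stored as the family `(D^β u)` of its weak derivatives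
for `|β| ≤ k`, so that the norm is `(∑ ‖D^β u‖²_{L²})^(1/2)`. -/
def HkSubmodule (n k : ℕ) :
    Submodule ℝ (PiLp 2 fun _ : MultiIdx n k => Lp ℝ 2 (volume : Measure (Rd n))) where
  carrier := {u | ∀ β, IsWeakDeriv β (u (zeroIdx n k)) (u β)}
  add_mem' := by
    intro u v hu hv β φ hφ hc
    have e : ∀ (γ : MultiIdx n k) (ψ : Rd n → ℝ), Continuous ψ → HasCompactSupport ψ →
        ∫ x, ((u + v) γ : Rd n → ℝ) x * ψ x = (∫ x, u γ x * ψ x) + ∫ x, v γ x * ψ x := by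
      intro γ ψ h1 h2
      rw [← integral_add (integrable_L2_mul _ h1 h2) (integrable_L2_mul _ h1 h2)]
      refine integral_congr_ae ?_
      filter_upwards [Lp.coeFn_add (u γ) (v γ)] with x hx
      rw [PiLp.add_apply, hx, Pi.add_apply, add_mul]
    rw [e _ _ (continuous_partialDeriv β hφ) (hasCompactSupport_partialDeriv β hc),
      e _ _ hφ.continuous hc, hu β φ hφ hc, hv β φ hφ hc, mul_add]
  zero_mem' := by
    intro β φ hφ hc
    have e : ∀ (γ : MultiIdx n k) (ψ : Rd n → ℝ),
        ∫ x, ((0 : PiLp 2 fun _ : MultiIdx n k => Lp ℝ 2 (volume : Measure (Rd n))) γ :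
          Rd n → ℝ) x * ψ x = 0 := by
      intro γ ψ
      refine integral_eq_zero_of_ae ?_
      filter_upwards [Lp.coeFn_zero ℝ 2 (volume : Measure (Rd n))] with x hx
      rw [PiLp.zero_apply, hx]
      simp
    rw [e, e, mul_zero]
  smul_mem' := by
    intro c u hu β φ hφ hc
    have e : ∀ (γ : MultiIdx n k) (ψ : Rd n → ℝ),
        ∫ x, ((c • u) γ : Rd n → ℝ) x * ψ x = c * ∫ x, u γ x * ψ x := by
      intro γ ψ
      rw [← integral_const_mul]
      refine integral_congr_ae ?_
      filter_upwards [Lp.coeFn_smul c (u γ)] with x hx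
      rw [PiLp.smul_apply, hx, Pi.smul_apply, smul_eq_mul, mul_assoc]
    rw [e, e, hu β φ hφ hc]
    ring

/-- The space `Hᵏ(ℝᵈ)`, with the norm `(∑ ‖D^β u‖²_{L²})^(1/2)` over `|β| ≤ k`. -/
abbrev Hk (n k : ℕ) : Type := HkSubmodule n k

/-- The function (defined almost everywhere) given by an element of `Hᵏ(ℝᵈ)`. -/
def Hk.fn {n k : ℕ} (u : Hk n k) : Rd n → ℝ := u.1 (zeroIdx n k)

/-! ### Generators and the space `Y₀` -/

section Generators

variable {n : ℕ} {X : Type*} [NormedAddCommGroup X] [NormedSpace ℝ X]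

/-- `w = T_𝟙 a v [μ]`, that is, `(a(exp(tμ)) v - v) / t → w` in `X` as `t → 0`. -/
def HasGenerator (κ : ℝ) (A : SymGroup n → X →L[ℝ] X) (μ : SymAlg n) (v w : X) : Prop :=
  Tendsto (fun t : ℝ => t⁻¹ • (A (expG κ (t • μ)) v - v)) (𝓝[≠] 0) (𝓝 w)

theorem HasGenerator.add {κ : ℝ} {A : SymGroup n → X →L[ℝ] X} {μ : SymAlg n} {v w v' w' : X}
    (h : HasGenerator κ A μ v w) (h' : HasGenerator κ A μ v' w') :
    HasGenerator κ A μ (v + v') (w + w') := by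
  refine (Tendsto.add h h').congr fun t => ?_
  rw [map_add, ← smul_add]
  congr 1
  abel

theorem HasGenerator.smul {κ : ℝ} {A : SymGroup n → X →L[ℝ] X} {μ : SymAlg n} {v w : X} (c : ℝ)
    (h : HasGenerator κ A μ v w) : HasGenerator κ A μ (c • v) (c • w) := by
  refine (Tendsto.const_smul h c).congr fun t => ?_
  rw [map_smul, ← smul_sub, smul_comm]

variable {ι : Type*}

/-- The set `Y₀` of all `v ∈ X` for which `T_𝟙 a v [εⱼ]` exists for every `j`. -/
def Y0 (κ : ℝ) (A : SymGroup n → X →L[ℝ] X) (ε : ι → SymAlg n) : Submodule ℝ X where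
  carrier := {v | ∀ j, ∃ w, HasGenerator κ A (ε j) v w}
  add_mem' := fun h h' j =>
    let ⟨_, hw⟩ := h j
    let ⟨_, hw'⟩ := h' j
    ⟨_, hw.add hw'⟩
  zero_mem' := fun j => ⟨0, by simp [HasGenerator]⟩
  smul_mem' := fun c _ h j =>
    let ⟨_, hw⟩ := h j
    ⟨_, hw.smul c⟩

/-- `Y₀` as a type of its own, which carries the graph norm and not the norm of `X`. -/
structure Y0Space (κ : ℝ) (A : SymGroup n → X →L[ℝ] X) (ε : ι → SymAlg n) where
  /-- the element of `X` -/
  val : X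
  mem : val ∈ Y0 κ A ε

namespace Y0Space

variable {κ : ℝ} {A : SymGroup n → X →L[ℝ] X} {ε : ι → SymAlg n}

@[ext] theorem ext {u v : Y0Space κ A ε} (h : u.val = v.val) : u = v := by
  cases u; cases v; cases h; rfl

theorem val_injective : Function.Injective (val : Y0Space κ A ε → X) := fun _ _ => ext

/-- `T_𝟙 a v [εⱼ]` for `v ∈ Y₀`. -/
def gen (v : Y0Space κ A ε) (j : ι) : X := (v.mem j).choose

theorem hasGenerator_gen (v : Y0Space κ A ε) (j : ι) : HasGenerator κ A (ε j) v.val (v.gen j) :=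
  (v.mem j).choose_spec

instance : Zero (Y0Space κ A ε) := ⟨⟨0, zero_mem _⟩⟩
instance : Add (Y0Space κ A ε) := ⟨fun u v => ⟨u.val + v.val, add_mem u.mem v.mem⟩⟩
instance : Neg (Y0Space κ A ε) := ⟨fun u => ⟨-u.val, neg_mem u.mem⟩⟩
instance : Sub (Y0Space κ A ε) := ⟨fun u v => ⟨u.val - v.val, sub_mem u.mem v.mem⟩⟩
instance {R : Type*} [SMul R ℝ] [SMul R X] [IsScalarTower R ℝ X] : SMul R (Y0Space κ A ε) :=
  ⟨fun c u => ⟨c • u.val, by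
    rw [← one_smul ℝ u.val, ← smul_assoc]
    exact (Y0 κ A ε).smul_mem _ u.mem⟩⟩

instance : AddCommGroup (Y0Space κ A ε) :=
  val_injective.addCommGroup val rfl (fun _ _ => rfl) (fun _ => rfl) (fun _ _ => rfl)
    (fun _ _ => rfl) (fun _ _ => rfl)

/-- The inclusion `Y₀ → X` as an additive map. -/
def valHom : Y0Space κ A ε →+ X where
  toFun := val
  map_zero' := rfl
  map_add' _ _ := rfl

instance : Module ℝ (Y0Space κ A ε) :=
  val_injective.module ℝ valHom (fun _ _ => rfl)

theorem gen_add (u v : Y0Space κ A ε) : (u + v).gen = u.gen + v.gen :=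
  funext fun j => tendsto_nhds_unique ((u + v).hasGenerator_gen j)
    ((u.hasGenerator_gen j).add (v.hasGenerator_gen j))

theorem gen_smul (c : ℝ) (u : Y0Space κ A ε) : (c • u).gen = c • u.gen :=
  funext fun j => tendsto_nhds_unique ((c • u).hasGenerator_gen j)
    ((u.hasGenerator_gen j).smul c)

/-- The map `v ↦ (v, (T_𝟙 a v [εⱼ])ⱼ)` into `X × Xᴶ`, where the latter carries the norm
`‖v‖ + maxⱼ ‖wⱼ‖`. -/
def graph : Y0Space κ A ε →ₗ[ℝ] WithLp 1 (X × (ι → X)) where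
  toFun v := WithLp.toLp 1 (v.val, v.gen)
  map_add' u v := by rw [gen_add]; rfl
  map_smul' c u := by rw [gen_smul]; rfl

theorem graph_injective : Function.Injective (graph : Y0Space κ A ε →ₗ[ℝ] _) := fun _ _ h =>
  ext (congrArg (fun z : WithLp 1 (X × (ι → X)) => z.fst) h)

variable [Fintype ι]

instance : NormedAddCommGroup (Y0Space κ A ε) :=
  NormedAddCommGroup.induced _ _ graph graph_injective

instance : NormedSpace ℝ (Y0Space κ A ε) :=
  NormedSpace.induced ℝ _ _ graph

/-- The norm of `Y₀` is `‖v‖_X + maxⱼ ‖T_𝟙 a v [εⱼ]‖_X`. -/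
theorem norm_eq (v : Y0Space κ A ε) : ‖v‖ = ‖v.val‖ + ‖v.gen‖ :=
  WithLp.prod_norm_eq_of_L1 _

end Y0Space

end Generators

end BurgersSymmetry

end

noncomputable section

namespace BurgersSymmetry

/-! Everything follows from a general fact about a strongly continuous action `A` of a locally
compact group with C¹ operations on a Banach space. The group law with exponent `p - 1` makes `a` an
action, and that law is used throughout. The curves `t ↦ expG κ (t • εⱼ)` need not be one-parameter
subgroups for it; they are only C¹ curves through the identity whose velocities form a basis. This
is why `κ` is arbitrary.

The central point is that differentiability of `A(γⱼ(t))v` at `t = 0` along each of these curves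
already makes the whole orbit map C¹. By the inverse function theorem, products of the curves
parametrise a neighbourhood of the identity. Writing `A(γⱼ(s))v = v + s r(s)` with `r` continuous
and using joint continuity of `(g, v) ↦ A g v`, one obtains Fréchet differentiability at the
identity (`hasFDerivAt_action_prodCurve`). Left translation carries this to every point, with a
derivative depending continuously on the point (`contDiff_action_chart`). This gives (c).

The formula for the derivative has further consequences. It passes to limits when both the vectors
and their generators converge, so the graph norm is complete (`hasDerivAt_action_of_tendsto`).
Conjugating the curves by `g` expresses the generators of `A g v` through the adjoint action and the
vectors `A g wᵢ`, which gives invariance, boundedness and continuity on `Y₀`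
(`hasDerivAt_action_apply`). Density is Gårding's argument: averages of an orbit against a C¹ weight
concentrated near the identity (`dense_hasDerivAt`).

For the two concrete spaces it remains to prove completeness and strong continuity. The point
transformations are affine, so the chain rule expresses each `D^β` of the transformed function by
derivatives of the same order, with coefficients continuous in `g`. Strong continuity thereby
reduces to composition with affine maps on `C₀` and on `L²`. -/

/-- A topological group embedded in a normed space `W`, with `C¹` group operations and a global
parametrisation `chart` by the normed space `E` which is inverted by the restriction of `coord`. -/
structure EmbeddedGroup (G W E : Type*) [Group G] [TopologicalSpace G]
    [NormedAddCommGroup W] [NormedSpace ℝ W] [NormedAddCommGroup E] [NormedSpace ℝ E] where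
  emb : G → W
  isInducing_emb : IsInducing emb
  mulW : W × W → W
  emb_mul : ∀ g h, emb (g * h) = mulW (emb g, emb h)
  contDiffAt_mulW : ∀ g h, ContDiffAt ℝ 1 mulW (emb g, emb h)
  invW : W → W
  emb_inv : ∀ g, emb g⁻¹ = invW (emb g)
  contDiffAt_invW : ∀ g, ContDiffAt ℝ 1 invW (emb g)
  chart : E → G
  contDiff_chart : ContDiff ℝ 1 fun y => emb (chart y)
  coord : W → E
  dom : Set G
  dom_mem : dom ∈ 𝓝 (1 : G)
  contDiffAt_coord : ∀ g ∈ dom, ContDiffAt ℝ 1 coord (emb g)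
  coord_chart : ∀ y, coord (emb (chart y)) = y
  chart_coord : ∀ g ∈ dom, chart (coord (emb g)) = g
  chart_zero : chart 0 = 1

/-! ### Calculus in coordinates on an embedded group -/

namespace EmbeddedGroup

variable {G W E : Type*} [Group G] [TopologicalSpace G]
    [NormedAddCommGroup W] [NormedSpace ℝ W] [NormedAddCommGroup E] [NormedSpace ℝ E]
    (M : EmbeddedGroup G W E)

theorem one_mem_dom : (1 : G) ∈ M.dom := mem_of_mem_nhds M.dom_mem

theorem contDiffAt_coord_one : ContDiffAt ℝ 1 M.coord (M.emb 1) :=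
  M.contDiffAt_coord 1 M.one_mem_dom

theorem coord_one : M.coord (M.emb 1) = 0 := by
  rw [← M.chart_zero, M.coord_chart]

theorem continuous_emb : Continuous M.emb := M.isInducing_emb.continuous

theorem continuous_chart : Continuous M.chart :=
  M.isInducing_emb.continuous_iff.2 M.contDiff_chart.continuous

theorem contDiffAt_mul {Z : Type*} [NormedAddCommGroup Z] [NormedSpace ℝ Z] {a b : Z → W}
    {z : Z} {g h : G} (ha : ContDiffAt ℝ 1 a z) (hb : ContDiffAt ℝ 1 b z) (hg : a z = M.emb g)
    (hh : b z = M.emb h) : ContDiffAt ℝ 1 (fun x => M.mulW (a x, b x)) z := by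
  refine ContDiffAt.comp z (g := M.mulW) ?_ (ha.prodMk hb)
  rw [hg, hh]
  exact M.contDiffAt_mulW g h

theorem contDiffAt_inv {Z : Type*} [NormedAddCommGroup Z] [NormedSpace ℝ Z] {a : Z → W}
    {z : Z} {g : G} (ha : ContDiffAt ℝ 1 a z) (hg : a z = M.emb g) :
    ContDiffAt ℝ 1 (fun x => M.invW (a x)) z := by
  refine ContDiffAt.comp z (g := M.invW) ?_ ha
  rw [hg]
  exact M.contDiffAt_invW g

-- The topology is induced by `emb`, so continuity of the operations can be read off from their
-- extensions to the ambient space.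
include M in
theorem isTopologicalGroup : IsTopologicalGroup G where
  continuous_mul := by
    rw [M.isInducing_emb.continuous_iff, continuous_iff_continuousAt]
    intro z
    have h := ContinuousAt.comp (f := fun z : G × G => (M.emb z.1, M.emb z.2)) (x := z)
      (M.contDiffAt_mulW z.1 z.2).continuousAt
      (by have := M.continuous_emb; fun_prop)
    exact h.congr (Eventually.of_forall fun z => (M.emb_mul z.1 z.2).symm)
  continuous_inv := by
    rw [M.isInducing_emb.continuous_iff, continuous_iff_continuousAt]
    intro g
    have h := ContinuousAt.comp (f := M.emb) (x := g)
      (M.contDiffAt_invW g).continuousAt M.continuous_emb.continuousAt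
    exact h.congr (Eventually.of_forall fun z => (M.emb_inv z).symm)

/-- The group multiplication in coordinates. -/
def mulC (z : E × E) : E := M.coord (M.mulW (M.emb (M.chart z.1), M.emb (M.chart z.2)))

theorem mulC_eq (y z : E) : M.mulC (y, z) = M.coord (M.emb (M.chart y * M.chart z)) := by
  simp only [mulC, M.emb_mul]

theorem contDiffAt_mulC : ContDiffAt ℝ 1 M.mulC 0 := by
  have h1 : ContDiffAt ℝ 1 (fun z : E × E => M.emb (M.chart z.1)) 0 :=
    (M.contDiff_chart.comp contDiff_fst).contDiffAt
  have h2 : ContDiffAt ℝ 1 (fun z : E × E => M.emb (M.chart z.2)) 0 :=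
    (M.contDiff_chart.comp contDiff_snd).contDiffAt
  have h3 := M.contDiffAt_mul h1 h2 rfl rfl
  refine ContDiffAt.comp (0 : E × E) (g := M.coord) ?_ h3
  simp only [Prod.fst_zero, Prod.snd_zero, ← M.emb_mul, M.chart_zero, mul_one]
  exact M.contDiffAt_coord_one

/-- Because `chart 0` is the unit, `mulC` is the identity in each variable when the other vanishes;
these two restrictions determine the derivative at the origin. -/
theorem hasFDerivAt_mulC : HasFDerivAt M.mulC
    (ContinuousLinearMap.fst ℝ E E + ContinuousLinearMap.snd ℝ E E) 0 := by
  have h := (M.contDiffAt_mulC.differentiableAt one_ne_zero).hasFDerivAt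
  have e1 : (fderiv ℝ M.mulC 0).comp (ContinuousLinearMap.inl ℝ E E) = .id ℝ E := by
    have : HasFDerivAt (fun y : E => M.mulC (y, 0))
        ((fderiv ℝ M.mulC 0).comp (ContinuousLinearMap.inl ℝ E E)) 0 :=
      HasFDerivAt.comp (0 : E) (g := M.mulC) h (hasFDerivAt_prodMk_left (0 : E) (0 : E))
    refine this.unique ?_
    have e : (fun y : E => M.mulC (y, 0)) = id := by
      funext y
      rw [M.mulC_eq, M.chart_zero, mul_one, M.coord_chart, id]
    rw [e]
    exact hasFDerivAt_id 0
  have e2 : (fderiv ℝ M.mulC 0).comp (ContinuousLinearMap.inr ℝ E E) = .id ℝ E := by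
    have : HasFDerivAt (fun y : E => M.mulC (0, y))
        ((fderiv ℝ M.mulC 0).comp (ContinuousLinearMap.inr ℝ E E)) 0 :=
      HasFDerivAt.comp (0 : E) (g := M.mulC) h (hasFDerivAt_prodMk_right (0 : E) (0 : E))
    refine this.unique ?_
    have e : (fun y : E => M.mulC (0, y)) = id := by
      funext y
      rw [M.mulC_eq, M.chart_zero, one_mul, M.coord_chart, id]
    rw [e]
    exact hasFDerivAt_id 0
  have e : fderiv ℝ M.mulC 0 = ContinuousLinearMap.fst ℝ E E + ContinuousLinearMap.snd ℝ E E := by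
    ext z
    · simpa using DFunLike.congr_fun e1 z
    · simpa using DFunLike.congr_fun e2 z
  rwa [e] at h

theorem eventually_coord_mul [IsTopologicalGroup G] {Z : Type*} [TopologicalSpace Z] {z : Z}
    {a b : Z → G}
    (ha : Tendsto a (𝓝 z) (𝓝 1)) (hb : Tendsto b (𝓝 z) (𝓝 1)) :
    (fun x => M.coord (M.emb (a x * b x))) =ᶠ[𝓝 z]
      fun x => M.mulC (M.coord (M.emb (a x)), M.coord (M.emb (b x))) := by
  filter_upwards [ha.eventually M.dom_mem, hb.eventually M.dom_mem] with x hx hx'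
  rw [M.mulC_eq, M.chart_coord _ hx, M.chart_coord _ hx']

/-- `y ↦ ψ(y₀)⁻¹ ψ(y)` in coordinates, where `ψ` is the parametrisation. -/
def divC (z : E × E) : E :=
  M.coord (M.mulW (M.invW (M.emb (M.chart z.1)), M.emb (M.chart z.2)))

theorem divC_eq (y z : E) : M.divC (y, z) = M.coord (M.emb ((M.chart y)⁻¹ * M.chart z)) := by
  simp only [divC, M.emb_mul, M.emb_inv]

theorem contDiffAt_divC (y : E) : ContDiffAt ℝ 1 M.divC (y, y) := by
  have h1 : ContDiffAt ℝ 1 (fun z : E × E => M.emb (M.chart z.1)) (y, y) :=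
    (M.contDiff_chart.comp contDiff_fst).contDiffAt
  have h2 : ContDiffAt ℝ 1 (fun z : E × E => M.emb (M.chart z.2)) (y, y) :=
    (M.contDiff_chart.comp contDiff_snd).contDiffAt
  have h3 := M.contDiffAt_mul (M.contDiffAt_inv h1 rfl) h2 (M.emb_inv _).symm rfl
  refine ContDiffAt.comp (y, y) (g := M.coord) ?_ h3
  simp only [← M.emb_mul, ← M.emb_inv, inv_mul_cancel]
  exact M.contDiffAt_coord_one

/-- The left logarithmic derivative of the parametrisation. -/
def logDeriv (y : E) : E →L[ℝ] E := (fderiv ℝ M.divC (y, y)).comp (ContinuousLinearMap.inr ℝ E E)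

theorem hasFDerivAt_divC (y : E) : HasFDerivAt (fun z => M.divC (y, z)) (M.logDeriv y) y :=
  HasFDerivAt.comp (y : E) (g := M.divC)
    ((M.contDiffAt_divC y).differentiableAt one_ne_zero).hasFDerivAt (hasFDerivAt_prodMk_right y y)

/-- `divC` is C¹ jointly in both variables at each diagonal point, so its derivative is continuous
there, also when the base point moves. -/
theorem continuous_logDeriv : Continuous M.logDeriv := by
  rw [continuous_iff_continuousAt]
  intro y
  have h1 : ContinuousAt (fderiv ℝ M.divC) (y, y) :=
    (M.contDiffAt_divC y).continuousAt_fderiv one_ne_zero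
  have h2 : ContinuousAt (fun y : E => fderiv ℝ M.divC (y, y)) y :=
    ContinuousAt.comp (f := fun y : E => (y, y)) (g := fderiv ℝ M.divC) h1 (by fun_prop)
  exact h2.clm_comp continuousAt_const

theorem logDeriv_zero : M.logDeriv 0 = .id ℝ E := by
  refine (M.hasFDerivAt_divC 0).unique ?_
  have e : (fun y : E => M.divC (0, y)) = id := by
    funext y
    rw [M.divC_eq, M.chart_zero, inv_one, one_mul, M.coord_chart, id]
  rw [e]
  exact hasFDerivAt_id 0

end EmbeddedGroup

/-! ### Strongly continuous actions -/

/-- No differentiability of `h` is needed, since the scalar factor vanishes at the origin and the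
error is `c y • (h y - h 0)`. -/
theorem hasFDerivAt_smul_of_continuousAt {E X : Type*} [NormedAddCommGroup E] [NormedSpace ℝ E]
    [NormedAddCommGroup X] [NormedSpace ℝ X]
    (c : E →L[ℝ] ℝ) {h : E → X} (hh : ContinuousAt h 0) :
    HasFDerivAt (fun y => c y • h y) (c.smulRight (h 0)) 0 := by
  rw [hasFDerivAt_iff_isLittleO_nhds_zero]
  have h1 : (fun y => h y - h 0) =o[𝓝 0] (fun _ => (1 : ℝ)) := by
    rw [Asymptotics.isLittleO_one_iff]
    simpa using hh.tendsto.sub_const (h 0)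
  have h2 := (c.isBigO_id (𝓝 0)).norm_right.smul_isLittleO h1
  refine (h2.congr (g₂ := fun y => ‖y‖) (fun y => ?_) (fun y => ?_)).of_norm_right
  · simp [smul_sub]
  · simp

section Action

variable {G X : Type*} [Group G] [TopologicalSpace G] [LocallyCompactSpace G]
  [NormedAddCommGroup X] [NormedSpace ℝ X] [CompleteSpace X]
  {A : G →* (X →L[ℝ] X)}

theorem action_mul {G X : Type*} [Group G] [NormedAddCommGroup X] [NormedSpace ℝ X]
    (A : G →* (X →L[ℝ] X)) (g h : G) (v : X) : A (g * h) v = A g (A h v) := by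
  rw [map_mul]; rfl

theorem action_one {G X : Type*} [Group G] [NormedAddCommGroup X] [NormedSpace ℝ X]
    (A : G →* (X →L[ℝ] X)) (v : X) : A 1 v = v := by
  rw [map_one]; rfl

/-- Orbits are bounded on compact sets, so the uniform boundedness principle applies. -/
theorem bound_on_compact {G X : Type*} [Group G] [TopologicalSpace G]
    [NormedAddCommGroup X] [NormedSpace ℝ X] [CompleteSpace X] {A : G →* (X →L[ℝ] X)}
    (hA : ∀ v, Continuous fun g => A g v) {K : Set G} (hK : IsCompact K) :
    ∃ C, ∀ g ∈ K, ‖A g‖ ≤ C := by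
  obtain ⟨C, hC⟩ := banach_steinhaus (g := fun g : K => A g) fun v => by
    obtain ⟨C, hC⟩ := hK.exists_bound_of_continuousOn (hA v).continuousOn
    exact ⟨C, fun g => hC g g.2⟩
  exact ⟨C, fun g hg => hC ⟨g, hg⟩⟩

theorem eventually_bound (hA : ∀ v, Continuous fun g => A g v) (g : G) :
    ∃ C, 0 < C ∧ ∀ᶠ h in 𝓝 g, ‖A h‖ ≤ C := by
  obtain ⟨K, hK, hg⟩ := exists_compact_mem_nhds g
  obtain ⟨C, hC⟩ := bound_on_compact hA hK
  exact ⟨max C 1, by positivity, by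
    filter_upwards [hg] with h hh using (hC h hh).trans (le_max_left _ _)⟩

/-- Local boundedness of the operator norms upgrades strong continuity to joint continuity in the
group element and the vector. -/
theorem tendsto_action (hA : ∀ v, Continuous fun g => A g v) {Z : Type*} {l : Filter Z}
    {a : Z → G} {f : Z → X} {g : G} {v : X} (ha : Tendsto a l (𝓝 g)) (hf : Tendsto f l (𝓝 v)) :
    Tendsto (fun z => A (a z) (f z)) l (𝓝 (A g v)) := by
  obtain ⟨C, hC, hb⟩ := eventually_bound hA g
  have h1 : Tendsto (fun z => A (a z) (f z - v)) l (𝓝 0) := by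
    refine squeeze_zero_norm' (a := fun z => C * ‖f z - v‖) ?_ ?_
    · filter_upwards [ha.eventually hb] with z hz
      exact ((A (a z)).le_opNorm _).trans (by gcongr)
    · have : Tendsto (fun z => f z - v) l (𝓝 0) := by simpa using hf.sub_const v
      simpa using this.norm.const_mul C
  have h2 := h1.add (((hA v).tendsto g).comp ha)
  rw [zero_add] at h2
  refine h2.congr fun z => ?_
  simp

end Action

/-! ### Frames of curves and differentiability of orbits -/

/-- Curves through the identity of an embedded group whose tangent vectors are the standard basis. -/
structure IsFrame {G W ι : Type*} [Group G] [TopologicalSpace G] [NormedAddCommGroup W]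
    [NormedSpace ℝ W] [Fintype ι] [DecidableEq ι] (M : EmbeddedGroup G W (ι → ℝ))
    (γ : ι → ℝ → G) : Prop where
  zero : ∀ j, γ j 0 = 1
  contDiff : ∀ j, ContDiff ℝ 1 fun t => M.emb (γ j t)
  hasDerivAt : ∀ j, HasDerivAt (fun t => M.coord (M.emb (γ j t))) (Pi.single j 1) 0

/-- The linear map `y ↦ ∑ⱼ yⱼ wⱼ`. -/
def combine {ι X : Type*} [Fintype ι] [NormedAddCommGroup X] [NormedSpace ℝ X] (w : ι → X) :
    (ι → ℝ) →L[ℝ] X :=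
  ∑ j, (ContinuousLinearMap.proj (R := ℝ) (φ := fun _ : ι => ℝ) j).smulRight (w j)

theorem combine_apply {ι X : Type*} [Fintype ι] [NormedAddCommGroup X] [NormedSpace ℝ X]
    (w : ι → X) (y : ι → ℝ) : combine w y = ∑ j, y j • w j := by
  simp [combine]

theorem combine_single {ι X : Type*} [Fintype ι] [DecidableEq ι] [NormedAddCommGroup X]
    [NormedSpace ℝ X] (w : ι → X) (j : ι) : combine w (Pi.single j 1) = w j := by
  rw [combine_apply, Finset.sum_eq_single j] <;> simp +contextual

theorem continuous_combine {ι X : Type*} [Fintype ι] [NormedAddCommGroup X] [NormedSpace ℝ X] :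
    Continuous (combine : (ι → X) → ((ι → ℝ) →L[ℝ] X)) := by
  unfold combine
  refine continuous_finsetSum _ fun j _ => ?_
  exact ((ContinuousLinearMap.smulRightL ℝ (ι → ℝ) X
    (ContinuousLinearMap.proj (R := ℝ) (φ := fun _ : ι => ℝ) j)).continuous.comp
      (continuous_apply j))

theorem comp_combine {ι X Y : Type*} [Fintype ι] [NormedAddCommGroup X] [NormedSpace ℝ X]
    [NormedAddCommGroup Y] [NormedSpace ℝ Y] (L : X →L[ℝ] Y) (w : ι → X) :
    L.comp (combine w) = combine fun j => L (w j) := by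
  ext y
  simp [combine_apply]

section Frame

variable {G W X ι : Type*} [Group G] [TopologicalSpace G] [IsTopologicalGroup G]
  [LocallyCompactSpace G] [NormedAddCommGroup W] [NormedSpace ℝ W] [Fintype ι] [DecidableEq ι]
  [NormedAddCommGroup X] [NormedSpace ℝ X] [CompleteSpace X]
  {M : EmbeddedGroup G W (ι → ℝ)} {γ : ι → ℝ → G} {A : G →* (X →L[ℝ] X)}

theorem IsFrame.continuous {G W ι : Type*} [Group G] [TopologicalSpace G] [NormedAddCommGroup W]
    [NormedSpace ℝ W] [Fintype ι] [DecidableEq ι] {M : EmbeddedGroup G W (ι → ℝ)}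
    {γ : ι → ℝ → G} (hγ : IsFrame M γ) (j : ι) : Continuous (γ j) :=
  M.isInducing_emb.continuous_iff.2 (hγ.contDiff j).continuous

theorem IsFrame.tendsto {G W ι : Type*} [Group G] [TopologicalSpace G] [NormedAddCommGroup W]
    [NormedSpace ℝ W] [Fintype ι] [DecidableEq ι] {M : EmbeddedGroup G W (ι → ℝ)}
    {γ : ι → ℝ → G} (hγ : IsFrame M γ) (j : ι) : Tendsto (γ j) (𝓝 0) (𝓝 1) := by
  have := (hγ.continuous j).tendsto 0
  rwa [hγ.zero] at this

/-- The products `γ_{jₘ}(t_{jₘ}) ⋯ γ_{j₁}(t_{j₁})` for a list `j₁, …, jₘ`. -/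
def prodCurve {G ι : Type*} [Group G] (γ : ι → ℝ → G) : List ι → (ι → ℝ) → G
  | [], _ => 1
  | j :: l, t => prodCurve γ l t * γ j (t j)

section ProdCurve

variable {G W ι : Type*} [Group G] [TopologicalSpace G] [NormedAddCommGroup W]
    [NormedSpace ℝ W] [Fintype ι] [DecidableEq ι] {M : EmbeddedGroup G W (ι → ℝ)}
    {γ : ι → ℝ → G}

theorem prodCurve_zero (hγ : IsFrame M γ) (l : List ι) : prodCurve γ l 0 = 1 := by
  induction l with
  | nil => rfl
  | cons j l ih => simp [prodCurve, ih, hγ.zero]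

theorem contDiff_prodCurve (hγ : IsFrame M γ) (l : List ι) :
    ContDiff ℝ 1 fun t => M.emb (prodCurve γ l t) := by
  induction l with
  | nil => exact contDiff_const (c := M.emb 1)
  | cons j l ih =>
    simp only [prodCurve, M.emb_mul]
    rw [contDiff_iff_contDiffAt]
    intro t
    refine M.contDiffAt_mul ih.contDiffAt ?_ rfl rfl
    exact ((hγ.contDiff j).comp (contDiff_apply ℝ ℝ j)).contDiffAt

theorem tendsto_prodCurve (hγ : IsFrame M γ) (l : List ι) :
    Tendsto (prodCurve γ l) (𝓝 0) (𝓝 1) := by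
  have h : Continuous (prodCurve γ l) :=
    M.isInducing_emb.continuous_iff.2 (contDiff_prodCurve hγ l).continuous
  have := h.tendsto 0
  rwa [prodCurve_zero hγ] at this

/-- To first order the multiplication is addition in coordinates, so each factor contributes its own
velocity. For a list of all indices without repetition the sum is the identity. -/
theorem hasFDerivAt_prodCurve [IsTopologicalGroup G] (hγ : IsFrame M γ) (l : List ι) :
    HasFDerivAt (fun t => M.coord (M.emb (prodCurve γ l t)))
      (l.map fun j => (ContinuousLinearMap.proj (R := ℝ) (φ := fun _ : ι => ℝ) j).smulRight
        (Pi.single j (1 : ℝ) : ι → ℝ)).sum 0 := by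
  induction l with
  | nil => exact hasFDerivAt_const (M.coord (M.emb 1)) (0 : ι → ℝ)
  | cons j l ih =>
    have h1 : HasFDerivAt (fun t : ι → ℝ => M.coord (M.emb (γ j (t j))))
        ((ContinuousLinearMap.proj (R := ℝ) (φ := fun _ : ι => ℝ) j).smulRight
          (Pi.single j (1 : ℝ) : ι → ℝ)) 0 := by
      have h2 : HasFDerivAt (fun t : ι → ℝ => t j)
        (ContinuousLinearMap.proj (R := ℝ) (φ := fun _ : ι => ℝ) j) 0 :=
        (ContinuousLinearMap.proj (R := ℝ) (φ := fun _ : ι => ℝ) j).hasFDerivAt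
      refine (HasFDerivAt.comp (0 : ι → ℝ) (g := fun t => M.coord (M.emb (γ j t)))
        (hγ.hasDerivAt j).hasFDerivAt h2).congr_fderiv ?_
      ext y : 1
      simp
    have h3 : Tendsto (fun t : ι → ℝ => γ j (t j)) (𝓝 0) (𝓝 1) :=
      (hγ.tendsto j).comp ((continuous_apply j).tendsto (0 : ι → ℝ))
    refine HasFDerivAt.congr_of_eventuallyEq ?_
      (M.eventually_coord_mul (tendsto_prodCurve hγ l) h3)
    have h4 := ih.prodMk h1
    have h5 : HasFDerivAt M.mulC (ContinuousLinearMap.fst ℝ (ι → ℝ) (ι → ℝ) +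
        ContinuousLinearMap.snd ℝ (ι → ℝ) (ι → ℝ))
        (M.coord (M.emb (prodCurve γ l 0)), M.coord (M.emb (γ j ((0 : ι → ℝ) j)))) := by
      rw [prodCurve_zero hγ, Pi.zero_apply, hγ.zero, M.coord_one]
      exact M.hasFDerivAt_mulC
    have h6 := HasFDerivAt.comp (0 : ι → ℝ) (g := M.mulC) h5 h4
    refine h6.congr_fderiv ?_
    ext y : 1
    simp [add_comm]

/-- Near the identity the group is parametrised by products of the curves of a frame. -/
theorem exists_prodCurve_eq_chart [IsTopologicalGroup G] (hγ : IsFrame M γ) :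
    ∃ τ : (ι → ℝ) → ι → ℝ, HasFDerivAt τ (.id ℝ (ι → ℝ)) 0 ∧ τ 0 = 0 ∧
      ∀ᶠ y in 𝓝 0, M.chart y = prodCurve γ Finset.univ.toList (τ y) := by
  set P : (ι → ℝ) → ι → ℝ := fun t => M.coord (M.emb (prodCurve γ Finset.univ.toList t)) with hP
  have hP0 : P 0 = 0 := by rw [hP]; simp only [prodCurve_zero hγ, M.coord_one]
  have h1 : ContDiffAt ℝ 1 P 0 := by
    refine ContDiffAt.comp (0 : ι → ℝ) (g := M.coord) ?_ (contDiff_prodCurve hγ _).contDiffAt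
    rw [prodCurve_zero hγ]
    exact M.contDiffAt_coord_one
  have h2 := h1.hasStrictFDerivAt one_ne_zero
  have h3 : fderiv ℝ P 0 = .id ℝ (ι → ℝ) := by
    refine h2.hasFDerivAt.unique ?_
    refine (hasFDerivAt_prodCurve hγ Finset.univ.toList).congr_fderiv ?_
    rw [Finset.sum_map_toList]
    ext y : 1
    simp [← Pi.single_smul]
    exact Finset.univ_sum_single y
  rw [h3] at h2
  have h4 : HasStrictFDerivAt P
    ((ContinuousLinearEquiv.refl ℝ (ι → ℝ) : (ι → ℝ) ≃L[ℝ] (ι → ℝ)) : (ι → ℝ) →L[ℝ] (ι → ℝ)) 0 := h2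
  -- The times `τ y` are found by inverting `P`; applying `chart` to `P (τ y) = y` recovers the
  -- group element because the product stays in `dom` near the identity.
  refine ⟨h4.localInverse P _ 0, ?_, ?_, ?_⟩
  · have := h4.to_localInverse.hasFDerivAt
    rwa [hP0] at this
  · have := h4.localInverse_apply_image
    rwa [hP0] at this
  · have h5 := h4.eventually_right_inverse
    have h6 := h4.localInverse_continuousAt
    have h7 := h4.localInverse_apply_image
    rw [hP0] at h5 h6 h7
    have h8 : Tendsto (h4.localInverse P _ 0) (𝓝 0) (𝓝 0) := by
      have := h6.tendsto
      rwa [h7] at this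
    filter_upwards [h5, ((tendsto_prodCurve hγ Finset.univ.toList).comp h8).eventually M.dom_mem]
      with y hy hy'
    have h9 := M.chart_coord _ hy'
    exact (congrArg M.chart hy).symm.trans h9

end ProdCurve

-- The newest factor acts directly on `v`, where differentiability is assumed. The earlier factors
-- are then applied to a difference quotient, for which joint continuity suffices; no intermediate
-- vector has to lie in the domain of the generators.
omit [IsTopologicalGroup G] in
theorem hasFDerivAt_action_prodCurve (hA : ∀ v, Continuous fun g => A g v) (hγ : IsFrame M γ)
    {v : X} {w : ι → X} (hw : ∀ j, HasDerivAt (fun t => A (γ j t) v) (w j) 0) (l : List ι) :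
    HasFDerivAt (fun t => A (prodCurve γ l t) v)
      (l.map fun j => (ContinuousLinearMap.proj (R := ℝ) (φ := fun _ : ι => ℝ) j).smulRight
        (w j)).sum 0 := by
  induction l with
  | nil => exact hasFDerivAt_const (A 1 v) (0 : ι → ℝ)
  | cons j l ih =>
    -- The quotient `(A(γⱼ(s))v - v)/s`, extended by `w j` at `s = 0`, is continuous at `0`.
    set r : ℝ → X := dslope (fun t => A (γ j t) v) 0 with hr
    have hr0 : r 0 = w j := by rw [hr, dslope_same, (hw j).deriv]
    have hrc : Tendsto r (𝓝 0) (𝓝 (w j)) := by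
      have : ContinuousAt r 0 := continuousAt_dslope_same.2 (hw j).differentiableAt
      rw [← hr0]
      exact this
    have h1 : ContinuousAt (fun t : ι → ℝ => A (prodCurve γ l t) (r (t j))) 0 := by
      have := tendsto_action hA (tendsto_prodCurve hγ l)
        (hrc.comp ((continuous_apply j).tendsto (0 : ι → ℝ)))
      rw [ContinuousAt, prodCurve_zero hγ, Pi.zero_apply, hr0]
      exact this
    have h2 := hasFDerivAt_smul_of_continuousAt
      (ContinuousLinearMap.proj (R := ℝ) (φ := fun _ : ι => ℝ) j) h1
    rw [prodCurve_zero hγ, Pi.zero_apply, hr0, action_one] at h2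
    have h3 := h2.add ih
    rw [List.map_cons, List.sum_cons]
    refine h3.congr_of_eventuallyEq (Eventually.of_forall fun t => ?_)
    have h4 := sub_smul_dslope (fun t => A (γ j t) v) 0 (t j)
    simp only [sub_zero, hγ.zero, action_one, ← hr] at h4
    simp only [prodCurve, action_mul, Pi.add_apply, ContinuousLinearMap.proj_apply]
    rw [← map_smul, h4, map_sub]
    abel

theorem hasFDerivAt_action_chart_zero (hA : ∀ v, Continuous fun g => A g v) (hγ : IsFrame M γ)
    {v : X} {w : ι → X} (hw : ∀ j, HasDerivAt (fun t => A (γ j t) v) (w j) 0) :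
    HasFDerivAt (fun y => A (M.chart y) v) (combine w) 0 := by
  obtain ⟨τ, h1, h2, h3⟩ := exists_prodCurve_eq_chart hγ
  have h4 := hasFDerivAt_action_prodCurve hA hγ hw Finset.univ.toList
  rw [Finset.sum_map_toList, ← h2] at h4
  have h5 := HasFDerivAt.comp (0 : ι → ℝ) h4 h1
  refine HasFDerivAt.congr_of_eventuallyEq h5 ?_
  filter_upwards [h3] with y hy
  rw [hy]
  rfl

/-- Writing `A(ψ(z))v = A(ψ(y)) A(ψ(y)⁻¹ψ(z))v` for the chart `ψ` reduces the derivative at `y` to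
the one at the identity; `logDeriv` is the inner derivative. -/
theorem hasFDerivAt_action_chart (hA : ∀ v, Continuous fun g => A g v) (hγ : IsFrame M γ)
    {v : X} {w : ι → X} (hw : ∀ j, HasDerivAt (fun t => A (γ j t) v) (w j) 0) (y : ι → ℝ) :
    HasFDerivAt (fun y => A (M.chart y) v)
      ((A (M.chart y)).comp ((combine w).comp (M.logDeriv y))) y := by
  have h1 := hasFDerivAt_action_chart_zero hA hγ hw
  have h0 : M.divC (y, y) = 0 := by rw [M.divC_eq, inv_mul_cancel, M.coord_one]
  rw [← h0] at h1
  have h2 := HasFDerivAt.comp y (f := fun z => M.divC (y, z)) h1 (M.hasFDerivAt_divC y)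
  have h3 := HasFDerivAt.comp y (g := A (M.chart y)) (A (M.chart y)).hasFDerivAt h2
  refine h3.congr_of_eventuallyEq ?_
  have h4 : Tendsto (fun z => (M.chart y)⁻¹ * M.chart z) (𝓝 y) (𝓝 1) := by
    rw [← inv_mul_cancel (M.chart y)]
    exact (M.continuous_chart.tendsto y).const_mul _
  filter_upwards [h4.eventually M.dom_mem] with z hz
  simp only [Function.comp]
  rw [M.divC_eq, M.chart_coord _ hz, ← action_mul, mul_inv_cancel_left]

theorem contDiff_action_chart (hA : ∀ v, Continuous fun g => A g v) (hγ : IsFrame M γ)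
    {v : X} {w : ι → X} (hw : ∀ j, HasDerivAt (fun t => A (γ j t) v) (w j) 0) :
    ContDiff ℝ 1 fun y => A (M.chart y) v := by
  rw [contDiff_one_iff_hasFDerivAt]
  refine ⟨_, ?_, hasFDerivAt_action_chart hA hγ hw⟩
  -- `y ↦ A (M.chart y)` is only strongly continuous. Moving it onto the finitely many vectors `w j`
  -- turns strong continuity into continuity in operator norm.
  have e : (fun y => (A (M.chart y)).comp ((combine w).comp (M.logDeriv y))) =
      fun y => (combine fun j => A (M.chart y) (w j)).comp (M.logDeriv y) := by
    funext y
    rw [← ContinuousLinearMap.comp_assoc, comp_combine]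
  rw [e]
  refine Continuous.clm_comp (continuous_combine.comp ?_) M.continuous_logDeriv
  exact continuous_pi fun j => (hA _).comp M.continuous_chart

-- Once the orbit is Fréchet differentiable at the identity, any curve through the identity may be
-- used, not only those of the frame; conjugated curves need this.
omit [IsTopologicalGroup G] [LocallyCompactSpace G] [DecidableEq ι] [CompleteSpace X] in
theorem hasDerivAt_action_curve {v : X} {L : (ι → ℝ) →L[ℝ] X}
    (h : HasFDerivAt (fun y => A (M.chart y) v) L 0) {δ : ℝ → G} (hδ : Tendsto δ (𝓝 0) (𝓝 1))
    (hδ0 : δ 0 = 1) {e : ι → ℝ} (he : HasDerivAt (fun t => M.coord (M.emb (δ t))) e 0) :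
    HasDerivAt (fun t => A (δ t) v) (L e) 0 := by
  have h0 : M.coord (M.emb (δ 0)) = 0 := by rw [hδ0, M.coord_one]
  rw [← h0] at h
  have h1 := HasFDerivAt.comp_hasDerivAt (0 : ℝ) h he
  refine h1.congr_of_eventuallyEq ?_
  filter_upwards [hδ.eventually M.dom_mem] with t ht
  simp only [Function.comp]
  rw [M.chart_coord _ ht]

/-- This is the closedness of the generators. For a single curve, pointwise derivatives at `0` would
not pass to the limit; here the derivatives are known in a whole neighbourhood in the chart and
converge uniformly there. -/
theorem hasDerivAt_action_of_tendsto (hA : ∀ v, Continuous fun g => A g v) (hγ : IsFrame M γ)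
    {v : ℕ → X} {w : ℕ → ι → X}
    (hw : ∀ m j, HasDerivAt (fun t => A (γ j t) (v m)) (w m j) 0) {v' : X} {w' : ι → X}
    (hv' : Tendsto v atTop (𝓝 v')) (hw' : Tendsto w atTop (𝓝 w')) (j : ι) :
    HasDerivAt (fun t => A (γ j t) v') (w' j) 0 := by
  have key : HasFDerivAt (fun y => A (M.chart y) v')
      ((A (M.chart 0)).comp ((combine w').comp (M.logDeriv 0))) 0 := by
    refine hasFDerivAt_of_tendstoUniformlyOnFilter (l := atTop)
      (f := fun m y => A (M.chart y) (v m))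
      (f' := fun m y => (A (M.chart y)).comp ((combine (w m)).comp (M.logDeriv y)))
      (g' := fun y => (A (M.chart y)).comp ((combine w').comp (M.logDeriv y))) ?_
      (Eventually.of_forall fun z => hasFDerivAt_action_chart hA hγ (hw z.1) z.2)
      (Eventually.of_forall fun y => ((A (M.chart y)).continuous.tendsto v').comp hv')
    obtain ⟨C, hC, hb⟩ := eventually_bound hA (M.chart 0)
    have hb' := (M.continuous_chart.tendsto 0).eventually hb
    have hl : ∀ᶠ y in 𝓝 (0 : ι → ℝ), ‖M.logDeriv y‖ < ‖M.logDeriv 0‖ + 1 :=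
      (M.continuous_logDeriv.norm.tendsto 0).eventually_lt_const (lt_add_one _)
    have hc : Tendsto (fun m => combine (w m)) atTop (𝓝 (combine w')) :=
      (continuous_combine.tendsto w').comp hw'
    rw [Metric.tendstoUniformlyOnFilter_iff]
    intro η hη
    have hc' : ∀ᶠ m in atTop, ‖combine (w m) - combine w'‖ < η / (C * (‖M.logDeriv 0‖ + 1)) := by
      have h1 : Tendsto (fun m => ‖combine (w m) - combine w'‖) atTop (𝓝 0) := by
        simpa using (hc.sub_const (combine w')).norm
      exact h1.eventually_lt_const (by positivity)
    filter_upwards [hc'.prod_mk (hb'.and hl)] with z hz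
    obtain ⟨h1, h2, h3⟩ := hz
    rw [dist_comm, dist_eq_norm, ← ContinuousLinearMap.comp_sub, ← ContinuousLinearMap.sub_comp]
    calc _ ≤ ‖A (M.chart z.2)‖ * (‖combine (w z.1) - combine w'‖ * ‖M.logDeriv z.2‖) :=
          (ContinuousLinearMap.opNorm_comp_le _ _).trans
            (by gcongr; exact ContinuousLinearMap.opNorm_comp_le _ _)
      _ ≤ C * (‖combine (w z.1) - combine w'‖ * (‖M.logDeriv 0‖ + 1)) := by gcongr
      _ < C * (η / (C * (‖M.logDeriv 0‖ + 1)) * (‖M.logDeriv 0‖ + 1)) := by gcongr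
      _ = η := by field_simp
  rw [M.chart_zero, M.logDeriv_zero, map_one] at key
  have := hasDerivAt_action_curve key (hγ.tendsto j) (hγ.zero j) (hγ.hasDerivAt j)
  rw [← combine_single w' j]
  exact this

/-- The adjoint action `Ad(g⁻¹) eⱼ`, in coordinates. -/
def adjVec (M : EmbeddedGroup G W (ι → ℝ)) (γ : ι → ℝ → G) (j : ι) (g : G) : ι → ℝ :=
  deriv (fun t => M.coord (M.emb (g⁻¹ * γ j t * g))) 0

-- The conjugation is taken as a C¹ function of the ambient point and of `t` together, so that its
-- `t`-derivative depends continuously on `g`.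
omit [IsTopologicalGroup G] [LocallyCompactSpace G] in
theorem adjVec_aux (hγ : IsFrame M γ) (j : ι) (g : G) :
    ContDiffAt ℝ 1 (fun z : W × ℝ =>
      M.coord (M.mulW (M.mulW (M.invW z.1, M.emb (γ j z.2)), z.1))) (M.emb g, 0) := by
  have h1 : ContDiffAt ℝ 1 (fun z : W × ℝ => z.1) (M.emb g, 0) := contDiffAt_fst
  have h2 : ContDiffAt ℝ 1 (fun z : W × ℝ => M.emb (γ j z.2)) (M.emb g, 0) :=
    ((hγ.contDiff j).comp contDiff_snd).contDiffAt
  have h3 := M.contDiffAt_mul (M.contDiffAt_inv h1 rfl) h2 (M.emb_inv g).symm rfl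
  have h4 := M.contDiffAt_mul (g := g⁻¹ * γ j 0) h3 h1 (by rw [M.emb_mul, M.emb_inv]) rfl
  refine ContDiffAt.comp _ (g := M.coord) ?_ h4
  simp only [← M.emb_inv, ← M.emb_mul, hγ.zero, mul_one, inv_mul_cancel]
  exact M.contDiffAt_coord_one

omit [IsTopologicalGroup G] [LocallyCompactSpace G] in
theorem hasDerivAt_conj (hγ : IsFrame M γ) (j : ι) (g : G) :
    HasDerivAt (fun t => M.coord (M.emb (g⁻¹ * γ j t * g)))
      (fderiv ℝ (fun z : W × ℝ =>
      M.coord (M.mulW (M.mulW (M.invW z.1, M.emb (γ j z.2)), z.1))) (M.emb g, 0) (0, 1)) 0 := by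
  have h := ((adjVec_aux hγ j g).differentiableAt one_ne_zero).hasFDerivAt
  have h2 : HasDerivAt (fun t : ℝ => (M.emb g, t)) ((0 : W), (1 : ℝ)) 0 :=
    (hasDerivAt_const _ _).prodMk (hasDerivAt_id _)
  have h3 := HasFDerivAt.comp_hasDerivAt (0 : ℝ) h h2
  refine h3.congr_of_eventuallyEq (Eventually.of_forall fun t => ?_)
  simp only [Function.comp, M.emb_mul, M.emb_inv]

omit [IsTopologicalGroup G] [LocallyCompactSpace G] in
theorem continuous_adjVec (hγ : IsFrame M γ) (j : ι) : Continuous (adjVec M γ j) := by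
  have e : adjVec M γ j = fun g => _ := funext fun g => (hasDerivAt_conj hγ j g).deriv
  rw [e, continuous_iff_continuousAt]
  intro g
  have h1 := (adjVec_aux hγ j g).continuousAt_fderiv one_ne_zero
  have h2 := ContinuousAt.comp (f := fun g => (M.emb g, (0 : ℝ))) (x := g) h1
    (M.continuous_emb.prodMk continuous_const).continuousAt
  exact h2.clm_apply continuousAt_const

/-- Since `γⱼ(t) g = g (g⁻¹ γⱼ(t) g)`, the curve acting on `A g v` becomes a conjugated curve acting
on `v`, followed by the fixed operator `A g`. -/
theorem hasDerivAt_action_apply (hA : ∀ v, Continuous fun g => A g v) (hγ : IsFrame M γ)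
    {v : X} {w : ι → X} (hw : ∀ j, HasDerivAt (fun t => A (γ j t) v) (w j) 0) (g : G) (j : ι) :
    HasDerivAt (fun t => A (γ j t) (A g v)) (∑ i, adjVec M γ j g i • A g (w i)) 0 := by
  have h1 : Tendsto (fun t => g⁻¹ * γ j t * g) (𝓝 0) (𝓝 1) := by
    have := ((hγ.tendsto j).const_mul g⁻¹).mul_const g
    simpa using this
  have h2 := hasDerivAt_action_curve (hasFDerivAt_action_chart_zero hA hγ hw) h1
    (by simp [hγ.zero]) (hasDerivAt_conj hγ j g).differentiableAt.hasDerivAt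
  have h3 := HasFDerivAt.comp_hasDerivAt (0 : ℝ) (A g).hasFDerivAt h2
  have e : (∑ i, adjVec M γ j g i • A g (w i)) = A g (combine w (adjVec M γ j g)) := by
    simp [combine_apply]
  rw [e]
  refine h3.congr_of_eventuallyEq (Eventually.of_forall fun t => ?_)
  simp only [Function.comp, ← action_mul]
  congr 2
  group

end Frame

/-! ### Density of the differentiable vectors -/

section Garding

variable {G W X ι : Type*} [Group G] [TopologicalSpace G] [IsTopologicalGroup G]
  [LocallyCompactSpace G] [NormedAddCommGroup W] [NormedSpace ℝ W] [Fintype ι] [DecidableEq ι]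
  [NormedAddCommGroup X] [NormedSpace ℝ X] [CompleteSpace X]
  {M : EmbeddedGroup G W (ι → ℝ)} {γ : ι → ℝ → G} {A : G →* (X →L[ℝ] X)}

omit [IsTopologicalGroup G] [LocallyCompactSpace G] in
theorem contDiffAt_translate (hγ : IsFrame M γ) {F : W → ℝ} (hF : ContDiff ℝ 1 F) (j : ι) (t : ℝ)
    (g : G) : ContDiffAt ℝ 1 (fun z : ℝ × W => F (M.mulW (M.invW (M.emb (γ j z.1)), z.2)))
      (t, M.emb g) := by
  have h1 : ContDiffAt ℝ 1 (fun z : ℝ × W => z.2) (t, M.emb g) := contDiffAt_snd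
  have h2 : ContDiffAt ℝ 1 (fun z : ℝ × W => M.emb (γ j z.1)) (t, M.emb g) :=
    ((hγ.contDiff j).comp contDiff_fst).contDiffAt
  exact hF.contDiffAt.comp _ (M.contDiffAt_mul (M.contDiffAt_inv h2 rfl) h1 (M.emb_inv _).symm rfl)

omit [LocallyCompactSpace G] in
/-- Gårding's theorem: averages of an orbit against a smooth function are smooth vectors. -/
theorem exists_hasDerivAt_average [MeasurableSpace G] [BorelSpace G] (μ : Measure G)
    [μ.IsHaarMeasure] (hA : ∀ v, Continuous fun g => A g v) (hγ : IsFrame M γ)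
    {F : W → ℝ} (hF : ContDiff ℝ 1 F) {K : Set G} (hK : IsCompact K)
    (hFK : ∀ g ∉ K, F (M.emb g) = 0) (v : X) (j : ι) :
    ∃ w, HasDerivAt (fun t => A (γ j t) (∫ g, F (M.emb g) • A g v ∂μ)) w 0 := by
  -- Left invariance of the measure shifts `γ j t` from the orbit to the weight, so the
  -- `t`-dependence sits in a scalar C¹ kernel and no smoothness of `v` is needed.
  set k : ℝ → G → ℝ := fun t g => F (M.emb ((γ j t)⁻¹ * g)) with hk
  set k' : ℝ → G → ℝ := fun t g => fderiv ℝ (fun z : ℝ × W =>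
    F (M.mulW (M.invW (M.emb (γ j z.1)), z.2))) (t, M.emb g) (1, 0) with hk'
  have hγc := hγ.continuous j
  have hkc : ∀ t, Continuous (k t) := fun t =>
    hF.continuous.comp (M.continuous_emb.comp (continuous_const.mul continuous_id))
  have hder : ∀ t g, HasDerivAt (fun t => k t g) (k' t g) t := by
    intro t g
    have h1 := ((contDiffAt_translate (M := M) hγ hF j t g).differentiableAt
      one_ne_zero).hasFDerivAt
    have h2 : HasDerivAt (fun t : ℝ => (t, M.emb g)) ((1 : ℝ), (0 : W)) t :=
      (hasDerivAt_id _).prodMk (hasDerivAt_const _ _)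
    have h3 := HasFDerivAt.comp_hasDerivAt t h1 h2
    refine h3.congr_of_eventuallyEq (Eventually.of_forall fun s => ?_)
    simp only [hk, Function.comp, M.emb_mul, M.emb_inv]
  have hk'c : Continuous fun z : ℝ × G => k' z.1 z.2 := by
    rw [continuous_iff_continuousAt]
    rintro ⟨t, g⟩
    have h1 := (contDiffAt_translate (M := M) hγ hF j t g).continuousAt_fderiv one_ne_zero
    have h2 := ContinuousAt.comp (f := fun z : ℝ × G => (z.1, M.emb z.2)) (x := (t, g)) h1
      (continuous_fst.prodMk (M.continuous_emb.comp continuous_snd)).continuousAt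
    exact h2.clm_apply continuousAt_const
  -- For `|t| ≤ 1` all shifted weights are supported in this one compact set, which provides an
  -- integrable bound for differentiation under the integral.
  set K' : Set G := (fun z : ℝ × G => γ j z.1 * z.2) '' (Set.Icc (-1) 1 ×ˢ K) with hK'
  have hK'c : IsCompact K' :=
    (isCompact_Icc.prod hK).image (by fun_prop)
  have hsupp : ∀ t ∈ Set.Ioo (-1 : ℝ) 1, ∀ g ∉ K', k t g = 0 := by
    intro t ht g hg
    refine hFK _ fun h => hg ⟨(t, (γ j t)⁻¹ * g), ⟨Set.Ioo_subset_Icc_self ht, h⟩, ?_⟩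
    simp
  have hsupp' : ∀ t ∈ Set.Ioo (-1 : ℝ) 1, ∀ g ∉ K', k' t g = 0 := by
    intro t ht g hg
    refine (hder t g).unique ?_
    refine (hasDerivAt_const t (0 : ℝ)).congr_of_eventuallyEq ?_
    filter_upwards [isOpen_Ioo.mem_nhds ht] with s hs using hsupp s hs g hg
  have h0 : (0 : ℝ) ∈ Set.Ioo (-1 : ℝ) 1 := by norm_num
  have hint : ∀ {f : G → ℝ}, Continuous f → (∀ g ∉ K', f g = 0) →
      Integrable (fun g => f g • A g v) μ := by
    intro f hf hfK
    exact (hf.smul (hA v)).integrable_of_hasCompactSupport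
      (HasCompactSupport.intro hK'c fun g hg => by simp [hfK g hg])
  obtain ⟨C, hC⟩ := (isCompact_Icc.prod hK'c : IsCompact (Set.Icc (-1 : ℝ) 1 ×ˢ K')
    ).exists_bound_of_continuousOn (f := fun z : ℝ × G => k' z.1 z.2 • A z.2 v)
      (hk'c.smul ((hA v).comp continuous_snd)).continuousOn
  have hmeas : ∀ t ∈ Set.Ioo (-1 : ℝ) 1, AEStronglyMeasurable (fun g => k t g • A g v) μ :=
    fun t ht => (hint (hkc t) (hsupp t ht)).aestronglyMeasurable
  -- `G` is not assumed Hausdorff, so the closure is taken to have a measurable compact set.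
  obtain ⟨L, hL, hLc⟩ : ∃ L : Set G, K' ⊆ L ∧ IsCompact L ∧ MeasurableSet L :=
    ⟨closure K', subset_closure, hK'c.closure, isClosed_closure.measurableSet⟩
  have key := (hasDerivAt_integral_of_dominated_loc_of_deriv_le (μ := μ) (𝕜 := ℝ)
    (F := fun t g => k t g • A g v) (F' := fun t g => k' t g • A g v) (x₀ := 0)
    (s := Set.Ioo (-1 : ℝ) 1) (bound := L.indicator fun _ => |C|) (isOpen_Ioo.mem_nhds h0)
    (by filter_upwards [isOpen_Ioo.mem_nhds h0] with t ht using hmeas t ht)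
    (hint (hkc 0) (hsupp 0 h0))
    (hint (hk'c.comp (continuous_const.prodMk continuous_id)) (hsupp' 0 h0)).aestronglyMeasurable
    (Eventually.of_forall fun g t ht => by
      by_cases hg : g ∈ K'
      · rw [Set.indicator_of_mem (hL hg)]
        exact (hC (t, g) ⟨Set.Ioo_subset_Icc_self ht, hg⟩).trans (le_abs_self C)
      · rw [hsupp' t ht g hg, zero_smul, norm_zero]
        exact Set.indicator_nonneg (fun h hh => abs_nonneg C) g)
    (by
      rw [integrable_indicator_iff hLc.2]
      exact integrableOn_const hLc.1.measure_lt_top.ne)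
    (Eventually.of_forall fun g t _ => (hder t g).smul_const _)).2
  refine ⟨_, key.congr_of_eventuallyEq ?_⟩
  filter_upwards [isOpen_Ioo.mem_nhds h0] with t ht
  have hi : Integrable (fun g => F (M.emb g) • A g v) μ := by
    simpa [hk, hγ.zero] using hint (hkc 0) (hsupp 0 h0)
  rw [← ContinuousLinearMap.integral_comp_comm _ hi,
    ← integral_mul_left_eq_self (fun g => k t g • A g v) (γ j t)]
  simp only [hk, inv_mul_cancel_left, action_mul, map_smul]

/-- Smooth vectors are dense. -/
theorem dense_hasDerivAt [FiniteDimensional ℝ W] (hA : ∀ v, Continuous fun g => A g v)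
    (hγ : IsFrame M γ) :
    Dense {v : X | ∀ j, ∃ w, HasDerivAt (fun t => A (γ j t) v) w 0} := by
  intro v
  rw [Metric.mem_closure_iff]
  intro η hη
  let _ : MeasurableSpace G := borel G
  have _ : BorelSpace G := ⟨rfl⟩
  obtain ⟨K, hK, hK1⟩ := exists_compact_mem_nhds (1 : G)
  have h1 : ∀ᶠ g in 𝓝 (1 : G), dist (A g v) v < η / 2 := by
    have := (hA v).tendsto 1
    rw [action_one] at this
    exact (Metric.tendsto_nhds.1 this) _ (by positivity)
  -- The weight will live where `A g v` is within `η / 2` of `v`; the normalised average then has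
  -- the same distance from `v`. Intersecting with `K` makes the support compact.
  have h2 : K ∩ {g | dist (A g v) v < η / 2} ∈ 𝓝 (1 : G) := inter_mem hK1 h1
  rw [M.isInducing_emb.nhds_eq_comap, mem_comap] at h2
  obtain ⟨U, hU, hUs⟩ := h2
  obtain ⟨r, hr, hrU⟩ := Metric.mem_nhds_iff.1 hU
  let F : ContDiffBump (M.emb 1) := ⟨r / 3, r / 2, by positivity, by linarith⟩
  have hF : ContDiff ℝ 1 F := F.contDiff
  have hFs : ∀ g, F (M.emb g) ≠ 0 → g ∈ K ∩ {g | dist (A g v) v < η / 2} := by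
    intro g hg
    refine hUs (hrU ?_)
    have h3 : M.emb g ∈ Function.support F := hg
    rw [F.support_eq] at h3
    exact Metric.ball_subset_ball (by change r / 2 ≤ r; linarith) h3
  have hFK : ∀ g ∉ K, F (M.emb g) = 0 := fun g hg => by
    by_contra h
    exact hg (hFs g h).1
  set μ : Measure G := Measure.haar with hμ
  have hFc : Continuous fun g => F (M.emb g) := F.continuous.comp M.continuous_emb
  have hsupp : HasCompactSupport fun g => F (M.emb g) := HasCompactSupport.intro hK hFK
  have hFi : Integrable (fun g => F (M.emb g)) μ := hFc.integrable_of_hasCompactSupport hsupp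
  have hpos : 0 < ∫ g, F (M.emb g) ∂μ :=
    hFc.integral_pos_of_hasCompactSupport_nonneg_nonzero hsupp (fun g => F.nonneg)
      (x := 1) (by
        have : F (M.emb 1) = 1 := F.one_of_mem_closedBall (by
          rw [Metric.mem_closedBall, dist_self]; exact F.rIn_pos.le)
        rw [this]; exact one_ne_zero)
  set c := ∫ g, F (M.emb g) ∂μ with hc
  refine ⟨c⁻¹ • ∫ g, F (M.emb g) • A g v ∂μ, fun j => ?_, ?_⟩
  · obtain ⟨w, hw⟩ := exists_hasDerivAt_average μ hA hγ hF hK hFK v j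
    refine ⟨c⁻¹ • w, ?_⟩
    simp only [map_smul]
    exact hw.const_smul c⁻¹
  · have hi : Integrable (fun g => F (M.emb g) • A g v) μ :=
      (hFc.smul (hA v)).integrable_of_hasCompactSupport
        (HasCompactSupport.intro hK fun g hg => by simp [hFK g hg])
    have e : c⁻¹ • ∫ g, F (M.emb g) • A g v ∂μ - v =
        c⁻¹ • ∫ g, F (M.emb g) • (A g v - v) ∂μ := by
      simp only [smul_sub]
      rw [integral_sub hi (hFi.smul_const v), integral_smul_const, smul_sub, ← hc,
        inv_smul_smul₀ hpos.ne']
    rw [dist_comm, dist_eq_norm, e, norm_smul, Real.norm_of_nonneg (inv_nonneg.2 hpos.le)]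
    have h3 : ‖∫ g, F (M.emb g) • (A g v - v) ∂μ‖ ≤ ∫ g, F (M.emb g) * (η / 2) ∂μ := by
      refine norm_integral_le_of_norm_le (hFi.mul_const _) (Eventually.of_forall fun g => ?_)
      rw [norm_smul, Real.norm_of_nonneg F.nonneg]
      by_cases hg : F (M.emb g) = 0
      · simp [hg]
      · have := (hFs g hg).2
        rw [Set.mem_ofPred_eq, dist_eq_norm] at this
        gcongr
        exact F.nonneg
    rw [integral_mul_const, ← hc] at h3
    calc _ ≤ c⁻¹ * (c * (η / 2)) := by gcongr
      _ = η / 2 := by field_simp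
      _ < η := by linarith

end Garding

/-! ### The symmetry group -/

/-- The map `v ↦ (1 0; 0 M) v`. -/
def rot {n : ℕ} (M : Matrix (Fin n) (Fin n) ℝ) (v : Rd n) : Rd n :=
  WithLp.toLp 2 (Matrix.mulVec (augment 1 M) v.ofLp)

section Augment

variable {n : ℕ}

theorem augment_mulVec_zero (c : ℝ) (M : Matrix (Fin n) (Fin n) ℝ) (v : Fin (n + 1) → ℝ) :
    (augment c M).mulVec v 0 = c * v 0 := by
  simp [augment, Matrix.mulVec, dotProduct, Fin.sum_univ_succ]

theorem augment_mulVec_succ (c : ℝ) (M : Matrix (Fin n) (Fin n) ℝ) (v : Fin (n + 1) → ℝ)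
    (i : Fin n) : (augment c M).mulVec v i.succ = ∑ j, M i j * v j.succ := by
  simp [augment, Matrix.mulVec, dotProduct, Fin.sum_univ_succ]

theorem augment_transpose (c : ℝ) (M : Matrix (Fin n) (Fin n) ℝ) :
    (augment c M).transpose = augment c M.transpose := by
  ext i j
  refine Fin.cases ?_ (fun i => ?_) i <;> refine Fin.cases ?_ (fun j => ?_) j <;>
    simp [augment]

theorem augment_one_mul (M N : Matrix (Fin n) (Fin n) ℝ) :
    augment 1 (M * N) = augment 1 M * augment 1 N := by
  ext i j
  refine Fin.cases ?_ (fun i => ?_) i <;> refine Fin.cases ?_ (fun j => ?_) j <;>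
    simp [augment, Matrix.mul_apply, Fin.sum_univ_succ]

theorem augment_one_one : augment 1 (1 : Matrix (Fin n) (Fin n) ℝ) = 1 := by
  ext i j
  refine Fin.cases ?_ (fun i => ?_) i <;> refine Fin.cases ?_ (fun j => ?_) j <;>
    simp [augment, Matrix.one_apply, (Fin.succ_ne_zero _).symm]

theorem augment_smul (t c : ℝ) (M : Matrix (Fin n) (Fin n) ℝ) :
    augment (t * c) (t • M) = t • augment c M := by
  ext i j
  refine Fin.cases ?_ (fun i => ?_) i <;> refine Fin.cases ?_ (fun j => ?_) j <;>
    simp [augment]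

theorem rot_mul (M N : Matrix (Fin n) (Fin n) ℝ) (v : Rd n) : rot (M * N) v = rot M (rot N v) := by
  simp [rot, augment_one_mul, Matrix.mulVec_mulVec]

theorem rot_one (v : Rd n) : rot (1 : Matrix (Fin n) (Fin n) ℝ) v = v := by
  simp [rot, augment_one_one]

theorem rot_add (M : Matrix (Fin n) (Fin n) ℝ) (v w : Rd n) : rot M (v + w) = rot M v + rot M w := by
  simp [rot, Matrix.mulVec_add]

theorem rot_smul (M : Matrix (Fin n) (Fin n) ℝ) (c : ℝ) (v : Rd n) : rot M (c • v) = c • rot M v := by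
  simp [rot, Matrix.mulVec_smul]

theorem rot_sub (M : Matrix (Fin n) (Fin n) ℝ) (v w : Rd n) : rot M (v - w) = rot M v - rot M w := by
  simp [rot, Matrix.mulVec_sub]

end Augment

theorem act_eq {n : ℕ} (p : ℝ) (g : SymGroup n) (v : Rd n → ℝ) (x : Rd n) :
    act p g v x = (g.1 : ℝ)⁻¹ * v (((g.1 : ℝ) ^ (1 - p)) •
      rot (g.2.1 : Matrix (Fin n) (Fin n) ℝ).transpose (x - g.2.2)) := by
  simp only [act, rot, augment_transpose]

/-- The group of which `a` is a left action: the multiplication is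
`(α₁, Q₁, b₁) (α₂, Q₂, b₂) = (α₁ α₂, Q₁ Q₂, b₁ + α₁^(p-1) (1 0; 0 Q₁) b₂)`. -/
def Sym (_p : ℝ) (n : ℕ) : Type := SymGroup n

namespace Sym

variable {p : ℝ} {n : ℕ}

instance : TopologicalSpace (Sym p n) := inferInstanceAs (TopologicalSpace (SymGroup n))

/-- The scaling parameter. -/
def scale (g : Sym p n) : ℝ := ((show SymGroup n from g).1).1

/-- The rotation. -/
def mat (g : Sym p n) : Matrix (Fin n) (Fin n) ℝ := ((show SymGroup n from g).2.1).1

/-- The translation. -/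
def vec (g : Sym p n) : Rd n := (show SymGroup n from g).2.2

theorem scale_pos (g : Sym p n) : 0 < g.scale := ((show SymGroup n from g).1).2

theorem mat_mem (g : Sym p n) : g.mat ∈ Matrix.specialOrthogonalGroup (Fin n) ℝ :=
  (show SymGroup n from g).2.1.2

theorem mat_transpose_mul (g : Sym p n) : g.mat.transpose * g.mat = 1 :=
  (Matrix.mem_orthogonalGroup_iff' _ _).1 (Matrix.mem_specialOrthogonalGroup_iff.1 g.mat_mem).1

theorem mat_mul_transpose (g : Sym p n) : g.mat * g.mat.transpose = 1 :=
  (Matrix.mem_orthogonalGroup_iff _ _).1 (Matrix.mem_specialOrthogonalGroup_iff.1 g.mat_mem).1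

@[ext] theorem ext {g h : Sym p n} (h1 : g.scale = h.scale) (h2 : g.mat = h.mat)
    (h3 : g.vec = h.vec) : g = h :=
  Prod.ext (Subtype.ext h1) (Prod.ext (Subtype.ext h2) h3)

/-- The element with given components. -/
def mk (a : ℝ) (ha : 0 < a) (Q : Matrix (Fin n) (Fin n) ℝ)
    (hQ : Q ∈ Matrix.specialOrthogonalGroup (Fin n) ℝ) (b : Rd n) : Sym p n :=
  ((⟨a, ha⟩, ⟨Q, hQ⟩, b) : SymGroup n)

@[simp] theorem scale_mk (a : ℝ) (ha : 0 < a) (Q : Matrix (Fin n) (Fin n) ℝ) (hQ) (b : Rd n) :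
    (mk a ha Q hQ b : Sym p n).scale = a := rfl

@[simp] theorem mat_mk (a : ℝ) (ha : 0 < a) (Q : Matrix (Fin n) (Fin n) ℝ) (hQ) (b : Rd n) :
    (mk a ha Q hQ b : Sym p n).mat = Q := rfl

@[simp] theorem vec_mk (a : ℝ) (ha : 0 < a) (Q : Matrix (Fin n) (Fin n) ℝ) (hQ) (b : Rd n) :
    (mk a ha Q hQ b : Sym p n).vec = b := rfl

theorem transpose_mem {Q : Matrix (Fin n) (Fin n) ℝ}
    (hQ : Q ∈ Matrix.specialOrthogonalGroup (Fin n) ℝ) :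
    Q.transpose ∈ Matrix.specialOrthogonalGroup (Fin n) ℝ := by
  rw [Matrix.mem_specialOrthogonalGroup_iff, Matrix.mem_orthogonalGroup_iff] at hQ ⊢
  rw [Matrix.det_transpose]
  refine ⟨?_, hQ.2⟩
  have h := hQ.1
  rw [mul_eq_one_comm] at h
  exact h

instance : Mul (Sym p n) := ⟨fun g h => mk (g.scale * h.scale) (mul_pos g.scale_pos h.scale_pos)
  (g.mat * h.mat) (mul_mem g.mat_mem h.mat_mem) (g.vec + g.scale ^ (p - 1) • rot g.mat h.vec)⟩

instance : One (Sym p n) := ⟨mk 1 one_pos 1 (one_mem _) 0⟩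

instance : Inv (Sym p n) := ⟨fun g => mk g.scale⁻¹ (inv_pos.2 g.scale_pos) g.mat.transpose
  (transpose_mem g.mat_mem) (-(g.scale⁻¹ ^ (p - 1) • rot g.mat.transpose g.vec))⟩

@[simp] theorem scale_mul (g h : Sym p n) : (g * h).scale = g.scale * h.scale := rfl
@[simp] theorem mat_mul (g h : Sym p n) : (g * h).mat = g.mat * h.mat := rfl
@[simp] theorem vec_mul (g h : Sym p n) :
    (g * h).vec = g.vec + g.scale ^ (p - 1) • rot g.mat h.vec := rfl
@[simp] theorem scale_one : (1 : Sym p n).scale = 1 := rfl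
@[simp] theorem mat_one : (1 : Sym p n).mat = 1 := rfl
@[simp] theorem vec_one : (1 : Sym p n).vec = 0 := rfl
@[simp] theorem scale_inv (g : Sym p n) : g⁻¹.scale = g.scale⁻¹ := rfl
@[simp] theorem mat_inv (g : Sym p n) : g⁻¹.mat = g.mat.transpose := rfl
@[simp] theorem vec_inv (g : Sym p n) :
    g⁻¹.vec = -(g.scale⁻¹ ^ (p - 1) • rot g.mat.transpose g.vec) := rfl

instance : Group (Sym p n) := Group.ofLeftAxioms
  (fun a b c => by
    ext1
    · simp [mul_assoc]
    · simp [mul_assoc]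
    · simp [Real.mul_rpow a.scale_pos.le b.scale_pos.le, rot_add, rot_smul, rot_mul, add_assoc,
        smul_smul])
  (fun a => by
    ext1
    · simp
    · simp
    · simp [rot_one])
  (fun a => by
    ext1
    · simp [a.scale_pos.ne']
    · simp [a.mat_transpose_mul]
    · simp)

/-- The point transformation `x ↦ α^(1-p) (1 0; 0 Q)ᵀ (x - b)`. -/
def point (g : Sym p n) (x : Rd n) : Rd n := g.scale ^ (1 - p) • rot g.mat.transpose (x - g.vec)

theorem act_apply (g : Sym p n) (v : Rd n → ℝ) (x : Rd n) :
    act p g v x = g.scale⁻¹ * v (g.point x) := act_eq p g v x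

/-- The order is reversed, which makes `act` a left action. The exponent `p - 1` in the translation
part is what cancels against the factor `α^(1-p)`. -/
theorem point_mul (g h : Sym p n) (x : Rd n) : (g * h).point x = h.point (g.point x) := by
  have e : g.scale ^ (1 - p) * g.scale ^ (p - 1) = 1 := by
    rw [← Real.rpow_add g.scale_pos]; simp
  have e2 : rot g.mat.transpose (rot g.mat h.vec) = h.vec := by
    rw [← rot_mul, g.mat_transpose_mul, rot_one]
  simp only [point, scale_mul, mat_mul, vec_mul, Matrix.transpose_mul, rot_mul, rot_sub, rot_add,
    rot_smul, Real.mul_rpow g.scale_pos.le h.scale_pos.le, smul_sub, smul_add, smul_smul]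
  rw [e2, mul_right_comm, e, one_mul, mul_comm (g.scale ^ (1 - p))]
  abel

theorem point_one (x : Rd n) : (1 : Sym p n).point x = x := by
  simp [point, rot_one]

theorem act_mul (g h : Sym p n) (v : Rd n → ℝ) : act p (g * h) v = act p g (act p h v) := by
  funext x
  simp only [act_apply, point_mul, scale_mul, mul_inv, mul_assoc]

theorem act_one (v : Rd n → ℝ) : act p (1 : Sym p n) v = v := by
  funext x
  simp [act_apply, point_one]

theorem continuous_scale : Continuous (scale : Sym p n → ℝ) :=
  continuous_subtype_val.comp (continuous_fst (X := Set.Ioi (0 : ℝ)))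

theorem continuous_mat : Continuous (mat : Sym p n → Matrix (Fin n) (Fin n) ℝ) :=
  continuous_subtype_val.comp
    ((continuous_fst (X := Matrix.specialOrthogonalGroup (Fin n) ℝ)).comp
      (continuous_snd (X := Set.Ioi (0 : ℝ))))

theorem continuous_vec : Continuous (vec : Sym p n → Rd n) :=
  (continuous_snd (X := Matrix.specialOrthogonalGroup (Fin n) ℝ)).comp
      (continuous_snd (X := Set.Ioi (0 : ℝ)))

/-- Closedness gives local compactness of the group, which Haar measure and the local norm bounds
require. -/
theorem isClosed_specialOrthogonalGroup :
    IsClosed (Matrix.specialOrthogonalGroup (Fin n) ℝ : Set (Matrix (Fin n) (Fin n) ℝ)) := by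
  have e : (Matrix.specialOrthogonalGroup (Fin n) ℝ : Set (Matrix (Fin n) (Fin n) ℝ)) =
      {Q | Q * Q.transpose = 1} ∩ {Q | Q.det = 1} := by
    ext Q
    rw [SetLike.mem_coe, Matrix.mem_specialOrthogonalGroup_iff, Matrix.mem_orthogonalGroup_iff]
    rfl
  rw [e]
  exact (isClosed_eq (by fun_prop) continuous_const).inter
    (isClosed_eq (by fun_prop) continuous_const)

instance : LocallyCompactSpace (Sym p n) := by
  have h1 : LocallyCompactSpace (Set.Ioi (0 : ℝ)) := isOpen_Ioi.locallyCompactSpace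
  have h2 : LocallyCompactSpace (Matrix (Fin n) (Fin n) ℝ) :=
    inferInstanceAs (LocallyCompactSpace (Fin n → Fin n → ℝ))
  have h3 : LocallyCompactSpace (Matrix.specialOrthogonalGroup (Fin n) ℝ) :=
    isClosed_specialOrthogonalGroup.locallyCompactSpace
  exact inferInstanceAs (LocallyCompactSpace (Set.Ioi (0 : ℝ) × Matrix.specialOrthogonalGroup (Fin n) ℝ × Rd n))

theorem isInducing_embed : IsInducing (embed : SymGroup n → _) := by
  have h1 : IsInducing (fun a : Set.Ioi (0 : ℝ) => (a : ℝ)) := IsInducing.subtypeVal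
  have h2 : IsInducing (fun Q : Matrix.specialOrthogonalGroup (Fin n) ℝ =>
      (fun i j => (Q : Matrix (Fin n) (Fin n) ℝ) i j : Fin n → Fin n → ℝ)) :=
    IsInducing.subtypeVal
  exact h1.prodMap (h2.prodMap IsInducing.id)

end Sym

/-! ### Smoothness of matrix operations, entry by entry -/

section Entries

variable {Z : Type*} [NormedAddCommGroup Z] [NormedSpace ℝ Z] {m : ℕ} {z : Z}

theorem contDiffAt_matrix_mul {A B : Z → Matrix (Fin m) (Fin m) ℝ}
    (hA : ∀ i j, ContDiffAt ℝ 1 (fun x => A x i j) z)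
    (hB : ∀ i j, ContDiffAt ℝ 1 (fun x => B x i j) z) (i j : Fin m) :
    ContDiffAt ℝ 1 (fun x => (A x * B x) i j) z := by
  simp only [Matrix.mul_apply]
  exact ContDiffAt.sum fun l _ => (hA i l).mul (hB l j)

theorem contDiffAt_matrix_det {A : Z → Matrix (Fin m) (Fin m) ℝ}
    (hA : ∀ i j, ContDiffAt ℝ 1 (fun x => A x i j) z) :
    ContDiffAt ℝ 1 (fun x => (A x).det) z := by
  simp only [Matrix.det_apply]
  refine ContDiffAt.sum fun σ _ => ContDiffAt.const_smul _ ?_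
  exact contDiffAt_prod fun i _ => hA _ _

theorem contDiffAt_matrix_inv {A : Z → Matrix (Fin m) (Fin m) ℝ}
    (hA : ∀ i j, ContDiffAt ℝ 1 (fun x => A x i j) z) (h : (A z).det ≠ 0) (i j : Fin m) :
    ContDiffAt ℝ 1 (fun x => (A x)⁻¹ i j) z := by
  have e : (fun x => (A x)⁻¹ i j) = fun x => (A x).det⁻¹ * (A x).adjugate i j := by
    funext x
    rw [Matrix.inv_def, Ring.inverse_eq_inv', Matrix.smul_apply, smul_eq_mul]
  rw [e]
  refine ((contDiffAt_matrix_det hA).inv h).mul ?_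
  simp only [Matrix.adjugate_apply]
  refine contDiffAt_matrix_det fun k l => ?_
  by_cases hk : k = j
  · subst hk
    simp only [Matrix.updateRow_self]
    exact contDiffAt_const
  · simp only [Matrix.updateRow_ne hk]
    exact hA k l

theorem contDiffAt_rot {A : Z → Matrix (Fin m) (Fin m) ℝ} {v : Z → Rd m}
    (hA : ∀ i j, ContDiffAt ℝ 1 (fun x => A x i j) z) (hv : ContDiffAt ℝ 1 v z) :
    ContDiffAt ℝ 1 (fun x => rot (A x) (v x)) z := by
  rw [contDiffAt_euclidean] at hv ⊢
  intro i
  refine Fin.cases ?_ (fun i => ?_) i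
  · simp only [rot, augment_mulVec_zero, one_mul]
    exact hv 0
  · simp only [rot, augment_mulVec_succ]
    exact ContDiffAt.sum fun j _ => (hA i j).mul (hv _)

end Entries

/-! ### The Cayley transform -/

section Cayley

variable {n : ℕ}

/-- A skew matrix has vanishing quadratic form, so `H v = v` forces `v ⬝ᵥ v = 0`. -/
theorem det_one_sub_ne_zero {H : Matrix (Fin n) (Fin n) ℝ} (hH : H.transpose = -H) :
    (1 - H).det ≠ 0 := by
  intro h
  obtain ⟨v, hv, hv'⟩ := Matrix.exists_mulVec_eq_zero_iff.2 h
  rw [Matrix.sub_mulVec, Matrix.one_mulVec, sub_eq_zero] at hv'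
  have h1 : v ⬝ᵥ (H.mulVec v) = -(v ⬝ᵥ (H.mulVec v)) := by
    conv_lhs => rw [Matrix.dotProduct_mulVec, ← Matrix.mulVec_transpose, hH, Matrix.neg_mulVec,
      neg_dotProduct, dotProduct_comm]
  have h2 : v ⬝ᵥ v = 0 := by
    nth_rw 2 [hv']
    linarith
  exact hv (dotProduct_self_eq_zero.1 h2)

/-- The rotation `(1 + H)(1 - H)⁻¹`. -/
def cayley (H : Matrix (Fin n) (Fin n) ℝ) : Matrix (Fin n) (Fin n) ℝ := (1 + H) * (1 - H)⁻¹

/-- The inverse of the Cayley transform. -/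
def cayleyInv (Q : Matrix (Fin n) (Fin n) ℝ) : Matrix (Fin n) (Fin n) ℝ := (Q - 1) * (Q + 1)⁻¹

theorem cayley_mem {H : Matrix (Fin n) (Fin n) ℝ} (hH : H.transpose = -H) :
    cayley H ∈ Matrix.specialOrthogonalGroup (Fin n) ℝ := by
  have hd := det_one_sub_ne_zero hH
  have hu : IsUnit (1 - H).det := hd.isUnit
  have ht : (1 - H).transpose = 1 + H := by simp [Matrix.transpose_sub, hH]
  have ht' : (1 + H).transpose = 1 - H := by simp [Matrix.transpose_add, hH, sub_eq_add_neg]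
  have hu' : IsUnit (1 + H).det := by rw [← ht, Matrix.det_transpose]; exact hu
  rw [Matrix.mem_specialOrthogonalGroup_iff, Matrix.mem_orthogonalGroup_iff']
  constructor
  · change (cayley H).transpose * cayley H = 1
    have hc : (1 - H) * (1 + H) = (1 + H) * (1 - H) := by noncomm_ring
    rw [cayley, Matrix.transpose_mul, Matrix.transpose_nonsing_inv, ht, ht', Matrix.mul_assoc,
      ← Matrix.mul_assoc (1 - H), hc, Matrix.mul_assoc, ← Matrix.mul_assoc,
      Matrix.nonsing_inv_mul _ hu', Matrix.one_mul, Matrix.mul_nonsing_inv _ hu]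
  -- The factors `1 + H` and `1 - H` are transposes of each other, so the determinants in the
  -- quotient cancel.
  · have : (1 + H).det = (1 - H).det := by rw [← ht, Matrix.det_transpose]
    rw [cayley, Matrix.det_mul, Matrix.det_nonsing_inv, this, Ring.mul_inverse_cancel _ hu]

theorem cayleyInv_cayley {H : Matrix (Fin n) (Fin n) ℝ} (hH : H.transpose = -H) :
    cayleyInv (cayley H) = H := by
  have hu : IsUnit (1 - H).det := (det_one_sub_ne_zero hH).isUnit
  have h1 : cayley H + 1 = (2 : ℝ) • (1 - H)⁻¹ := by
    have : (1 : Matrix (Fin n) (Fin n) ℝ) = (1 - H) * (1 - H)⁻¹ :=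
      (Matrix.mul_nonsing_inv _ hu).symm
    conv_lhs => rw [this, cayley, ← Matrix.add_mul]
    rw [show 1 + H + (1 - H) = (2 : ℝ) • (1 : Matrix (Fin n) (Fin n) ℝ) by rw [two_smul]; abel,
      Matrix.smul_mul, Matrix.one_mul]
  have h2 : cayley H - 1 = (2 : ℝ) • (H * (1 - H)⁻¹) := by
    have : (1 : Matrix (Fin n) (Fin n) ℝ) = (1 - H) * (1 - H)⁻¹ :=
      (Matrix.mul_nonsing_inv _ hu).symm
    conv_lhs => rw [this, cayley, ← Matrix.sub_mul]
    rw [show 1 + H - (1 - H) = (2 : ℝ) • H by rw [two_smul]; abel, Matrix.smul_mul]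
  have h3 : ((2 : ℝ) • (1 - H)⁻¹)⁻¹ = (2 : ℝ)⁻¹ • (1 - H) := by
    refine Matrix.inv_eq_right_inv ?_
    rw [Matrix.smul_mul, Matrix.mul_smul, Matrix.nonsing_inv_mul _ hu, smul_smul]
    norm_num
  rw [cayleyInv, h1, h2, h3, Matrix.smul_mul, Matrix.mul_smul, Matrix.mul_assoc,
    Matrix.nonsing_inv_mul _ hu, smul_smul, Matrix.mul_one]
  norm_num

theorem cayleyInv_transpose {Q : Matrix (Fin n) (Fin n) ℝ} (hQ : Q.transpose * Q = 1)
    (h : (Q + 1).det ≠ 0) : (cayleyInv Q).transpose = -cayleyInv Q := by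
  have hu : IsUnit (Q + 1).det := h.isUnit
  have hu' : IsUnit (Q + 1).transpose.det := by rwa [Matrix.det_transpose]
  have key : (Q - 1).transpose * (Q + 1) = -((Q + 1).transpose * (Q - 1)) := by
    simp only [Matrix.transpose_sub, Matrix.transpose_add, Matrix.transpose_one, sub_mul, add_mul,
      mul_add, mul_sub, hQ, one_mul, mul_one]
    abel
  rw [cayleyInv, Matrix.transpose_mul, Matrix.transpose_nonsing_inv]
  calc _ = (Q + 1).transpose⁻¹ * ((Q - 1).transpose * (Q + 1)) * (Q + 1)⁻¹ := by
        rw [Matrix.mul_assoc, Matrix.mul_assoc (Q - 1).transpose, Matrix.mul_nonsing_inv _ hu,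
          Matrix.mul_one]
    _ = _ := by
        rw [key, Matrix.mul_neg, ← Matrix.mul_assoc, Matrix.nonsing_inv_mul _ hu', Matrix.one_mul,
          Matrix.neg_mul]

theorem cayley_cayleyInv {Q : Matrix (Fin n) (Fin n) ℝ} (h : (Q + 1).det ≠ 0) :
    cayley (cayleyInv Q) = Q := by
  have hu : IsUnit (Q + 1).det := h.isUnit
  have h0 : (1 : Matrix (Fin n) (Fin n) ℝ) = (Q + 1) * (Q + 1)⁻¹ :=
    (Matrix.mul_nonsing_inv _ hu).symm
  have h1 : 1 + cayleyInv Q = (2 : ℝ) • (Q * (Q + 1)⁻¹) := by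
    conv_lhs => rw [h0, cayleyInv, ← Matrix.add_mul]
    rw [show Q + 1 + (Q - 1) = (2 : ℝ) • Q by rw [two_smul]; abel, Matrix.smul_mul]
  have h2 : 1 - cayleyInv Q = (2 : ℝ) • (Q + 1)⁻¹ := by
    conv_lhs => rw [h0, cayleyInv, ← Matrix.sub_mul]
    rw [show Q + 1 - (Q - 1) = (2 : ℝ) • (1 : Matrix (Fin n) (Fin n) ℝ) by rw [two_smul]; abel,
      Matrix.smul_mul, Matrix.one_mul]
  have h3 : ((2 : ℝ) • (Q + 1)⁻¹)⁻¹ = (2 : ℝ)⁻¹ • (Q + 1) := by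
    refine Matrix.inv_eq_right_inv ?_
    rw [Matrix.smul_mul, Matrix.mul_smul, Matrix.nonsing_inv_mul _ hu, smul_smul]
    norm_num
  rw [cayley, h1, h2, h3, Matrix.smul_mul, Matrix.mul_smul, Matrix.mul_assoc,
    Matrix.nonsing_inv_mul _ hu, smul_smul, Matrix.mul_one]
  norm_num

/-- The skew-symmetric part of a matrix. -/
def skewPart : Matrix (Fin n) (Fin n) ℝ →ₗ[ℝ] LieAlgebra.Orthogonal.so (Fin n) ℝ where
  toFun K := ⟨(2⁻¹ : ℝ) • (K - K.transpose), by
    rw [LieAlgebra.Orthogonal.mem_so, Matrix.transpose_smul, Matrix.transpose_sub,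
      Matrix.transpose_transpose, ← smul_neg, neg_sub]⟩
  map_add' K L := by
    ext1
    change (2⁻¹ : ℝ) • (K + L - (K + L).transpose) =
      (2⁻¹ : ℝ) • (K - K.transpose) + (2⁻¹ : ℝ) • (L - L.transpose)
    rw [Matrix.transpose_add, ← smul_add]
    congr 1
    abel
  map_smul' c K := by
    ext1
    change (2⁻¹ : ℝ) • (c • K - (c • K).transpose) = c • (2⁻¹ : ℝ) • (K - K.transpose)
    rw [Matrix.transpose_smul, ← smul_sub, smul_comm]

/-- Coordinates must be defined on all ambient matrices; `skewPart` extends the identification of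
skew matrices with the Lie algebra linearly to them. -/
theorem skewPart_coe {K : Matrix (Fin n) (Fin n) ℝ} (hK : K.transpose = -K) :
    (skewPart K : Matrix (Fin n) (Fin n) ℝ) = K := by
  change (2⁻¹ : ℝ) • (K - K.transpose) = K
  rw [hK, sub_neg_eq_add, ← two_smul ℝ K, smul_smul]
  norm_num

theorem so_transpose (S : LieAlgebra.Orthogonal.so (Fin n) ℝ) :
    (S : Matrix (Fin n) (Fin n) ℝ).transpose = -(S : Matrix (Fin n) (Fin n) ℝ) :=
  (LieAlgebra.Orthogonal.mem_so (Fin n) ℝ _).1 S.2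

theorem skewPart_so (S : LieAlgebra.Orthogonal.so (Fin n) ℝ) :
    skewPart (S : Matrix (Fin n) (Fin n) ℝ) = S :=
  Subtype.ext (skewPart_coe (so_transpose S))

theorem half_so_transpose (S : LieAlgebra.Orthogonal.so (Fin n) ℝ) :
    ((2⁻¹ : ℝ) • (S : Matrix (Fin n) (Fin n) ℝ)).transpose =
      -((2⁻¹ : ℝ) • (S : Matrix (Fin n) (Fin n) ℝ)) := by
  rw [Matrix.transpose_smul, so_transpose, smul_neg]

end Cayley

/-! ### The symmetry group as an embedded group -/

namespace Sym

/-- The space in which the group is embedded. -/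
abbrev Amb (n : ℕ) := ℝ × (Fin n → Fin n → ℝ) × Rd n

section Ambient

variable {n : ℕ}

/-- Extension of the multiplication to the ambient space. -/
def mulAmb (p : ℝ) (z : Amb n × Amb n) : Amb n :=
  (z.1.1 * z.2.1, (Matrix.of z.1.2.1 * Matrix.of z.2.2.1 : Matrix (Fin n) (Fin n) ℝ),
    z.1.2.2 + z.1.1 ^ (p - 1) • rot (Matrix.of z.1.2.1) z.2.2.2)

/-- Extension of the inversion to the ambient space. -/
def invAmb (p : ℝ) (z : Amb n) : Amb n :=
  (z.1⁻¹, (Matrix.of z.2.1).transpose,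
    -(z.1⁻¹ ^ (p - 1) • rot (Matrix.of z.2.1).transpose z.2.2))

theorem contDiffAt_entry {Z : Type*} [NormedAddCommGroup Z] [NormedSpace ℝ Z] {z : Z}
    {f : Z → Fin n → Fin n → ℝ} (h : ContDiffAt ℝ 1 f z) (i j : Fin n) :
    ContDiffAt ℝ 1 (fun x => f x i j) z :=
  contDiffAt_pi.1 (contDiffAt_pi.1 h i) j

theorem contDiffAt_mulAmb (p : ℝ) (z : Amb n × Amb n) (hz : z.1.1 ≠ 0) :
    ContDiffAt ℝ 1 (mulAmb p) z := by
  have h1 : ContDiffAt ℝ 1 (fun z : Amb n × Amb n => z.1.2.1) z := by fun_prop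
  have h2 : ContDiffAt ℝ 1 (fun z : Amb n × Amb n => z.2.2.1) z := by fun_prop
  have h3 : ContDiffAt ℝ 1 (fun z : Amb n × Amb n => z.2.2.2) z := by fun_prop
  have h4 : ContDiffAt ℝ 1 (fun z : Amb n × Amb n => z.1.1) z := by fun_prop
  refine ContDiffAt.prodMk (by fun_prop) (ContDiffAt.prodMk ?_ (ContDiffAt.add (by fun_prop) ?_))
  · refine contDiffAt_pi.2 fun i => contDiffAt_pi.2 fun j => ?_
    exact contDiffAt_matrix_mul (contDiffAt_entry h1) (contDiffAt_entry h2) i j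
  · exact (h4.rpow_const_of_ne hz).smul (contDiffAt_rot (contDiffAt_entry h1) h3)

theorem contDiffAt_invAmb (p : ℝ) (z : Amb n) (hz : z.1 ≠ 0) :
    ContDiffAt ℝ 1 (invAmb p) z := by
  have h1 : ContDiffAt ℝ 1 (fun z : Amb n => z.2.1) z := by fun_prop
  have h3 : ContDiffAt ℝ 1 (fun z : Amb n => z.2.2) z := by fun_prop
  have h4 : ContDiffAt ℝ 1 (fun z : Amb n => z.1⁻¹) z := contDiffAt_fst.inv hz
  refine ContDiffAt.prodMk h4 (ContDiffAt.prodMk ?_ (ContDiffAt.neg ?_))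
  · refine contDiffAt_pi.2 fun i => contDiffAt_pi.2 fun j => ?_
    exact contDiffAt_entry h1 j i
  · exact (h4.rpow_const_of_ne (inv_ne_zero hz)).smul
      (contDiffAt_rot (fun i j => contDiffAt_entry h1 j i) h3)

/-- Logarithmic coordinates on the ambient space, with values in the Lie algebra. -/
def logAmb (z : Amb n) : Amb n :=
  (Real.log z.1, (2 : ℝ) • cayleyInv (Matrix.of z.2.1), z.2.2)

theorem contDiffAt_logAmb (z : Amb n) (hz : z.1 ≠ 0) (hz' : (Matrix.of z.2.1 + 1).det ≠ 0) :
    ContDiffAt ℝ 1 logAmb z := by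
  have h1 : ContDiffAt ℝ 1 (fun z : Amb n => z.2.1) z := by fun_prop
  have h2 : ∀ i j, ContDiffAt ℝ 1 (fun z : Amb n => (Matrix.of z.2.1 + 1) i j) z := fun i j =>
    (contDiffAt_entry h1 i j).add contDiffAt_const
  have h3 : ∀ i j, ContDiffAt ℝ 1 (fun z : Amb n => (Matrix.of z.2.1 - 1) i j) z := fun i j =>
    (contDiffAt_entry h1 i j).sub contDiffAt_const
  refine ContDiffAt.prodMk (contDiffAt_fst.log hz) (ContDiffAt.prodMk ?_ (by fun_prop))
  refine contDiffAt_pi.2 fun i => contDiffAt_pi.2 fun j => ?_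
  exact contDiffAt_const.mul (contDiffAt_matrix_mul h3 (contDiffAt_matrix_inv h2 hz') i j)

end Ambient

variable {n : ℕ} {ι : Type*} [Fintype ι]

/-- Coordinates on the ambient space with respect to a basis of the Lie algebra. -/
def toCoords (ε : Module.Basis ι ℝ (SymAlg n)) : Amb n →L[ℝ] (ι → ℝ) :=
  LinearMap.toContinuousLinearMap
    (ε.equivFun.toLinearMap ∘ₗ (LinearMap.id.prodMap
      ((skewPart ∘ₗ (Matrix.ofLinearEquiv ℝ).toLinearMap).prodMap LinearMap.id)))

theorem toCoords_apply (ε : Module.Basis ι ℝ (SymAlg n)) (z : Amb n) :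
    toCoords ε z = ε.equivFun (z.1, skewPart (Matrix.of z.2.1), z.2.2) := rfl

/-- The inclusion of the Lie algebra in the ambient space. -/
def algAmb : SymAlg n →ₗ[ℝ] Amb n where
  toFun μ := (μ.1, (μ.2.1 : Matrix (Fin n) (Fin n) ℝ), μ.2.2)
  map_add' _ _ := rfl
  map_smul' _ _ := rfl

/-- The inverse of `toCoords`. -/
def ofCoords (ε : Module.Basis ι ℝ (SymAlg n)) : (ι → ℝ) →L[ℝ] Amb n :=
  LinearMap.toContinuousLinearMap (algAmb ∘ₗ ε.equivFun.symm.toLinearMap)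

/-- The global parametrisation of a neighbourhood of the identity. -/
def chartAlg (p : ℝ) (μ : SymAlg n) : Sym p n :=
  mk (Real.exp μ.1) (Real.exp_pos _) (cayley ((2⁻¹ : ℝ) • (μ.2.1 : Matrix (Fin n) (Fin n) ℝ)))
    (cayley_mem (half_so_transpose _)) μ.2.2

theorem isOpen_det : IsOpen {g : Sym p n | (g.mat + 1).det ≠ 0} := by
  refine isOpen_ne_fun ?_ continuous_const
  exact (continuous_mat.add continuous_const).matrix_det

/-- The symmetry group as an embedded group. -/
def embedded (p : ℝ) (ε : Module.Basis ι ℝ (SymAlg n)) : EmbeddedGroup (Sym p n) (Amb n) (ι → ℝ) where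
  emb := embed
  isInducing_emb := isInducing_embed
  mulW := mulAmb p
  emb_mul _ _ := rfl
  contDiffAt_mulW g h := contDiffAt_mulAmb p _ g.scale_pos.ne'
  invW := invAmb p
  emb_inv _ := rfl
  contDiffAt_invW g := contDiffAt_invAmb p _ g.scale_pos.ne'
  chart y := chartAlg p (ε.equivFun.symm y)
  contDiff_chart := by
    have h1 : ContDiff ℝ 1 (ofCoords ε) := (ofCoords ε).contDiff
    have h2 : ContDiff ℝ 1 fun y => (ofCoords ε y).2.1 := contDiff_fst.comp (contDiff_snd.comp h1)
    rw [contDiff_iff_contDiffAt]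
    intro y
    have h3 : ∀ i j, ContDiffAt ℝ 1 (fun y => (2⁻¹ : ℝ) * (ofCoords ε y).2.1 i j) y :=
      fun i j => contDiffAt_const.mul (contDiffAt_entry h2.contDiffAt i j)
    have h4 : ContDiffAt ℝ 1 (fun y i j => (chartAlg p (ε.equivFun.symm y)).mat i j) y := by
      refine contDiffAt_pi.2 fun i => contDiffAt_pi.2 fun j => ?_
      set S : (ι → ℝ) → Matrix (Fin n) (Fin n) ℝ := fun y => (ε.equivFun.symm y).2.1 with hS
      have h5 : ∀ i j, ContDiffAt ℝ 1 (fun y => (1 + (2⁻¹ : ℝ) • S y) i j) y := fun i j =>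
        contDiffAt_const.add (h3 i j)
      have h6 : ∀ i j, ContDiffAt ℝ 1 (fun y => (1 - (2⁻¹ : ℝ) • S y) i j) y := fun i j =>
        contDiffAt_const.sub (h3 i j)
      exact contDiffAt_matrix_mul h5
        (contDiffAt_matrix_inv h6 (det_one_sub_ne_zero (half_so_transpose _))) i j
    exact (contDiff_fst.comp h1).contDiffAt.exp.prodMk (h4.prodMk
      (contDiff_snd.comp (contDiff_snd.comp h1)).contDiffAt)
  coord z := toCoords ε (logAmb z)
  -- The Cayley transform reaches exactly the rotations without eigenvalue `-1`.
  dom := {g | (g.mat + 1).det ≠ 0}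
  dom_mem := by
    refine isOpen_det.mem_nhds ?_
    have : (1 : Sym p n).mat + 1 = (2 : ℝ) • (1 : Matrix (Fin n) (Fin n) ℝ) := by
      rw [two_smul]; rfl
    rw [Set.mem_ofPred_eq, this, Matrix.det_smul, Matrix.det_one]
    positivity
  contDiffAt_coord g hg :=
    (toCoords ε).contDiff.contDiffAt.comp _ (contDiffAt_logAmb _ g.scale_pos.ne' hg)
  coord_chart y := by
    set μ := ε.equivFun.symm y with hμ
    have h1 : logAmb (embed (chartAlg p μ)) = algAmb μ := by
      refine Prod.ext (Real.log_exp _) (Prod.ext ?_ rfl)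
      change (2 : ℝ) • cayleyInv (cayley _) = (μ.2.1 : Matrix (Fin n) (Fin n) ℝ)
      rw [cayleyInv_cayley (half_so_transpose _), smul_smul]
      norm_num
    rw [h1, toCoords_apply]
    change ε.equivFun (μ.1, skewPart (μ.2.1 : Matrix (Fin n) (Fin n) ℝ), μ.2.2) = y
    rw [skewPart_so]
    exact ε.equivFun.apply_symm_apply y
  chart_coord g hg := by
    rw [toCoords_apply, LinearEquiv.symm_apply_apply]
    have h2 : (skewPart ((2 : ℝ) • cayleyInv g.mat) : Matrix (Fin n) (Fin n) ℝ) =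
        (2 : ℝ) • cayleyInv g.mat := by
      refine skewPart_coe ?_
      rw [Matrix.transpose_smul, cayleyInv_transpose g.mat_transpose_mul hg, smul_neg]
    ext1
    · exact Real.exp_log g.scale_pos
    · change cayley ((2⁻¹ : ℝ) • (skewPart ((2 : ℝ) • cayleyInv g.mat) : Matrix (Fin n) (Fin n) ℝ)) =
        g.mat
      rw [h2, smul_smul, inv_mul_cancel₀ two_ne_zero, one_smul, cayley_cayleyInv hg]
    · rfl
  chart_zero := by
    rw [map_zero]
    ext1
    · exact Real.exp_zero
    · change cayley ((2⁻¹ : ℝ) • (0 : Matrix (Fin n) (Fin n) ℝ)) = 1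
      simp [cayley]
    · rfl

end Sym

/-! ### The exponential curves -/

section ExpCurve

open scoped Matrix.Norms.Operator

variable {n : ℕ}

/-- The entire function `∑ₖ xᵏ / (k + 1)!` on matrices. -/
def phi {m : ℕ} (N : Matrix (Fin m) (Fin m) ℝ) : Matrix (Fin m) (Fin m) ℝ :=
  ∑' k : ℕ, (1 / (Nat.factorial (k + 1) : ℝ)) • N ^ k

/-- The ratio test gives infinite radius of convergence, so `phi` is analytic on all matrices. -/
theorem contDiff_phi {m : ℕ} :
    ContDiff ℝ 1 (phi : Matrix (Fin m) (Fin m) ℝ → Matrix (Fin m) (Fin m) ℝ) := by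
  set c : ℕ → ℝ := fun k => 1 / (Nat.factorial (k + 1) : ℝ) with hc
  have hr : (FormalMultilinearSeries.ofScalars (Matrix (Fin m) (Fin m) ℝ) c).radius = ⊤ := by
    refine FormalMultilinearSeries.ofScalars_radius_eq_top_of_tendsto _ c
      (Eventually.of_forall fun k => by positivity) ?_
    have e : (fun k => ‖c k.succ‖ / ‖c k‖) = fun k : ℕ => 1 / (((k + 1 : ℕ) : ℝ) + 1) := by
      funext k
      rw [Real.norm_of_nonneg (by positivity), Real.norm_of_nonneg (by positivity), hc]
      simp only [Nat.succ_eq_add_one]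
      rw [Nat.factorial_succ (k + 1)]
      push_cast
      field_simp
    rw [e]
    exact (tendsto_one_div_add_atTop_nhds_zero_nat (𝕜 := ℝ)).comp (tendsto_add_atTop_nat 1)
  have e : (phi : Matrix (Fin m) (Fin m) ℝ → Matrix (Fin m) (Fin m) ℝ) =
      (FormalMultilinearSeries.ofScalars (Matrix (Fin m) (Fin m) ℝ) c).sum := by
    funext N
    exact (FormalMultilinearSeries.ofScalars_sum_eq c N).symm
  rw [e]
  have h := (FormalMultilinearSeries.ofScalars (Matrix (Fin m) (Fin m) ℝ) c).hasFPowerSeriesOnBall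
    (by rw [hr]; exact ENNReal.zero_lt_top)
  rw [contDiff_iff_contDiffAt]
  intro x
  exact (h.analyticAt_of_mem (by rw [hr]; simp)).contDiffAt

theorem phi_zero {m : ℕ} : phi (0 : Matrix (Fin m) (Fin m) ℝ) = 1 := by
  rw [phi, tsum_eq_single 0]
  · simp
  · intro k hk
    simp [hk]

theorem contDiff_matrix_entry {Z : Type*} [NormedAddCommGroup Z] [NormedSpace ℝ Z] {m : ℕ}
    {f : Z → Matrix (Fin m) (Fin m) ℝ} (hf : ContDiff ℝ 1 f) (i j : Fin m) :
    ContDiff ℝ 1 fun z => f z i j :=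
  (LinearMap.toContinuousLinearMap (Matrix.entryLinearMap ℝ ℝ i j)).contDiff.comp hf

theorem contDiff_exp_smul_entry {m : ℕ} (S : Matrix (Fin m) (Fin m) ℝ) (i j : Fin m) :
    ContDiff ℝ 1 fun t : ℝ => NormedSpace.exp (t • S) i j := by
  refine contDiff_matrix_entry ?_ i j
  rw [contDiff_iff_contDiffAt]
  intro t
  have h1 : ContDiffAt ℝ 1 (NormedSpace.exp : Matrix (Fin m) (Fin m) ℝ → _) (t • S) :=
    (NormedSpace.exp_analytic (𝕂 := ℝ) (t • S)).contDiffAt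
  exact ContDiffAt.comp t (g := NormedSpace.exp) h1 (contDiffAt_id.smul contDiffAt_const)

theorem hasDerivAt_exp_smul_entry {m : ℕ} (S : Matrix (Fin m) (Fin m) ℝ) (i j : Fin m) :
    HasDerivAt (fun t : ℝ => NormedSpace.exp (t • S) i j) (S i j) 0 := by
  have h := hasDerivAt_exp_smul_const (𝕂 := ℝ) S (0 : ℝ)
  have h2 := HasFDerivAt.comp_hasDerivAt (0 : ℝ)
    (LinearMap.toContinuousLinearMap (Matrix.entryLinearMap ℝ ℝ i j)).hasFDerivAt h
  refine HasDerivAt.congr_deriv (f := fun t : ℝ => NormedSpace.exp (t • S) i j) h2 ?_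
  simp only [zero_smul, NormedSpace.exp_zero, one_mul]
  rfl

theorem contDiff_phi_smul_entry {m : ℕ} (N : Matrix (Fin m) (Fin m) ℝ) (i j : Fin m) :
    ContDiff ℝ 1 fun t : ℝ => phi (t • N) i j :=
  contDiff_matrix_entry (contDiff_phi.comp (contDiff_id.smul contDiff_const)) i j

end ExpCurve

namespace Sym

variable {n : ℕ} {ι : Type*} [Fintype ι] [DecidableEq ι]

/-- The exponential curve, as a curve in the symmetry group. -/
def expCurve (p κ : ℝ) (μ : SymAlg n) (t : ℝ) : Sym p n := expG κ (t • μ)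

/-- The matrix occurring in the translational part of the exponential map. -/
def expMat (κ : ℝ) (μ : SymAlg n) : Matrix (Fin (n + 1)) (Fin (n + 1)) ℝ :=
  augment (κ * μ.1)
    ((κ * μ.1) • (1 : Matrix (Fin n) (Fin n) ℝ) + (μ.2.1 : Matrix (Fin n) (Fin n) ℝ))

theorem expMat_smul (κ t : ℝ) (μ : SymAlg n) : expMat κ (t • μ) = t • expMat κ μ := by
  rw [expMat, expMat, ← augment_smul]
  congr 1
  · simp; ring
  · change (κ * (t * μ.1)) • (1 : Matrix (Fin n) (Fin n) ℝ) + t • (μ.2.1 : Matrix (Fin n) (Fin n) ℝ) = _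
    rw [smul_add, smul_smul]
    congr 2
    ring

theorem scale_expCurve (p κ : ℝ) (μ : SymAlg n) (t : ℝ) :
    (expCurve p κ μ t).scale = Real.exp (t * μ.1) := rfl

theorem mat_expCurve (p κ : ℝ) (μ : SymAlg n) (t : ℝ) :
    (expCurve p κ μ t).mat = NormedSpace.exp (t • (μ.2.1 : Matrix (Fin n) (Fin n) ℝ)) := rfl

theorem vec_expCurve (p κ : ℝ) (μ : SymAlg n) (t : ℝ) :
    (expCurve p κ μ t).vec =
      t • WithLp.toLp 2 ((phi (t • expMat κ μ)).mulVec μ.2.2.ofLp) := by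
  have h : (expCurve p κ μ t).vec =
    WithLp.toLp 2 ((phi (expMat κ (t • μ))).mulVec (t • μ.2.2.ofLp)) := rfl
  rw [h, expMat_smul, Matrix.mulVec_smul]
  rfl

theorem expCurve_zero (p κ : ℝ) (μ : SymAlg n) : expCurve p κ μ 0 = 1 := by
  ext1
  · simp [scale_expCurve]
  · simp [mat_expCurve]
  · simp [vec_expCurve]

theorem contDiff_vec_expCurve_aux (κ : ℝ) (μ : SymAlg n) :
    ContDiff ℝ 1 fun t : ℝ => (WithLp.toLp 2 ((phi (t • expMat κ μ)).mulVec μ.2.2.ofLp) : Rd n) := by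
  rw [contDiff_euclidean]
  intro i
  simp only [Matrix.mulVec, dotProduct]
  exact ContDiff.sum fun j _ => (contDiff_phi_smul_entry _ i j).mul contDiff_const

theorem contDiff_embed_expCurve (p κ : ℝ) (μ : SymAlg n) :
    ContDiff ℝ 1 fun t => embed (expCurve p κ μ t : SymGroup n) := by
  have h1 : ContDiff ℝ 1 fun t => (expCurve p κ μ t).scale := by
    simp only [scale_expCurve]
    fun_prop
  have h2 : ContDiff ℝ 1 fun t => (fun i j => (expCurve p κ μ t).mat i j : Fin n → Fin n → ℝ) := by
    refine contDiff_pi.2 fun i => contDiff_pi.2 fun j => ?_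
    simp only [mat_expCurve]
    exact contDiff_exp_smul_entry _ i j
  have h3 : ContDiff ℝ 1 fun t => (expCurve p κ μ t).vec := by
    simp only [vec_expCurve]
    exact contDiff_id.smul (contDiff_vec_expCurve_aux κ μ)
  exact h1.prodMk (h2.prodMk h3)

/-- To first order at the identity the exponential agrees with the chart: `cayley (S / 2)` and `exp
S` both begin with `1 + S`, and `phi 0 = 1`. The number `κ` enters only through higher-order terms.
-/
theorem hasDerivAt_logAmb_expCurve (p κ : ℝ) (μ : SymAlg n) :
    HasDerivAt (fun t => logAmb (embed (expCurve p κ μ t : SymGroup n))) (algAmb μ) 0 := by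
  have h1 : HasDerivAt (fun t => Real.log (expCurve p κ μ t).scale) μ.1 0 := by
    simp only [scale_expCurve, Real.log_exp]
    simpa using (hasDerivAt_id (0 : ℝ)).mul_const μ.1
  have h3 : HasDerivAt (fun t => (expCurve p κ μ t).vec) μ.2.2 0 := by
    simp only [vec_expCurve]
    have h := (hasDerivAt_id (0 : ℝ)).smul
      ((contDiff_vec_expCurve_aux κ μ).differentiable one_ne_zero 0).hasDerivAt
    refine h.congr_deriv ?_
    simp [phi_zero]
  have h2 : HasDerivAt (fun t => (fun i j => ((2 : ℝ) • cayleyInv (expCurve p κ μ t).mat) i j :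
      Fin n → Fin n → ℝ)) (fun i j => (μ.2.1 : Matrix (Fin n) (Fin n) ℝ) i j) 0 := by
    rw [hasDerivAt_pi]
    intro i
    rw [hasDerivAt_pi]
    intro j
    simp only [mat_expCurve, cayleyInv, Matrix.smul_apply, Matrix.mul_apply, smul_eq_mul]
    set S := (μ.2.1 : Matrix (Fin n) (Fin n) ℝ) with hS
    have hd : (NormedSpace.exp ((0 : ℝ) • S) + 1).det ≠ 0 := by
      rw [zero_smul, NormedSpace.exp_zero, ← two_smul ℝ (1 : Matrix (Fin n) (Fin n) ℝ),
        Matrix.det_smul, Matrix.det_one]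
      positivity
    -- The derivative of the inverse matrix need not be computed: in the product rule it is
    -- multiplied by `exp 0 - 1 = 0`.
    have hi : ∀ l, HasDerivAt (fun t : ℝ => (NormedSpace.exp (t • S) + 1)⁻¹ l j)
        (deriv (fun t : ℝ => (NormedSpace.exp (t • S) + 1)⁻¹ l j) 0) 0 := fun l =>
      ((contDiffAt_matrix_inv (A := fun t : ℝ => NormedSpace.exp (t • S) + 1)
        (fun i j => (contDiff_exp_smul_entry S i j).contDiffAt.add contDiffAt_const) hd l j
        ).differentiableAt one_ne_zero).hasDerivAt
    have hinv : (1 + 1 : Matrix (Fin n) (Fin n) ℝ)⁻¹ = (2⁻¹ : ℝ) • 1 := by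
      refine Matrix.inv_eq_right_inv ?_
      rw [← two_smul ℝ (1 : Matrix (Fin n) (Fin n) ℝ), smul_mul_smul_comm, Matrix.one_mul]
      norm_num
    have h := (HasDerivAt.fun_sum fun l (_ : l ∈ Finset.univ) =>
      ((hasDerivAt_exp_smul_entry S i l).sub_const ((1 : Matrix (Fin n) (Fin n) ℝ) i l)).mul
        (hi l)).const_mul (2 : ℝ)
    refine h.congr_deriv ?_
    simp [hinv, Matrix.one_apply]
    ring
  exact h1.prodMk (h2.prodMk h3)

theorem isFrame_expCurve (p κ : ℝ) (ε : Module.Basis ι ℝ (SymAlg n)) :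
    IsFrame (embedded p ε) fun j => expCurve p κ (ε j) where
  zero j := expCurve_zero p κ _
  contDiff j := contDiff_embed_expCurve p κ _
  hasDerivAt j := by
    have h := HasFDerivAt.comp_hasDerivAt (0 : ℝ) (toCoords ε).hasFDerivAt
      (hasDerivAt_logAmb_expCurve p κ (ε j))
    refine h.congr_deriv ?_
    rw [toCoords_apply]
    change ε.equivFun ((ε j).1, skewPart ((ε j).2.1 : Matrix (Fin n) (Fin n) ℝ), (ε j).2.2) = _
    rw [skewPart_so]
    funext i
    rw [Module.Basis.equivFun_self, Pi.single_apply]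
    simp only [eq_comm]

end Sym

/-! ### Consequences for strongly continuous actions of the symmetry group -/

section Main

variable {n : ℕ} {ι : Type*} [Fintype ι] {X : Type*} [NormedAddCommGroup X] [NormedSpace ℝ X]

theorem hasGenerator_iff {p κ : ℝ} (A : Sym p n →* (X →L[ℝ] X)) (μ : SymAlg n) (v w : X) :
    HasGenerator κ A μ v w ↔ HasDerivAt (fun t => A (Sym.expCurve p κ μ t) v) w 0 := by
  rw [hasDerivAt_iff_tendsto_slope_zero]
  simp only [zero_add, Sym.expCurve_zero, action_one]
  rfl

variable [CompleteSpace X] {p κ : ℝ} {A : Sym p n →* (X →L[ℝ] X)}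
  (ε : Module.Basis ι ℝ (SymAlg n))

theorem dense_Y0 (hA : ∀ v, Continuous fun g => A g v) :
    Dense (Y0 κ (fun g => A g) ε : Set X) := by
  classical
  have := (Sym.embedded p ε).isTopologicalGroup
  have h := dense_hasDerivAt hA (Sym.isFrame_expCurve p κ ε)
  refine h.mono fun v hv j => ?_
  obtain ⟨w, hw⟩ := hv j
  exact ⟨w, (hasGenerator_iff A _ _ _).2 hw⟩

theorem completeSpace_Y0Space (hA : ∀ v, Continuous fun g => A g v) :
    CompleteSpace (Y0Space κ (fun g => A g) ε) := by
  classical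
  have := (Sym.embedded p ε).isTopologicalGroup
  refine Metric.complete_of_cauchySeq_tendsto fun u hu => ?_
  have hle1 : ∀ a b, dist (u a).val (u b).val ≤ dist (u a) (u b) := fun a b => by
    rw [dist_eq_norm, dist_eq_norm, Y0Space.norm_eq]
    exact le_add_of_nonneg_right (norm_nonneg _)
  have hgen : ∀ a b : Y0Space κ (fun g => A g) ε, (a - b).gen = a.gen - b.gen := fun a b => by
    have := Y0Space.gen_add (a - b) b
    rw [sub_add_cancel] at this
    rw [this, add_sub_cancel_right]
  have hle2 : ∀ a b, dist (u a).gen (u b).gen ≤ dist (u a) (u b) := fun a b => by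
    rw [dist_eq_norm, dist_eq_norm, Y0Space.norm_eq, hgen]
    exact le_add_of_nonneg_left (norm_nonneg _)
  have hc1 : CauchySeq fun m => (u m).val := by
    rw [Metric.cauchySeq_iff] at hu ⊢
    exact fun η hη => (hu η hη).imp fun N h a ha b hb => (hle1 a b).trans_lt (h a ha b hb)
  have hc2 : CauchySeq fun m => (u m).gen := by
    rw [Metric.cauchySeq_iff] at hu ⊢
    exact fun η hη => (hu η hη).imp fun N h a ha b hb => (hle2 a b).trans_lt (h a ha b hb)
  obtain ⟨v, hv⟩ := cauchySeq_tendsto_of_complete hc1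
  obtain ⟨w, hw⟩ := cauchySeq_tendsto_of_complete hc2
  have hvw : ∀ j, HasGenerator κ (fun g => A g) (ε j) v (w j) := fun j =>
    (hasGenerator_iff A _ _ _).2 (hasDerivAt_action_of_tendsto hA (Sym.isFrame_expCurve p κ ε)
      (fun m j => (hasGenerator_iff A _ _ _).1 ((u m).hasGenerator_gen j)) hv hw j)
  refine ⟨⟨v, fun j => ⟨w j, hvw j⟩⟩, ?_⟩
  rw [tendsto_iff_norm_sub_tendsto_zero]
  have e : ∀ m, ‖u m - ⟨v, fun j => ⟨w j, hvw j⟩⟩‖ = ‖(u m).val - v‖ + ‖(u m).gen - w‖ := by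
    intro m
    rw [Y0Space.norm_eq, hgen]
    congr 3
    exact funext fun j => tendsto_nhds_unique (Y0Space.hasGenerator_gen _ j) (hvw j)
  simp only [e]
  simpa using (tendsto_iff_norm_sub_tendsto_zero.1 hv).add (tendsto_iff_norm_sub_tendsto_zero.1 hw)

theorem exists_operators_Y0Space (hA : ∀ v, Continuous fun g => A g v) :
    ∃ B : SymGroup n → (Y0Space κ (fun g => A g) ε →L[ℝ] Y0Space κ (fun g => A g) ε),
      (∀ g v, (B g v).val = A g v.val) ∧ ∀ v, Continuous fun g => B g v := by
  classical
  have := (Sym.embedded p ε).isTopologicalGroup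
  set c := adjVec (Sym.embedded p ε) (fun j => Sym.expCurve p κ (ε j)) with hc
  have hgen : ∀ (g : Sym p n) (v : Y0Space κ (fun g => A g) ε) j,
      HasGenerator κ (fun g => A g) (ε j) (A g v.val) (∑ i, c j g i • A g (v.gen i)) :=
    fun g v j => (hasGenerator_iff A _ _ _).2
      (hasDerivAt_action_apply hA (Sym.isFrame_expCurve p κ ε)
      (fun i => (hasGenerator_iff A _ _ _).1 (v.hasGenerator_gen i)) g j)
  let B0 : Sym p n → (Y0Space κ (fun g => A g) ε →ₗ[ℝ] Y0Space κ (fun g => A g) ε) := fun g =>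
    { toFun := fun v => ⟨A g v.val, fun j => ⟨_, hgen g v j⟩⟩
      map_add' := fun v w => Y0Space.ext (map_add (A g) v.val w.val)
      map_smul' := fun r v => Y0Space.ext (map_smul (A g) r v.val) }
  have hB0 : ∀ g v, (B0 g v).gen = fun j => ∑ i, c j g i • A g (v.gen i) := fun g v =>
    funext fun j => tendsto_nhds_unique (Y0Space.hasGenerator_gen _ j) (hgen g v j)
  have hbound : ∀ g v, ‖B0 g v‖ ≤ (‖A g‖ + ∑ j, ∑ i, |c j g i| * ‖A g‖) * ‖v‖ := by
    intro g v
    have hv1 : ‖v.val‖ ≤ ‖v‖ := by rw [Y0Space.norm_eq]; linarith [norm_nonneg v.gen]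
    have hv2 : ‖v.gen‖ ≤ ‖v‖ := by rw [Y0Space.norm_eq]; linarith [norm_nonneg v.val]
    rw [Y0Space.norm_eq, hB0, add_mul]
    refine add_le_add (((A g).le_opNorm _).trans (by gcongr)) ?_
    rw [pi_norm_le_iff_of_nonneg (by positivity)]
    intro j
    calc ‖∑ i, c j g i • A g (v.gen i)‖ ≤ ∑ i, |c j g i| * ‖A g‖ * ‖v‖ := by
          refine (norm_sum_le _ _).trans (Finset.sum_le_sum fun i _ => ?_)
          rw [norm_smul, Real.norm_eq_abs, mul_assoc]
          gcongr
          refine ((A g).le_opNorm _).trans ?_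
          gcongr
          exact (norm_le_pi_norm v.gen i).trans hv2
      _ = (∑ i, |c j g i| * ‖A g‖) * ‖v‖ := by rw [Finset.sum_mul]
      _ ≤ (∑ j, ∑ i, |c j g i| * ‖A g‖) * ‖v‖ := by
          refine mul_le_mul_of_nonneg_right ?_ (norm_nonneg v)
          exact Finset.single_le_sum (f := fun j => ∑ i, |c j g i| * ‖A g‖)
            (fun j _ => by positivity) (Finset.mem_univ j)
  refine ⟨fun g => (B0 g).mkContinuous _ (hbound g), fun g v => rfl, fun v => ?_⟩
  -- The norm of `Y₀` is pulled back along `graph`, so continuity in `Y₀` means continuity of the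
  -- vector and of its generators, which are given by `hB0`.
  have hind : IsInducing (Y0Space.graph : Y0Space κ (fun g => A g) ε → _) := ⟨rfl⟩
  rw [hind.continuous_iff]
  refine (WithLp.prod_continuous_toLp 1 X (ι → X)).comp (f := fun g : SymGroup n =>
    ((A g v.val : X), (B0 g v).gen)) (Continuous.prodMk (hA v.val) ?_)
  have e : (fun g => (B0 g v).gen) = fun g j => ∑ i, c j g i • A g (v.gen i) :=
    funext fun g => hB0 g v
  have hcont : Continuous fun (g : Sym p n) j => ∑ i, c j g i • A g (v.gen i) := by
    refine continuous_pi fun j => continuous_finsetSum _ fun i _ => ?_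
    exact ((continuous_apply i).comp
      (continuous_adjVec (Sym.isFrame_expCurve p κ ε) j)).smul (hA _)
  rw [← e] at hcont
  exact hcont

theorem isC1_action (hA : ∀ v, Continuous fun g => A g v) {v : X}
    (hv : v ∈ Y0 κ (fun g => A g) ε) : IsC1 fun g => A g v := by
  classical
  set M := Sym.embedded p ε with hM
  have := M.isTopologicalGroup
  choose w hw using hv
  have hC := contDiff_action_chart hA (Sym.isFrame_expCurve p κ ε)
    (fun j => (hasGenerator_iff A _ _ _).1 (hw j))
  intro g
  set g' : Sym p n := g with hg'
  -- coordinates of `g⁻¹ h`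
  set φ : Sym.Amb n → (ι → ℝ) := fun z => M.coord (M.mulW (M.emb g'⁻¹, z)) with hφ
  have hφc : ContDiffAt ℝ 1 φ (M.emb g') := by
    have h1 : ContDiffAt ℝ 1 (fun z => M.mulW (M.emb g'⁻¹, z)) (M.emb g') :=
      M.contDiffAt_mul contDiffAt_const contDiffAt_id rfl rfl
    refine ContDiffAt.comp _ (g := M.coord) ?_ h1
    rw [← M.emb_mul, inv_mul_cancel]
    exact M.contDiffAt_coord_one
  obtain ⟨U, hU, hφU⟩ := hφc.contDiffOn le_rfl (by simp)
  have hdom : ∀ᶠ h : Sym p n in 𝓝 g', g'⁻¹ * h ∈ M.dom := by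
    have h1 : Tendsto (fun h => g'⁻¹ * h) (𝓝 g') (𝓝 1) := by
      have := (tendsto_id (α := Sym p n) (x := 𝓝 g')).const_mul g'⁻¹
      simpa using this
    exact h1.eventually M.dom_mem
  rw [M.isInducing_emb.nhds_eq_comap, eventually_comap] at hdom
  obtain ⟨V, hV, hVo, hgV⟩ := _root_.mem_nhds_iff.1 (inter_mem hU hdom)
  refine ⟨V, fun z => A g' (A (M.chart (φ z)) v), hVo, hgV, ?_, ?_⟩
  · exact (A g').contDiff.comp_contDiffOn
      (hC.comp_contDiffOn (hφU.mono fun z hz => (hV hz).1))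
  · intro h hh
    set h' : Sym p n := h with hh'
    have h1 : g'⁻¹ * h' ∈ M.dom := (hV hh).2 h' rfl
    have h2 : φ (M.emb h') = M.coord (M.emb (g'⁻¹ * h')) := by rw [hφ, M.emb_mul]
    have h3 : A g' (A (M.chart (φ (M.emb h'))) v) = A h' v := by
      rw [h2, M.chart_coord _ h1, ← action_mul, mul_inv_cancel_left]
    exact h3

end Main

/-! ### Symmetry of iterated derivatives -/

section Symmetry

variable {E F : Type*} [NormedAddCommGroup E] [NormedSpace ℝ E] [NormedAddCommGroup F]
  [NormedSpace ℝ F] {f : E → F}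

theorem fderiv_iteratedFDeriv_apply {m : ℕ} (hf : ContDiff ℝ (m + 1) f) (x a : E)
    (w : Fin m → E) :
    fderiv ℝ (iteratedFDeriv ℝ m f) x a w = fderiv ℝ (fun y => iteratedFDeriv ℝ m f y w) x a := by
  have h1 : DifferentiableAt ℝ (iteratedFDeriv ℝ m f) x :=
    (hf.differentiable_iteratedFDeriv (by exact_mod_cast Nat.lt_succ_self m)) x
  have h2 := ((ContinuousMultilinearMap.apply ℝ (fun _ : Fin m => E) F w).hasFDerivAt).comp x
    h1.hasFDerivAt
  exact (DFunLike.congr_fun h2.fderiv a).symm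

/-- Exchanging the first two arguments is the symmetry of a second derivative, with the other
arguments frozen. Any other adjacent exchange happens inside the derivative of one order less, where
the induction hypothesis holds at every point. -/
theorem iteratedFDeriv_comp_swap {m : ℕ} (hf : ContDiff ℝ (m + 1 : ℕ) f) (i : Fin m) (x : E)
    (v : Fin (m + 1) → E) :
    iteratedFDeriv ℝ (m + 1) f x (v ∘ Equiv.swap i.castSucc i.succ) =
      iteratedFDeriv ℝ (m + 1) f x v := by
  induction m generalizing x with
  | zero => exact i.elim0
  | succ m ih =>
    have hf' : ContDiff ℝ (m + 1 : ℕ) f := hf.of_le (by exact_mod_cast Nat.le_succ _)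
    refine Fin.cases ?_ (fun i => ?_) i
    · have hsucc : ∀ v : Fin (m + 2) → E, iteratedFDeriv ℝ (m + 2) f x v =
          fderiv ℝ (fderiv ℝ fun y => iteratedFDeriv ℝ m f y (Fin.tail (Fin.tail v))) x (v 0)
            (v 1) := by
        intro v
        have h0 : ContDiff ℝ 2 fun y => iteratedFDeriv ℝ m f y (Fin.tail (Fin.tail v)) := by
          refine (ContinuousMultilinearMap.apply ℝ (fun _ : Fin m => E) F
            (Fin.tail (Fin.tail v))).contDiff.comp (hf.iteratedFDeriv_right ?_)
          norm_cast
          omega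
        have h1 : ∀ y, iteratedFDeriv ℝ (m + 1) f y (Fin.tail v) =
            fderiv ℝ (fun y => iteratedFDeriv ℝ m f y (Fin.tail (Fin.tail v))) y (v 1) := by
          intro y
          rw [iteratedFDeriv_succ_apply_left, fderiv_iteratedFDeriv_apply (by exact_mod_cast hf')]
          rfl
        rw [iteratedFDeriv_succ_apply_left, fderiv_iteratedFDeriv_apply (by exact_mod_cast hf)]
        simp only [h1]
        have h2 : DifferentiableAt ℝ (fderiv ℝ fun y =>
            iteratedFDeriv ℝ m f y (Fin.tail (Fin.tail v))) x :=
          (h0.fderiv_right (m := 1) (by norm_num)).differentiable one_ne_zero x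
        rw [fderiv_clm_apply h2 (by fun_prop)]
        simp
      rw [hsucc, hsucc]
      have e1 : Fin.tail (Fin.tail (v ∘ Equiv.swap (0 : Fin (m + 1)).castSucc (0 : Fin (m + 1)).succ))
          = Fin.tail (Fin.tail v) := by
        funext j
        simp only [Fin.tail, Function.comp]
        congr 1
      have h0 : ContDiff ℝ 2 fun y => iteratedFDeriv ℝ m f y (Fin.tail (Fin.tail v)) := by
        refine (ContinuousMultilinearMap.apply ℝ (fun _ : Fin m => E) F
          (Fin.tail (Fin.tail v))).contDiff.comp (hf.iteratedFDeriv_right ?_)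
        norm_cast
        omega
      have hs := (h0.contDiffAt (x := x)).isSymmSndFDerivAt (by simp)
      rw [e1]
      have e2 : (v ∘ Equiv.swap (0 : Fin (m + 1)).castSucc (0 : Fin (m + 1)).succ) 0 = v 1 := by
        simp [Function.comp]
      have e3 : (v ∘ Equiv.swap (0 : Fin (m + 1)).castSucc (0 : Fin (m + 1)).succ) 1 = v 0 := by
        simp [Function.comp]
      rw [e2, e3]
      exact hs (v 1) (v 0)
    · have e : ∀ v : Fin (m + 2) → E, Fin.tail (v ∘ Equiv.swap i.succ.castSucc i.succ.succ) =
          Fin.tail v ∘ Equiv.swap i.castSucc i.succ := by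
        intro v
        funext j
        simp only [Fin.tail, Function.comp]
        congr 1
        rw [← Fin.succ_castSucc]
        exact (Fin.succ_injective _).swap_apply _ _ _
      have e0 : (v ∘ Equiv.swap i.succ.castSucc i.succ.succ) 0 = v 0 := by
        simp only [Function.comp]
        rw [Equiv.swap_apply_of_ne_of_ne (by rw [← Fin.succ_castSucc]; exact (Fin.succ_ne_zero _).symm)
          (Fin.succ_ne_zero _).symm]
      rw [iteratedFDeriv_succ_apply_left, iteratedFDeriv_succ_apply_left,
        fderiv_iteratedFDeriv_apply (by exact_mod_cast hf),
        fderiv_iteratedFDeriv_apply (by exact_mod_cast hf), e, e0]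
      simp only [ih hf']

/-- The `m`-th derivative of a function of class `Cᵐ` is symmetric. -/
theorem iteratedFDeriv_comp_perm {m : ℕ} (hf : ContDiff ℝ m f) (x : E) (v : Fin m → E)
    (σ : Equiv.Perm (Fin m)) :
    iteratedFDeriv ℝ m f x (v ∘ σ) = iteratedFDeriv ℝ m f x v := by
  cases m with
  | zero =>
    congr 1
    exact Subsingleton.elim _ _
  | succ m =>
    let S : Submonoid (Equiv.Perm (Fin (m + 1))) :=
      { carrier := {σ | ∀ v, iteratedFDeriv ℝ (m + 1) f x (v ∘ σ) = iteratedFDeriv ℝ (m + 1) f x v}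
        mul_mem' := fun {a b} ha hb v => by
          rw [Equiv.Perm.coe_mul, ← Function.comp_assoc, hb, ha]
        one_mem' := fun v => rfl }
    have h : σ ∈ S := by
      have : Submonoid.closure (Set.range fun i : Fin m => Equiv.swap i.castSucc i.succ) ≤ S := by
        rw [Submonoid.closure_le]
        rintro _ ⟨i, rfl⟩ v
        exact iteratedFDeriv_comp_swap hf i x v
      -- Adjacent transpositions generate the symmetric group.
      rw [Equiv.Perm.mclosure_swap_castSucc_succ] at this
      exact this trivial
    exact h v

theorem iteratedFDeriv_comp_equiv {m m' : ℕ} (hf : ContDiff ℝ m f) (x : E) (v : Fin m → E)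
    (e : Fin m' ≃ Fin m) : iteratedFDeriv ℝ m' f x (v ∘ e) = iteratedFDeriv ℝ m f x v := by
  obtain rfl : m' = m := by simpa using Fintype.card_congr e
  exact iteratedFDeriv_comp_perm hf x v e

end Symmetry

/-! ### Multi-indices and the chain rule -/

section MultiIndex

variable {n k : ℕ}

theorem order_le (β : MultiIdx n k) : order β ≤ k := β.2

/-- The multi-index that counts the values of a finite sequence. -/
def countIdx {m : ℕ} (hm : m ≤ k) (σ : Fin m → Fin (n + 1)) : MultiIdx n k :=
  ⟨fun i => ⟨Fintype.card {j // σ j = i},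
      Nat.lt_succ_of_le ((Fintype.card_subtype_le _).trans (by simpa using hm))⟩, by
    have h := Fintype.card_congr (Equiv.sigmaFiberEquiv σ)
    rw [Fintype.card_sigma, Fintype.card_fin] at h
    exact h.trans_le hm⟩

/-- By symmetry only the multiplicity of each direction matters. The equivalence `e` sorts the
positions by the value of `σ`, as `directions` does. -/
theorem iteratedFDeriv_single {m : ℕ} (hm : m ≤ k) {u : Rd n → ℝ} (hu : ContDiff ℝ k u)
    (σ : Fin m → Fin (n + 1)) (x : Rd n) :
    iteratedFDeriv ℝ m u x (fun j => EuclideanSpace.single (σ j) (1 : ℝ)) =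
      partialDeriv (countIdx hm σ) u x := by
  let e : Fin (order (countIdx hm σ)) ≃ Fin m :=
    finSigmaFinEquiv.symm.trans ((Equiv.sigmaCongrRight fun i =>
      (Fintype.equivFinOfCardEq (α := {j // σ j = i}) rfl).symm).trans (Equiv.sigmaFiberEquiv σ))
  rw [partialDeriv, ← iteratedFDeriv_comp_equiv (hu.of_le (by exact_mod_cast hm)) x _ e]
  congr 1
  funext a
  simp only [Function.comp, directions]
  congr 1
  exact ((Fintype.equivFinOfCardEq (α := {j // σ j = (finSigmaFinEquiv.symm a).1}) rfl).symm
    (finSigmaFinEquiv.symm a).2).2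

theorem iteratedFDeriv_apply_eq_sum {m : ℕ} (hm : m ≤ k) {u : Rd n → ℝ} (hu : ContDiff ℝ k u)
    (w : Fin m → Rd n) (x : Rd n) :
    iteratedFDeriv ℝ m u x w =
      ∑ σ : Fin m → Fin (n + 1), (∏ j, w j (σ j)) * partialDeriv (countIdx hm σ) u x := by
  have hw : w = fun j => ∑ i, w j i • EuclideanSpace.single i (1 : ℝ) := by
    funext j
    ext i
    simp [Pi.single_apply]
  conv_lhs => rw [hw, ContinuousMultilinearMap.map_sum]
  refine Finset.sum_congr rfl fun σ _ => ?_
  rw [ContinuousMultilinearMap.map_smul_univ, smul_eq_mul, iteratedFDeriv_single hm hu]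

/-- The inner map is affine, so no lower-order terms occur: only derivatives of order `|β|` appear,
with constant coefficients. -/
theorem partialDeriv_comp_affine {u : Rd n → ℝ} (hu : ContDiff ℝ k u) (L : Rd n →L[ℝ] Rd n)
    (b : Rd n) (β : MultiIdx n k) (x : Rd n) :
    partialDeriv β (fun x => u (L (x - b))) x =
      ∑ σ : Fin (order β) → Fin (n + 1), (∏ j, L (directions β j) (σ j)) *
        partialDeriv (countIdx (order_le β) σ) u (L (x - b)) := by
  have h1 : iteratedFDeriv ℝ (order β) (fun x => u (L (x - b))) x =
      iteratedFDeriv ℝ (order β) (u ∘ L) (x - b) :=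
    iteratedFDeriv_comp_sub (f := u ∘ L) (order β) b x
  rw [partialDeriv, h1, L.iteratedFDeriv_comp_right (contDiff_order β hu) _ le_rfl,
    ContinuousMultilinearMap.compContinuousLinearMap_apply, iteratedFDeriv_apply_eq_sum (order_le β) hu]

theorem order_zeroIdx : order (zeroIdx n k) = 0 := by simp [order, zeroIdx]

instance : IsEmpty (Fin (order (zeroIdx n k))) := by
  rw [order_zeroIdx]
  infer_instance

theorem countIdx_zeroIdx (σ : Fin (order (zeroIdx n k)) → Fin (n + 1)) :
    countIdx (order_le (zeroIdx n k)) σ = zeroIdx n k := by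
  refine Subtype.ext (funext fun i => Fin.ext ?_)
  have : IsEmpty {j // σ j = i} := ⟨fun j => isEmptyElim (α := Fin (order (zeroIdx n k))) j.1⟩
  exact Fintype.card_eq_zero (α := {j // σ j = i})

end MultiIndex

/-! ### The affine point transformations and their effect on derivatives -/

section Point

variable {n k : ℕ} {p : ℝ}

theorem norm_rot {Q : Matrix (Fin n) (Fin n) ℝ} (hQ : Q.transpose * Q = 1) (v : Rd n) :
    ‖rot Q v‖ = ‖v‖ := by
  have h : ‖rot Q v‖ ^ 2 = ‖v‖ ^ 2 := by
    rw [EuclideanSpace.real_norm_sq_eq, EuclideanSpace.real_norm_sq_eq]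
    have e : ∀ w : Fin (n + 1) → ℝ, ∑ i, w i ^ 2 = w ⬝ᵥ w := fun w => by
      simp [dotProduct, sq]
    rw [e, e, rot]
    simp only
    rw [Matrix.dotProduct_mulVec, ← Matrix.mulVec_transpose, Matrix.mulVec_mulVec,
      augment_transpose, ← augment_one_mul, hQ, augment_one_one, Matrix.one_mulVec]
  exact (sq_eq_sq₀ (norm_nonneg _) (norm_nonneg _)).1 h

namespace Sym

/-- The linear part of the point transformation. -/
def lin (g : Sym p n) : Rd n →L[ℝ] Rd n :=
  LinearMap.toContinuousLinearMap
    { toFun := fun x => g.scale ^ (1 - p) • rot g.mat.transpose x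
      map_add' := fun x y => by rw [rot_add, smul_add]
      map_smul' := fun c x => by rw [rot_smul, smul_comm]; rfl }

theorem lin_apply (g : Sym p n) (x : Rd n) : g.lin x = g.scale ^ (1 - p) • rot g.mat.transpose x :=
  rfl

theorem point_eq (g : Sym p n) (x : Rd n) : g.point x = g.lin (x - g.vec) := rfl

theorem factor_pos (g : Sym p n) : 0 < g.scale ^ (1 - p) := Real.rpow_pos_of_pos g.scale_pos _

theorem norm_lin (g : Sym p n) (x : Rd n) : ‖g.lin x‖ = g.scale ^ (1 - p) * ‖x‖ := by
  rw [lin_apply, norm_smul, norm_rot (by rw [Matrix.transpose_transpose, g.mat_mul_transpose]),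
    Real.norm_of_nonneg g.factor_pos.le]

theorem continuous_factor : Continuous fun g : Sym p n => g.scale ^ (1 - p) :=
  continuous_scale.rpow_const fun g => Or.inl g.scale_pos.ne'

theorem continuous_rot {Z : Type*} [TopologicalSpace Z] {M : Z → Matrix (Fin n) (Fin n) ℝ}
    {v : Z → Rd n} (hM : Continuous M) (hv : Continuous v) : Continuous fun z => rot (M z) (v z) := by
  refine (PiLp.continuous_toLp 2 _).comp (continuous_pi fun i => ?_)
  have hv' : ∀ j, Continuous fun z => v z j := fun j => by fun_prop
  refine Fin.cases ?_ (fun i => ?_) i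
  · simp only [augment_mulVec_zero]
    exact continuous_const.mul (hv' 0)
  · simp only [augment_mulVec_succ]
    exact continuous_finsetSum _ fun j _ => (hM.matrix_elem i j).mul (hv' _)

theorem continuous_lin_apply {Z : Type*} [TopologicalSpace Z] {g : Z → Sym p n} {v : Z → Rd n}
    (hg : Continuous g) (hv : Continuous v) : Continuous fun z => (g z).lin (v z) :=
  (continuous_factor.comp hg).smul (continuous_rot (continuous_mat.comp hg).matrix_transpose hv)

theorem continuous_point {Z : Type*} [TopologicalSpace Z] {g : Z → Sym p n} {v : Z → Rd n}
    (hg : Continuous g) (hv : Continuous v) : Continuous fun z => (g z).point (v z) :=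
  continuous_lin_apply hg (hv.sub (continuous_vec.comp hg))

/-- The point transformation as a homeomorphism. -/
def pointHomeo (g : Sym p n) : Rd n ≃ₜ Rd n where
  toFun := g.point
  invFun := g⁻¹.point
  left_inv x := by rw [← point_mul, mul_inv_cancel, point_one]
  right_inv x := by rw [← point_mul, inv_mul_cancel, point_one]
  continuous_toFun := continuous_point continuous_const continuous_id
  continuous_invFun := continuous_point continuous_const continuous_id

/-- The coefficients in the chain rule for the point transformation. -/
def coef (g : Sym p n) (β : MultiIdx n k) (σ : Fin (order β) → Fin (n + 1)) : ℝ :=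
  ∏ j, g.lin (directions β j) (σ j)

theorem continuous_coef (β : MultiIdx n k) (σ : Fin (order β) → Fin (n + 1)) :
    Continuous fun g : Sym p n => g.coef β σ := by
  refine continuous_finsetProd _ fun j _ => ?_
  have : Continuous fun g : Sym p n => g.lin (directions β j) :=
    continuous_lin_apply continuous_id continuous_const
  exact (continuous_apply (σ j)).comp ((PiLp.continuous_ofLp 2 _).comp this)

theorem coef_zeroIdx (g : Sym p n) (σ : Fin (order (zeroIdx n k)) → Fin (n + 1)) :
    g.coef (zeroIdx n k) σ = 1 := by
  simp [coef]

theorem contDiff_point (g : Sym p n) {m : WithTop ℕ∞} : ContDiff ℝ m g.point :=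
  g.lin.contDiff.comp (contDiff_id.sub contDiff_const)

theorem partialDeriv_comp_point (g : Sym p n) {u : Rd n → ℝ} (hu : ContDiff ℝ k u)
    (β : MultiIdx n k) (x : Rd n) :
    partialDeriv β (u ∘ g.point) x =
      ∑ σ, g.coef β σ * partialDeriv (countIdx (order_le β) σ) u (g.point x) :=
  partialDeriv_comp_affine hu g.lin g.vec β x

theorem act_eq_smul (g : Sym p n) (v : Rd n → ℝ) : act p g v = g.scale⁻¹ • (v ∘ g.point) :=
  funext fun x => act_apply g v x

theorem partialDeriv_act (g : Sym p n) {u : Rd n → ℝ} (hu : ContDiff ℝ k u)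
    (β : MultiIdx n k) (x : Rd n) :
    partialDeriv β (act p g u) x =
      g.scale⁻¹ * ∑ σ, g.coef β σ * partialDeriv (countIdx (order_le β) σ) u (g.point x) := by
  have h : ContDiff ℝ k (u ∘ g.point) := hu.comp g.contDiff_point
  rw [← partialDeriv_comp_point g hu, act_eq_smul, partialDeriv, partialDeriv,
    iteratedFDeriv_const_smul_apply (contDiff_order β h).contDiffAt]
  rfl

section Mix

variable {B : Type*} [NormedAddCommGroup B] [NormedSpace ℝ B]

/-- The action on families of derivatives that is induced by an action `T` on functions. -/
def mix (T : Sym p n → B →L[ℝ] B) (g : Sym p n) :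
    (MultiIdx n k → B) →L[ℝ] (MultiIdx n k → B) :=
  ContinuousLinearMap.pi fun β => g.scale⁻¹ • ∑ σ, g.coef β σ •
    (T g).comp (ContinuousLinearMap.proj (R := ℝ) (φ := fun _ : MultiIdx n k => B)
      (countIdx (order_le β) σ))

theorem mix_apply (T : Sym p n → B →L[ℝ] B) (g : Sym p n) (u : MultiIdx n k → B)
    (β : MultiIdx n k) :
    mix T g u β = g.scale⁻¹ • ∑ σ, g.coef β σ • T g (u (countIdx (order_le β) σ)) := by
  simp [mix]

theorem mix_zeroIdx (T : Sym p n → B →L[ℝ] B) (g : Sym p n) (u : MultiIdx n k → B) :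
    mix T g u (zeroIdx n k) = g.scale⁻¹ • T g (u (zeroIdx n k)) := by
  rw [mix_apply, Fintype.sum_unique, coef_zeroIdx, one_smul, countIdx_zeroIdx]

/-- The chain-rule coefficients are continuous in `g`, so strong continuity on the stored families
of derivatives reduces to that of plain composition on the base space. -/
theorem continuous_mix {T : Sym p n → B →L[ℝ] B} (hT : ∀ v, Continuous fun g => T g v)
    (u : MultiIdx n k → B) : Continuous fun g => mix T g u := by
  refine continuous_pi fun β => ?_
  simp only [mix_apply]
  refine (continuous_scale.inv₀ fun g => g.scale_pos.ne').smul
    (continuous_finsetSum _ fun σ _ => (continuous_coef β σ).smul (hT _))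

end Mix

/-! ### The action on `C₀` -/

/-- Composition with the point transformation on `C₀`. -/
def compC0 (g : Sym p n) :
    ZeroAtInftyContinuousMap (Rd n) ℝ →L[ℝ] ZeroAtInftyContinuousMap (Rd n) ℝ :=
  LinearMap.mkContinuous (ZeroAtInftyContinuousMap.compLinearMap g.pointHomeo.toCocompactMap) 1
    fun u => by
      rw [one_mul, ← ZeroAtInftyContinuousMap.norm_toBCF_eq_norm,
        ← ZeroAtInftyContinuousMap.norm_toBCF_eq_norm,
        BoundedContinuousFunction.norm_le (norm_nonneg _)]
      exact fun x => u.toBCF.norm_coe_le_norm (g.point x)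

/-- Outside a large ball both terms are small, uniformly for `g` near `g₀`, because `u` vanishes at
infinity; on the ball, compactness makes pointwise continuity in `g` uniform. -/
theorem eventually_norm_comp_sub_lt (u : ZeroAtInftyContinuousMap (Rd n) ℝ) (g₀ : Sym p n) {η : ℝ}
    (hη : 0 < η) : ∀ᶠ g in 𝓝 g₀, ∀ x, |u (g.point x) - u (g₀.point x)| < η := by
  obtain ⟨R, hR⟩ : ∃ R, ∀ y : Rd n, R ≤ ‖y‖ → |u y| < η / 2 := by
    have h := (Metric.tendsto_nhds.1 u.zero_at_infty') (η / 2) (by positivity)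
    rw [← Metric.cobounded_eq_cocompact, ← comap_norm_atTop, eventually_comap,
      eventually_atTop] at h
    obtain ⟨R, hR⟩ := h
    refine ⟨R, fun y hy => ?_⟩
    have := hR _ hy y rfl
    rwa [Real.dist_eq, sub_zero] at this
  -- Near `g₀` the scaling factors stay above `s` and the translations below `b`, so `‖x‖ ≥ |R| / s
  -- + b` forces `‖g.point x‖ ≥ R`.
  set s := g₀.scale ^ (1 - p) / 2 with hs
  have hs0 : 0 < s := half_pos g₀.factor_pos
  set b := ‖g₀.vec‖ + 1 with hb
  have h1 : ∀ᶠ g : Sym p n in 𝓝 g₀, s < g.scale ^ (1 - p) :=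
    (continuous_factor.tendsto g₀).eventually_const_lt (half_lt_self g₀.factor_pos)
  have h2 : ∀ᶠ g : Sym p n in 𝓝 g₀, ‖g.vec‖ < b :=
    (continuous_vec.norm.tendsto g₀).eventually_lt_const (lt_add_one _)
  have hfar : ∀ g : Sym p n, s < g.scale ^ (1 - p) → ‖g.vec‖ < b →
      ∀ x : Rd n, |R| / s + b ≤ ‖x‖ → |u (g.point x)| < η / 2 := by
    intro g hg hg' x hx
    refine hR _ ?_
    rw [point_eq, norm_lin]
    have h3 : |R| / s ≤ ‖x - g.vec‖ := by
      have := norm_sub_norm_le x g.vec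
      linarith
    calc R ≤ |R| := le_abs_self R
      _ = s * (|R| / s) := by field_simp
      _ ≤ g.scale ^ (1 - p) * ‖x - g.vec‖ := by
          gcongr
          exact g.factor_pos.le
  have hnear : ∀ᶠ g in 𝓝 g₀, ∀ x ∈ Metric.closedBall (0 : Rd n) (|R| / s + b),
      |u (g.point x) - u (g₀.point x)| < η := by
    refine (isCompact_closedBall _ _).eventually_forall_of_forall_eventually fun x _ => ?_
    have hc : Continuous fun z : Sym p n × Rd n => |u (z.1.point z.2) - u (g₀.point z.2)| := by
      have h3 : Continuous fun z : Sym p n × Rd n => u (z.1.point z.2) :=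
        (map_continuous u).comp (continuous_point continuous_fst continuous_snd)
      have h4 : Continuous fun z : Sym p n × Rd n => u (g₀.point z.2) :=
        (map_continuous u).comp (continuous_point continuous_const continuous_snd)
      exact (h3.sub h4).abs
    refine (hc.tendsto (g₀, x)).eventually_lt_const ?_
    simpa using hη
  filter_upwards [h1, h2, hnear] with g hg hg' hgn x
  by_cases hx : x ∈ Metric.closedBall (0 : Rd n) (|R| / s + b)
  · exact hgn x hx
  · rw [mem_closedBall_zero_iff, not_le] at hx
    have h3 := hfar g hg hg' x hx.le
    have h4 := hfar g₀ (half_lt_self g₀.factor_pos) (lt_add_one _) x hx.le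
    have h5 := abs_sub (u (g.point x)) (u (g₀.point x))
    linarith

theorem continuous_compC0 (u : ZeroAtInftyContinuousMap (Rd n) ℝ) :
    Continuous fun g : Sym p n => g.compC0 u := by
  rw [continuous_iff_continuousAt]
  intro g₀
  rw [ContinuousAt, Metric.tendsto_nhds]
  intro η hη
  filter_upwards [eventually_norm_comp_sub_lt u g₀ (half_pos hη)] with g hg
  rw [← ZeroAtInftyContinuousMap.dist_toBCF_eq_dist]
  refine lt_of_le_of_lt ((BoundedContinuousFunction.dist_le (half_pos hη).le).2 fun x => ?_)
    (half_lt_self hη)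
  exact (hg x).le

end Sym

end Point

/-! ### Completeness of `C₀ᵏ` -/

section CompleteC0k

variable {n k : ℕ}

/-- The product `w ↦ ∏ⱼ (wⱼ)_{σ(j)}` of coordinates as a multilinear map. -/
def coordProd {m : ℕ} (σ : Fin m → Fin (n + 1)) :
    ContinuousMultilinearMap ℝ (fun _ : Fin m => Rd n) ℝ :=
  (ContinuousMultilinearMap.mkPiAlgebra ℝ (Fin m) ℝ).compContinuousLinearMap
    fun j => EuclideanSpace.proj (𝕜 := ℝ) (σ j)

theorem coordProd_apply {m : ℕ} (σ : Fin m → Fin (n + 1)) (w : Fin m → Rd n) :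
    coordProd σ w = ∏ j, w j (σ j) := by
  simp [coordProd]

theorem iteratedFDeriv_eq_sum {m : ℕ} (hm : m ≤ k) {u : Rd n → ℝ} (hu : ContDiff ℝ k u)
    (x : Rd n) : iteratedFDeriv ℝ m u x =
      ∑ σ : Fin m → Fin (n + 1), partialDeriv (countIdx hm σ) u x • coordProd σ := by
  ext w
  rw [iteratedFDeriv_apply_eq_sum hm hu, sum_apply]
  exact Finset.sum_congr rfl fun σ _ => by
    rw [smul_apply, coordProd_apply, smul_eq_mul, mul_comm]

/-- The Taylor series that is determined by a family of partial derivatives. -/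
def taylorOf (u : MultiIdx n k → Rd n → ℝ) (x : Rd n) :
    FormalMultilinearSeries ℝ (Rd n) ℝ := fun m =>
  if hm : m ≤ k then ∑ σ : Fin m → Fin (n + 1), u (countIdx hm σ) x • coordProd σ else 0

theorem taylorOf_of_le (u : MultiIdx n k → Rd n → ℝ) (x : Rd n) {m : ℕ} (hm : m ≤ k) :
    taylorOf u x m = ∑ σ : Fin m → Fin (n + 1), u (countIdx hm σ) x • coordProd σ := by
  rw [taylorOf, dif_pos hm]

theorem tendstoUniformly_taylorOf {u : ℕ → MultiIdx n k → Rd n → ℝ} {v : MultiIdx n k → Rd n → ℝ}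
    (h : ∀ β, TendstoUniformly (fun i => u i β) (v β) atTop) {m : ℕ} (hm : m ≤ k) :
    TendstoUniformly (fun i x => taylorOf (u i) x m) (fun x => taylorOf v x m) atTop := by
  rw [Metric.tendstoUniformly_iff]
  intro η hη
  set C : ℝ := ∑ σ : Fin m → Fin (n + 1), ‖coordProd (n := n) σ‖ with hC
  have hC0 : 0 ≤ C := by positivity
  have h1 : ∀ᶠ i in atTop, ∀ β x, dist (v β x) (u i β x) < η / (C + 1) :=
    eventually_all.2 fun β => Metric.tendstoUniformly_iff.1 (h β) _ (by positivity)
  filter_upwards [h1] with i hi x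
  rw [dist_eq_norm, taylorOf_of_le _ _ hm, taylorOf_of_le _ _ hm, ← Finset.sum_sub_distrib]
  calc ‖∑ σ : Fin m → Fin (n + 1), (v (countIdx hm σ) x • coordProd σ -
        u i (countIdx hm σ) x • coordProd σ)‖
      ≤ ∑ σ : Fin m → Fin (n + 1), η / (C + 1) * ‖coordProd (n := n) σ‖ := by
        refine (norm_sum_le _ _).trans (Finset.sum_le_sum fun σ _ => ?_)
        have e : v (countIdx hm σ) x • coordProd σ - u i (countIdx hm σ) x • coordProd σ =
          (v (countIdx hm σ) x - u i (countIdx hm σ) x) • coordProd (n := n) σ :=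
          (sub_smul _ _ _).symm
        rw [e, norm_smul, ← dist_eq_norm]
        gcongr
        exact (hi _ x).le
    _ = η / (C + 1) * C := by rw [← Finset.mul_sum]
    _ < η := by
        rw [div_mul_eq_mul_div, div_lt_iff₀ (by positivity)]
        nlinarith

/-- A uniform limit of functions whose derivatives converge uniformly is differentiable with the
limiting derivative. Applied at each order to the Taylor series built from the families, this
identifies the limit family as the derivatives of its zeroth member. -/
theorem isClosed_C0kSubmodule : IsClosed (C0kSubmodule n k : Set
    (MultiIdx n k → ZeroAtInftyContinuousMap (Rd n) ℝ)) := by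
  rw [← isSeqClosed_iff_isClosed]
  intro u v hu huv
  have hunif : ∀ β, TendstoUniformly (fun i => (u i β : Rd n → ℝ)) (v β) atTop := by
    intro β
    have := (ZeroAtInftyContinuousMap.tendsto_iff_tendstoUniformly).1 ((tendsto_pi_nhds.1 huv) β)
    exact this
  have hpt : ∀ β x, Tendsto (fun i => u i β x) atTop (𝓝 (v β x)) := fun β x =>
    (hunif β).tendsto_at x
  have hser : ∀ i m (hm : m ≤ k) x, iteratedFDeriv ℝ m (u i (zeroIdx n k)) x =
      taylorOf (fun β => (u i β : Rd n → ℝ)) x m := by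
    intro i m hm x
    rw [iteratedFDeriv_eq_sum hm (hu i).1, taylorOf_of_le _ _ hm]
    simp only [(hu i).2]
  have hder : ∀ m (hm : m < k) x, HasFDerivAt (fun x => taylorOf (fun β => (v β : Rd n → ℝ)) x m)
      (taylorOf (fun β => (v β : Rd n → ℝ)) x (m + 1)).curryLeft x := by
    intro m hm x
    have hL : UniformContinuous (fun M : ContinuousMultilinearMap ℝ (fun _ : Fin (m + 1) => Rd n) ℝ =>
        M.curryLeft) :=
      (continuousMultilinearCurryLeftEquiv ℝ (fun _ : Fin (m + 1) => Rd n) ℝ).isometry.uniformContinuous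
    refine hasFDerivAt_of_tendstoUniformly (l := atTop)
      (f := fun i x => taylorOf (fun β => (u i β : Rd n → ℝ)) x m)
      (f' := fun i x => (taylorOf (fun β => (u i β : Rd n → ℝ)) x (m + 1)).curryLeft)
      (hL.comp_tendstoUniformly (tendstoUniformly_taylorOf hunif (Nat.succ_le_of_lt hm))) ?_ ?_ x
    · intro i x
      have h1 := ((hu i).1.ftaylorSeries).fderiv m (by exact_mod_cast hm) x
      simp only [ftaylorSeries, hser i m hm.le, hser i (m + 1) (Nat.succ_le_of_lt hm)] at h1
      exact h1
    · intro x
      exact (tendstoUniformly_taylorOf hunif hm.le).tendsto_at x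
  have hT : HasFTaylorSeriesUpTo k (v (zeroIdx n k)) (taylorOf fun β => (v β : Rd n → ℝ)) := by
    refine ⟨fun x => ?_, fun m hm x => hder m (by exact_mod_cast hm) x, fun m hm => ?_⟩
    · rw [taylorOf_of_le _ _ (Nat.zero_le k), Fintype.sum_unique]
      have e : ∀ σ : Fin 0 → Fin (n + 1), countIdx (Nat.zero_le k) σ = zeroIdx n k := fun σ => by
        refine Subtype.ext (funext fun i => Fin.ext ?_)
        exact Fintype.card_eq_zero (α := {j : Fin 0 // σ j = i})
      rw [e]
      simp [ContinuousMultilinearMap.curry0, coordProd_apply]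
    · have hm' : m ≤ k := by exact_mod_cast hm
      have e : (fun x => taylorOf (fun β => (v β : Rd n → ℝ)) x m) = fun x =>
          ∑ σ : Fin m → Fin (n + 1), v (countIdx hm' σ) x • coordProd σ :=
        funext fun x => taylorOf_of_le _ _ hm'
      rw [e]
      exact continuous_finsetSum _ fun σ _ => (map_continuous (v _)).smul continuous_const
  refine ⟨hT.contDiff, fun β x => ?_⟩
  have h1 : ∀ (i : ℕ), u i β x = taylorOf (fun β => (u i β : Rd n → ℝ)) x (order β) (directions β) := by
    intro i
    rw [(hu i).2 β x, partialDeriv, hser i _ (order_le β)]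
  have h2 : Tendsto (fun i => u i β x) atTop
      (𝓝 (taylorOf (fun β => (v β : Rd n → ℝ)) x (order β) (directions β))) := by
    simp only [h1]
    exact ((ContinuousMultilinearMap.apply ℝ (fun _ : Fin (order β) => Rd n) ℝ
      (directions β)).continuous.tendsto _).comp
        ((tendstoUniformly_taylorOf hunif (order_le β)).tendsto_at x)
  rw [tendsto_nhds_unique (hpt β x) h2, partialDeriv,
    hT.eq_iteratedFDeriv (by exact_mod_cast order_le β)]

instance : CompleteSpace (C0k n k) := isClosed_C0kSubmodule.completeSpace_coe

end CompleteC0k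

/-! ### The action on `C₀ᵏ` -/

namespace Sym

variable {n k : ℕ} {p : ℝ}

theorem mix_compC0_zeroIdx (g : Sym p n) (u : MultiIdx n k → ZeroAtInftyContinuousMap (Rd n) ℝ) :
    (mix compC0 g u (zeroIdx n k) : Rd n → ℝ) = act p g (u (zeroIdx n k)) := by
  rw [mix_zeroIdx, act_eq_smul]
  rfl

theorem zeroAtInfty_sum_apply {α : Type*} (s : Finset α)
    (f : α → ZeroAtInftyContinuousMap (Rd n) ℝ) (x : Rd n) : (∑ a ∈ s, f a) x = ∑ a ∈ s, f a x := by
  classical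
  induction s using Finset.induction_on with
  | empty => simp
  | insert a s ha ih => rw [Finset.sum_insert ha, Finset.sum_insert ha, ← ih]; rfl

theorem mix_compC0_apply (g : Sym p n) (u : MultiIdx n k → ZeroAtInftyContinuousMap (Rd n) ℝ)
    (β : MultiIdx n k) (x : Rd n) : mix compC0 g u β x =
      g.scale⁻¹ * ∑ σ, g.coef β σ * u (countIdx (order_le β) σ) (g.point x) := by
  rw [mix_apply]
  rw [ZeroAtInftyContinuousMap.smul_apply, zeroAtInfty_sum_apply, smul_eq_mul]
  rfl

theorem mix_compC0_mem (g : Sym p n) {u : MultiIdx n k → ZeroAtInftyContinuousMap (Rd n) ℝ}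
    (hu : u ∈ C0kSubmodule n k) : mix compC0 g u ∈ C0kSubmodule n k := by
  have h : ContDiff ℝ k (act p g (u (zeroIdx n k))) := by
    rw [act_eq_smul]
    exact contDiff_const.smul (hu.1.comp g.contDiff_point)
  refine ⟨by rw [mix_compC0_zeroIdx]; exact h, fun β x => ?_⟩
  rw [mix_compC0_zeroIdx, partialDeriv_act g hu.1, mix_compC0_apply]
  simp only [hu.2]

/-- The higher components are determined by the function, so the action laws only have to be checked
on functions. -/
theorem C0k_ext {u v : C0k n k} (h : u.fn = v.fn) : u = v := by
  refine Subtype.ext (funext fun β => ZeroAtInftyContinuousMap.ext fun x => ?_)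
  rw [u.2.2, v.2.2]
  exact congrArg (fun f => partialDeriv β f x) h

/-- The operator `a(g)` on `C₀ᵏ`. -/
def opC0k (g : Sym p n) : C0k n k →L[ℝ] C0k n k :=
  ((mix compC0 g).comp (C0kSubmodule n k).subtypeL).codRestrict (C0kSubmodule n k)
    fun u => mix_compC0_mem g u.2

theorem fn_opC0k (g : Sym p n) (u : C0k n k) : (opC0k g u).fn = act p g u.fn :=
  mix_compC0_zeroIdx g u.1

theorem continuous_opC0k (u : C0k n k) : Continuous fun g : Sym p n => opC0k g u :=
  (continuous_mix continuous_compC0 u.1).subtype_mk _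

/-- The action of the symmetry group on `C₀ᵏ`. -/
def actionC0k (p : ℝ) (n k : ℕ) : Sym p n →* (C0k n k →L[ℝ] C0k n k) where
  toFun := opC0k
  map_one' := ContinuousLinearMap.ext fun u => C0k_ext (by rw [fn_opC0k, act_one]; rfl)
  map_mul' g h := ContinuousLinearMap.ext fun u => C0k_ext (by
    rw [fn_opC0k, act_mul, mul_apply_eq_comp, fn_opC0k, fn_opC0k])

end Sym

theorem continuousAt_of_dense {Z B : Type*} [TopologicalSpace Z] [NormedAddCommGroup B]
    [NormedSpace ℝ B] {T : Z → B →L[ℝ] B} {z : Z} {C : ℝ} (hb : ∀ᶠ y in 𝓝 z, ‖T y‖ ≤ C)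
    {S : Set B} (hS : Dense S) (hT : ∀ v ∈ S, ContinuousAt (fun y => T y v) z) (v : B) :
    ContinuousAt (fun y => T y v) z := by
  have hC : 0 ≤ C := (norm_nonneg _).trans hb.self_of_nhds
  rw [ContinuousAt, Metric.tendsto_nhds]
  intro η hη
  obtain ⟨w, hw, hvw⟩ := Metric.mem_closure_iff.1 (hS v) (η / (3 * (C + 1))) (by positivity)
  have h1 := (Metric.tendsto_nhds.1 (hT w hw)) (η / 3) (by positivity)
  have h2 : ∀ y, ‖T y‖ ≤ C → dist (T y v) (T y w) ≤ η / 3 := by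
    intro y hy
    rw [dist_eq_norm, ← map_sub]
    calc ‖T y (v - w)‖ ≤ ‖T y‖ * ‖v - w‖ := (T y).le_opNorm _
      _ ≤ (C + 1) * (η / (3 * (C + 1))) := by
          rw [← dist_eq_norm]
          gcongr
          linarith
      _ = η / 3 := by field_simp
  filter_upwards [hb, h1] with y hy hy'
  have h3 := h2 y hy
  have h4 := h2 z hb.self_of_nhds
  rw [dist_comm] at h4
  have h5 := dist_triangle4 (T y v) (T y w) (T z w) (T z v)
  have h6 : dist (T y w) (T z w) < η / 3 := hy'
  linarith

namespace Sym

variable {n k : ℕ} {p : ℝ}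

/-! ### The action on `L²` -/

/-- The rotation as a linear isometry. -/
def rotEquiv (g : Sym p n) : Rd n ≃ₗᵢ[ℝ] Rd n where
  toFun x := rot g.mat.transpose x
  invFun x := rot g.mat x
  left_inv x := by
    change rot g.mat (rot g.mat.transpose x) = x
    rw [← rot_mul, g.mat_mul_transpose, rot_one]
  right_inv x := by
    change rot g.mat.transpose (rot g.mat x) = x
    rw [← rot_mul, g.mat_transpose_mul, rot_one]
  map_add' := rot_add _
  map_smul' c x := rot_smul _ c x
  norm_map' x := norm_rot (by rw [Matrix.transpose_transpose, g.mat_mul_transpose]) x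

/-- The inverse of the Jacobian determinant of the point transformation. -/
def jac (g : Sym p n) : ℝ := ((g.scale ^ (1 - p)) ^ (n + 1))⁻¹

theorem jac_pos (g : Sym p n) : 0 < g.jac := inv_pos.2 (pow_pos g.factor_pos _)

theorem continuous_jac : Continuous (jac : Sym p n → ℝ) :=
  (continuous_factor.pow _).inv₀ fun g => (pow_pos g.factor_pos _).ne'

/-- Translation and rotation preserve the volume; only the dilation contributes, to the power `n +
1`, the dimension. -/
theorem map_point (g : Sym p n) :
    Measure.map g.point volume = ENNReal.ofReal g.jac • (volume : Measure (Rd n)) := by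
  have h1 : MeasurePreserving (fun x : Rd n => x - g.vec) := measurePreserving_sub_right _ _
  have h2 : MeasurePreserving g.rotEquiv := g.rotEquiv.measurePreserving
  have h3 := Measure.map_addHaar_smul (volume : Measure (Rd n)) g.factor_pos.ne'
  have h4 : g.point = (fun x => g.scale ^ (1 - p) • x) ∘ (g.rotEquiv ∘ fun x => x - g.vec) := rfl
  rw [h4, ← Measure.map_map (by fun_prop) (h2.measurable.comp h1.measurable),
    (h2.comp h1).map_eq, h3, finrank_euclideanSpace_fin, abs_of_pos (inv_pos.2 (pow_pos g.factor_pos _))]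
  rfl

theorem measurable_point (g : Sym p n) : Measurable g.point :=
  g.pointHomeo.continuous.measurable

theorem quasiMeasurePreserving_point (g : Sym p n) :
    Measure.QuasiMeasurePreserving g.point (volume : Measure (Rd n)) volume :=
  ⟨g.measurable_point, by rw [map_point]; exact Measure.smul_absolutelyContinuous⟩

theorem integral_comp_point (g : Sym p n) (f : Rd n → ℝ) :
    ∫ x, f (g.point x) = g.jac * ∫ x, f x := by
  have h := g.pointHomeo.measurableEmbedding.integral_map (μ := volume) f
  change ∫ y, f y ∂(Measure.map g.point volume) = ∫ x, f (g.point x) at h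
  rw [← h, map_point, integral_smul_measure, ENNReal.toReal_ofReal g.jac_pos.le, smul_eq_mul]

theorem memLp_comp_point (g : Sym p n) {f : Rd n → ℝ} (hf : MemLp f 2 volume) :
    MemLp (f ∘ g.point) 2 volume := by
  refine MemLp.comp_of_map ?_ g.measurable_point.aemeasurable
  rw [map_point]
  exact hf.smul_measure ENNReal.ofReal_ne_top

theorem eLpNorm_comp_point (g : Sym p n) {f : Rd n → ℝ} (hf : AEStronglyMeasurable f volume) :
    eLpNorm (f ∘ g.point) 2 volume = ENNReal.ofReal (g.jac ^ (1 / 2 : ℝ)) * eLpNorm f 2 volume := by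
  rw [← eLpNorm_map_measure _ g.measurable_point.aemeasurable, map_point,
    eLpNorm_smul_measure_of_ne_top (by norm_num), ENNReal.ofReal_rpow_of_pos g.jac_pos]
  · simp
  · rw [map_point]
    exact hf.mono_ac Measure.smul_absolutelyContinuous

theorem toLp_comp_point_ae (g : Sym p n) (u : Lp ℝ 2 (volume : Measure (Rd n))) :
    (memLp_comp_point g (Lp.memLp u)).toLp =ᵐ[volume] fun x => u (g.point x) :=
  MemLp.coeFn_toLp _

/-- Composition with the point transformation on `L²`. -/
def compL2 (g : Sym p n) :
    Lp ℝ 2 (volume : Measure (Rd n)) →L[ℝ] Lp ℝ 2 (volume : Measure (Rd n)) :=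
  LinearMap.mkContinuous
    { toFun := fun u => (memLp_comp_point g (Lp.memLp u)).toLp
      map_add' := fun u v => by
        refine Lp.ext ?_
        filter_upwards [toLp_comp_point_ae g (u + v), toLp_comp_point_ae g u,
          toLp_comp_point_ae g v, Lp.coeFn_add (memLp_comp_point g (Lp.memLp u)).toLp
            (memLp_comp_point g (Lp.memLp v)).toLp,
          g.quasiMeasurePreserving_point.ae (Lp.coeFn_add u v)] with x h1 h2 h3 h4 h5
        rw [h1, h4, Pi.add_apply, h2, h3, h5, Pi.add_apply]
      map_smul' := fun c u => by
        refine Lp.ext ?_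
        filter_upwards [toLp_comp_point_ae g (c • u), toLp_comp_point_ae g u,
          Lp.coeFn_smul c (memLp_comp_point g (Lp.memLp u)).toLp,
          g.quasiMeasurePreserving_point.ae (Lp.coeFn_smul c u)] with x h1 h2 h3 h4
        rw [h1, RingHom.id_apply, h3, Pi.smul_apply, h2, h4, Pi.smul_apply] }
    (g.jac ^ (1 / 2 : ℝ)) fun u => by
      change ‖(memLp_comp_point g (Lp.memLp u)).toLp‖ ≤ _
      rw [Lp.norm_toLp, eLpNorm_comp_point g (Lp.memLp u).1, ENNReal.toReal_mul,
        ENNReal.toReal_ofReal (Real.rpow_nonneg g.jac_pos.le _)]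
      rfl

theorem compL2_ae (g : Sym p n) (u : Lp ℝ 2 (volume : Measure (Rd n))) :
    g.compL2 u =ᵐ[volume] fun x => u (g.point x) := toLp_comp_point_ae g u

theorem norm_compL2_le (g : Sym p n) : ‖g.compL2‖ ≤ g.jac ^ (1 / 2 : ℝ) :=
  LinearMap.mkContinuous_norm_le _ (Real.rpow_nonneg g.jac_pos.le _) _

theorem eventually_norm_compL2_le (g₀ : Sym p n) :
    ∀ᶠ g : Sym p n in 𝓝 g₀, ‖g.compL2‖ ≤ g₀.jac ^ (1 / 2 : ℝ) + 1 := by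
  have h : Continuous fun g : Sym p n => g.jac ^ (1 / 2 : ℝ) :=
    continuous_jac.rpow_const fun g => Or.inl g.jac_pos.ne'
  filter_upwards [(h.tendsto g₀).eventually_lt_const (lt_add_one _)] with g hg
  exact (norm_compL2_le g).trans hg.le

theorem dense_compactSupport_L2 : Dense {u : Lp ℝ 2 (volume : Measure (Rd n)) |
    ∃ f : Rd n → ℝ, HasCompactSupport f ∧ Continuous f ∧ u =ᵐ[volume] f} := by
  intro u
  rw [Metric.mem_closure_iff]
  intro η hη
  obtain ⟨f, hf, hfu, hfc, hfm⟩ := (Lp.memLp u).exists_hasCompactSupport_eLpNorm_sub_le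
    (by norm_num) (ε := ENNReal.ofReal (η / 2)) (by simpa using hη)
  refine ⟨hfm.toLp, ⟨f, hf, hfc, hfm.coeFn_toLp⟩, ?_⟩
  have h : ((u : Rd n → ℝ) - ((hfm.toLp : Lp ℝ 2 (volume : Measure (Rd n))) : Rd n → ℝ)) =ᵐ[volume]
      (u : Rd n → ℝ) - f := ae_eq_rfl.sub hfm.coeFn_toLp
  rw [Lp.dist_def, eLpNorm_congr_ae h]
  calc (eLpNorm ((u : Rd n → ℝ) - f) 2 volume).toReal ≤ (ENNReal.ofReal (η / 2)).toReal :=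
        ENNReal.toReal_mono ENNReal.ofReal_ne_top hfu
    _ = η / 2 := ENNReal.toReal_ofReal (by positivity)
    _ < η := by linarith

/-- Near `g₀` the transformed functions share a compact support `K`, and there uniform convergence
implies convergence in `L²`. -/
theorem continuousAt_compL2_of_compactSupport (g₀ : Sym p n)
    (u : Lp ℝ 2 (volume : Measure (Rd n))) {f : Rd n → ℝ} (hf : HasCompactSupport f)
    (hfc : Continuous f) (hu : u =ᵐ[volume] f) : ContinuousAt (fun g : Sym p n => g.compL2 u) g₀ := by
  let f' : ZeroAtInftyContinuousMap (Rd n) ℝ := ⟨⟨f, hfc⟩, hf.is_zero_at_infty⟩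
  -- the supports of the functions `f ∘ g.point` for `g` near `g₀` lie in a compact set
  obtain ⟨R, hR⟩ : ∃ R : ℝ, ∀ y, R < ‖y‖ → f y = 0 := by
    obtain ⟨R, hR⟩ := hf.isCompact.isBounded.subset_closedBall 0
    refine ⟨R, fun y hy => ?_⟩
    by_contra h
    have := hR (subset_tsupport f h)
    rw [mem_closedBall_zero_iff] at this
    linarith
  set s := g₀.scale ^ (1 - p) / 2 with hs
  have hs0 : 0 < s := half_pos g₀.factor_pos
  set b := ‖g₀.vec‖ + 1 with hb
  have h1 : ∀ᶠ g : Sym p n in 𝓝 g₀, s < g.scale ^ (1 - p) :=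
    (continuous_factor.tendsto g₀).eventually_const_lt (half_lt_self g₀.factor_pos)
  have h2 : ∀ᶠ g : Sym p n in 𝓝 g₀, ‖g.vec‖ < b :=
    (continuous_vec.norm.tendsto g₀).eventually_lt_const (lt_add_one _)
  set K := Metric.closedBall (0 : Rd n) (|R| / s + b) with hK
  have hfar : ∀ g : Sym p n, s < g.scale ^ (1 - p) → ‖g.vec‖ < b →
      ∀ x ∉ K, f (g.point x) = 0 := by
    intro g hg hg' x hx
    rw [hK, mem_closedBall_zero_iff, not_le] at hx
    refine hR _ ?_
    rw [point_eq, norm_lin]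
    have h3 : |R| / s < ‖x - g.vec‖ := by
      have := norm_sub_norm_le x g.vec
      linarith
    calc R ≤ |R| := le_abs_self R
      _ = s * (|R| / s) := by field_simp
      _ < s * ‖x - g.vec‖ := by gcongr
      _ ≤ g.scale ^ (1 - p) * ‖x - g.vec‖ := by gcongr
  set V : ℝ := (volume K ^ (1 / 2 : ℝ)).toReal with hV
  have hVt : volume K ^ (1 / 2 : ℝ) ≠ ⊤ :=
    ENNReal.rpow_ne_top_of_nonneg (by norm_num) (isCompact_closedBall _ _).measure_lt_top.ne
  rw [ContinuousAt, Metric.tendsto_nhds]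
  intro η hη
  -- A uniform difference of `η / (V + 1)` on `K` has `L²` norm at most `η V / (V + 1) < η`, where
  -- `V` is the square root of the volume of `K`.
  filter_upwards [h1, h2, eventually_norm_comp_sub_lt f' g₀ (η := η / (V + 1))
    (by positivity)] with g hg hg' hgf
  have hae : (g.compL2 u - g₀.compL2 u : Rd n → ℝ) =ᵐ[volume]
      fun x => f (g.point x) - f (g₀.point x) := by
    filter_upwards [compL2_ae g u, compL2_ae g₀ u, g.quasiMeasurePreserving_point.ae hu,
      g₀.quasiMeasurePreserving_point.ae hu] with x h3 h4 h5 h6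
    rw [Pi.sub_apply, h3, h4, h5, h6]
  rw [Lp.dist_def, eLpNorm_congr_ae hae]
  have hle : eLpNorm (fun x => f (g.point x) - f (g₀.point x)) 2 volume ≤
      eLpNorm (K.indicator fun _ => η / (V + 1)) 2 (volume : Measure (Rd n)) := by
    refine eLpNorm_mono fun x => ?_
    by_cases hx : x ∈ K
    · rw [Set.indicator_of_mem hx, Real.norm_of_nonneg (by positivity : 0 ≤ η / (V + 1))]
      exact (hgf x).le
    · rw [hfar g hg hg' x hx, hfar g₀ (half_lt_self g₀.factor_pos) (lt_add_one _) x hx]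
      simp
  have hind : eLpNorm (K.indicator fun _ => η / (V + 1)) 2 (volume : Measure (Rd n)) =
      ENNReal.ofReal (η / (V + 1)) * volume K ^ (1 / 2 : ℝ) := by
    rw [eLpNorm_indicator_const Metric.isClosed_closedBall.measurableSet (by norm_num)
      (by norm_num), Real.enorm_of_nonneg (by positivity)]
    norm_num [hK]
  rw [hind] at hle
  calc _ ≤ (ENNReal.ofReal (η / (V + 1)) * volume K ^ (1 / 2 : ℝ)).toReal :=
        ENNReal.toReal_mono (ENNReal.mul_ne_top ENNReal.ofReal_ne_top hVt) hle
    _ = η / (V + 1) * V := by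
        rw [ENNReal.toReal_mul, ENNReal.toReal_ofReal (by positivity)]
    _ < η := by
        have : 0 ≤ V := ENNReal.toReal_nonneg
        rw [div_mul_eq_mul_div, div_lt_iff₀ (by positivity)]
        nlinarith

theorem continuous_compL2 (u : Lp ℝ 2 (volume : Measure (Rd n))) :
    Continuous fun g : Sym p n => g.compL2 u := by
  rw [continuous_iff_continuousAt]
  intro g₀
  refine continuousAt_of_dense (eventually_norm_compL2_le g₀) dense_compactSupport_L2 ?_ u
  rintro v ⟨f, hf, hfc, hv⟩
  exact continuousAt_compL2_of_compactSupport g₀ v hf hfc hv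

end Sym

/-! ### Completeness of `Hᵏ` and uniqueness of weak derivatives -/

section CompleteHk

variable {n k : ℕ}

/-- All terms of the chain rule have the same order, so the sign in the definition of weak
derivatives is common to them. -/
theorem order_countIdx {m : ℕ} (hm : m ≤ k) (σ : Fin m → Fin (n + 1)) :
    order (countIdx hm σ) = m := by
  have h := Fintype.card_congr (Equiv.sigmaFiberEquiv σ)
  rw [Fintype.card_sigma, Fintype.card_fin] at h
  exact h

theorem continuous_integral_L2_mul {ψ : Rd n → ℝ} (hψ : Continuous ψ) (hc : HasCompactSupport ψ) :
    Continuous fun u : Lp ℝ 2 (volume : Measure (Rd n)) => ∫ x, u x * ψ x := by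
  have hm : MemLp ψ 2 volume := hψ.memLp_of_hasCompactSupport hc
  have h : (fun u : Lp ℝ 2 (volume : Measure (Rd n)) => ∫ x, u x * ψ x) =
      fun u => inner ℝ hm.toLp u := by
    funext u
    rw [L2.inner_def]
    refine integral_congr_ae ?_
    filter_upwards [hm.coeFn_toLp] with x hx
    rw [hx]
    rfl
  rw [h]
  exact continuous_const.inner continuous_id

/-- Each test function imposes one equation between continuous functionals (inner products in `L²`),
so the space is an intersection of closed sets. -/
theorem isClosed_HkSubmodule : IsClosed (HkSubmodule n k : Set
    (PiLp 2 fun _ : MultiIdx n k => Lp ℝ 2 (volume : Measure (Rd n)))) := by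
  have h : (HkSubmodule n k : Set
      (PiLp 2 fun _ : MultiIdx n k => Lp ℝ 2 (volume : Measure (Rd n)))) =
      ⋂ (β : MultiIdx n k) (φ : Rd n → ℝ) (_ : ContDiff ℝ (⊤ : ℕ∞) φ) (_ : HasCompactSupport φ),
        {u | ∫ x, u (zeroIdx n k) x * partialDeriv β φ x = (-1) ^ order β * ∫ x, u β x * φ x} := by
    ext u
    simp only [Set.mem_iInter]
    rfl
  rw [h]
  refine isClosed_iInter fun β => isClosed_iInter fun φ => isClosed_iInter fun hφ =>
    isClosed_iInter fun hc => isClosed_eq ?_ (continuous_const.mul ?_)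
  · exact (continuous_integral_L2_mul (continuous_partialDeriv β hφ)
      (hasCompactSupport_partialDeriv β hc)).comp (PiLp.continuous_apply 2 _ _)
  · exact (continuous_integral_L2_mul hφ.continuous hc).comp (PiLp.continuous_apply 2 _ _)

instance : CompleteSpace (Hk n k) := isClosed_HkSubmodule.completeSpace_coe

/-- Weak derivatives are unique by the fundamental lemma of the calculus of variations, so the
function determines the whole family. -/
theorem Hk_ext {u v : Hk n k} (h : u.fn =ᵐ[volume] v.fn) : u = v := by
  refine Subtype.ext (PiLp.ext fun β => Lp.ext ?_)
  refine ae_eq_of_integral_contDiff_smul_eq ((Lp.memLp (u.1 β)).locallyIntegrable (by norm_num))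
    ((Lp.memLp (v.1 β)).locallyIntegrable (by norm_num)) fun φ hφ hc => ?_
  have h1 := u.2 β φ hφ hc
  have h2 := v.2 β φ hφ hc
  have h3 : ∫ x, u.1 (zeroIdx n k) x * partialDeriv β φ x =
      ∫ x, v.1 (zeroIdx n k) x * partialDeriv β φ x := by
    refine integral_congr_ae ?_
    filter_upwards [h] with x hx
    exact congrArg (· * partialDeriv β φ x) hx
  have h4 := mul_left_cancel₀ (pow_ne_zero (order β) (by norm_num : (-1 : ℝ) ≠ 0))
    (h1.symm.trans (h3.trans h2))
  simpa only [smul_eq_mul, mul_comm] using h4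

end CompleteHk

/-! ### The action on `Hᵏ` -/

namespace Sym

variable {n k : ℕ} {p : ℝ}

theorem mix_compL2_ae (g : Sym p n) (u : MultiIdx n k → Lp ℝ 2 (volume : Measure (Rd n)))
    (β : MultiIdx n k) : mix compL2 g u β =ᵐ[volume] fun x =>
      g.scale⁻¹ * ∑ σ, g.coef β σ * u (countIdx (order_le β) σ) (g.point x) := by
  rw [mix_apply]
  have h1 : ∀ᵐ x : Rd n, ∀ σ : Fin (order β) → Fin (n + 1),
      (g.coef β σ • g.compL2 (u (countIdx (order_le β) σ)) :
        Lp ℝ 2 (volume : Measure (Rd n))) x =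
      g.coef β σ * u (countIdx (order_le β) σ) (g.point x) := by
    rw [ae_all_iff]
    intro σ
    filter_upwards [Lp.coeFn_smul (g.coef β σ) (g.compL2 (u (countIdx (order_le β) σ))),
      compL2_ae g (u (countIdx (order_le β) σ))] with x h1 h2
    rw [h1, Pi.smul_apply, h2, smul_eq_mul]
  filter_upwards [h1, Lp.coeFn_smul g.scale⁻¹
      (∑ σ, g.coef β σ • g.compL2 (u (countIdx (order_le β) σ))),
    Lp.coeFn_fun_finsetSum Finset.univ
      fun σ => g.coef β σ • g.compL2 (u (countIdx (order_le β) σ))] with x h2 h3 h4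
  rw [h3, Pi.smul_apply, h4, smul_eq_mul]
  simp only [h2]

theorem integral_sum_coef_mul {m : ℕ} (c : ℝ) (a : (Fin m → Fin (n + 1)) → ℝ)
    {f : (Fin m → Fin (n + 1)) → Rd n → ℝ} (hf : ∀ σ, Integrable (f σ)) :
    ∫ x, c * ∑ σ, a σ * f σ x = c * ∑ σ, a σ * ∫ x, f σ x := by
  rw [integral_const_mul, integral_finsetSum _ fun σ _ => (hf σ).const_mul _]
  simp only [integral_const_mul]

theorem mix_compL2_zeroIdx (g : Sym p n)
    (u : MultiIdx n k → Lp ℝ 2 (volume : Measure (Rd n))) :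
    mix compL2 g u (zeroIdx n k) =ᵐ[volume] act p g (u (zeroIdx n k)) := by
  filter_upwards [mix_compL2_ae g u (zeroIdx n k)] with x hx
  rw [hx, Fintype.sum_unique, coef_zeroIdx, one_mul, countIdx_zeroIdx, act_apply]

/-- The transformation is moved to the test function by a change of variables, and the classical
chain rule is applied to `ψ = φ ∘ g⁻¹.point`. The same Jacobian factor appears on both sides. -/
theorem mix_compL2_isWeakDeriv (g : Sym p n)
    {u : MultiIdx n k → Lp ℝ 2 (volume : Measure (Rd n))}
    (hu : ∀ β, IsWeakDeriv β (u (zeroIdx n k)) (u β)) (β : MultiIdx n k) :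
    IsWeakDeriv β (mix compL2 g u (zeroIdx n k)) (mix compL2 g u β) := by
  intro φ hφ hc
  set ψ : Rd n → ℝ := φ ∘ g⁻¹.point with hψ
  have hψs : ContDiff ℝ (⊤ : ℕ∞) ψ := hφ.comp g⁻¹.contDiff_point
  have hψc : HasCompactSupport ψ := hc.comp_homeomorph g⁻¹.pointHomeo
  have hφψ : φ = ψ ∘ g.point := by
    funext x
    rw [hψ, Function.comp_apply, Function.comp_apply, ← point_mul, mul_inv_cancel, point_one]
  have hD : ∀ x, partialDeriv β φ x =
      ∑ σ, g.coef β σ * partialDeriv (countIdx (order_le β) σ) ψ (g.point x) := by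
    intro x
    rw [hφψ]
    exact partialDeriv_comp_point g (hψs.of_le (by exact_mod_cast le_top)) β x
  have hL : ∫ x, mix compL2 g u (zeroIdx n k) x * partialDeriv β φ x =
      g.jac * (g.scale⁻¹ * ∑ σ, g.coef β σ *
        ∫ y, u (zeroIdx n k) y * partialDeriv (countIdx (order_le β) σ) ψ y) := by
    rw [← integral_sum_coef_mul _ _ fun σ => integrable_L2_mul _
      (continuous_partialDeriv _ hψs) (hasCompactSupport_partialDeriv _ hψc),
      ← integral_comp_point g]
    refine integral_congr_ae ?_
    filter_upwards [mix_compL2_zeroIdx g u] with x hx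
    rw [hx, hD, act_apply, mul_assoc, Finset.mul_sum]
    simp only [mul_left_comm]
  have hR : ∫ x, mix compL2 g u β x * φ x =
      g.jac * (g.scale⁻¹ * ∑ σ, g.coef β σ * ∫ y, u (countIdx (order_le β) σ) y * ψ y) := by
    rw [← integral_sum_coef_mul _ _ fun σ => integrable_L2_mul _ hψs.continuous hψc,
      ← integral_comp_point g]
    refine integral_congr_ae ?_
    filter_upwards [mix_compL2_ae g u β] with x hx
    rw [hx, hφψ, Function.comp_apply, mul_assoc, Finset.sum_mul]
    simp only [mul_assoc]
  have hu' : ∀ σ : Fin (order β) → Fin (n + 1),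
      ∫ y, u (zeroIdx n k) y * partialDeriv (countIdx (order_le β) σ) ψ y =
        (-1) ^ order β * ∫ y, u (countIdx (order_le β) σ) y * ψ y := by
    intro σ
    rw [hu _ ψ hψs hψc, order_countIdx]
  rw [hL, hR]
  simp only [hu', mul_left_comm _ ((-1 : ℝ) ^ order β), ← Finset.mul_sum]

/-- The operator `a(g)` on `Hᵏ`. -/
def opHk (g : Sym p n) : Hk n k →L[ℝ] Hk n k :=
  (((PiLp.continuousLinearEquiv 2 ℝ
      fun _ : MultiIdx n k => Lp ℝ 2 (volume : Measure (Rd n))).symm.toContinuousLinearMap.comp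
    ((mix compL2 g).comp (PiLp.continuousLinearEquiv 2 ℝ
      fun _ : MultiIdx n k => Lp ℝ 2 (volume : Measure (Rd n))).toContinuousLinearMap)).comp
    (HkSubmodule n k).subtypeL).codRestrict (HkSubmodule n k)
      fun u => mix_compL2_isWeakDeriv g u.2

theorem fn_opHk (g : Sym p n) (u : Hk n k) : (opHk g u).fn =ᵐ[volume] act p g u.fn :=
  mix_compL2_zeroIdx g _

theorem continuous_opHk (u : Hk n k) : Continuous fun g : Sym p n => opHk g u :=
  ((PiLp.continuousLinearEquiv 2 ℝ fun _ : MultiIdx n k =>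
    Lp ℝ 2 (volume : Measure (Rd n))).symm.continuous.comp
      (continuous_mix continuous_compL2 _)).subtype_mk _

theorem act_congr_ae (g : Sym p n) {u v : Rd n → ℝ} (h : u =ᵐ[volume] v) :
    act p g u =ᵐ[volume] act p g v := by
  filter_upwards [g.quasiMeasurePreserving_point.ae h] with x hx
  rw [act_apply, act_apply, hx]

/-- The action of the symmetry group on `Hᵏ`. -/
def actionHk (p : ℝ) (n k : ℕ) : Sym p n →* (Hk n k →L[ℝ] Hk n k) where
  toFun := opHk
  map_one' := ContinuousLinearMap.ext fun u => Hk_ext ((fn_opHk 1 u).trans (by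
    rw [act_one]; rfl))
  map_mul' g h := ContinuousLinearMap.ext fun u => Hk_ext <| (fn_opHk (g * h) u).trans <| by
    rw [act_mul, mul_apply_eq_comp]
    exact ((fn_opHk g _).trans (act_congr_ae g (fn_opHk h u))).symm

end Sym

theorem Sym.continuous_actionC0k {p : ℝ} {n k : ℕ} (v : C0k n k) :
    Continuous fun g => actionC0k p n k g v := continuous_opC0k v

theorem Sym.continuous_actionHk {p : ℝ} {n k : ℕ} (v : Hk n k) :
    Continuous fun g => actionHk p n k g v := continuous_opHk v

/-- From here on the concrete spaces enter only through completeness and strong continuity. -/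
theorem Y0_properties {n : ℕ} {p : ℝ} (κ : ℝ) {ι X : Type*} [Fintype ι] [NormedAddCommGroup X]
    [NormedSpace ℝ X] [CompleteSpace X] (A : Sym p n →* (X →L[ℝ] X))
    (hA : ∀ v, Continuous fun g => A g v) (ε : Module.Basis ι ℝ (SymAlg n)) :
    Dense (Y0 κ (fun g => A g) ε : Set X) ∧ CompleteSpace (Y0Space κ (fun g => A g) ε) ∧
      (∀ v, Continuous fun g : SymGroup n => A g v) ∧
      (∃ B : SymGroup n → (Y0Space κ (fun g => A g) ε →L[ℝ] Y0Space κ (fun g => A g) ε),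
        (∀ g v, (B g v).val = A g v.val) ∧ ∀ v, Continuous fun g => B g v) ∧
      ∀ v ∈ Y0 κ (fun g => A g) ε, IsC1 fun g => A g v :=
  ⟨dense_Y0 ε hA, completeSpace_Y0Space ε hA, hA, exists_operators_Y0Space ε hA,
    fun _ hv => isC1_action ε hA hv⟩

end BurgersSymmetry

end

theorem lemma3p3 (n k : ℕ) (p κ : ℝ) (hp : 1 < p) {ι : Type*} [Fintype ι]
    (ε : Module.Basis ι ℝ (BurgersSymmetry.SymAlg n)) :
    -- the case `X = C₀ᵏ(ℝᵈ)`, where `d = n + 1`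
    (∃ A : BurgersSymmetry.SymGroup n →
        (BurgersSymmetry.C0k n k →L[ℝ] BurgersSymmetry.C0k n k),
      -- `A g` is the operator `a(g)`
      (∀ g v, (A g v).fn = BurgersSymmetry.act p g v.fn) ∧
      Dense (BurgersSymmetry.Y0 (X := BurgersSymmetry.C0k n k) κ A ε : Set (BurgersSymmetry.C0k n k)) ∧
      CompleteSpace (BurgersSymmetry.Y0Space (X := BurgersSymmetry.C0k n k) κ A ε) ∧
      (∀ v, Continuous fun g => A g v) ∧
      (∃ B : BurgersSymmetry.SymGroup n →
          (BurgersSymmetry.Y0Space (X := BurgersSymmetry.C0k n k) κ A ε →L[ℝ] BurgersSymmetry.Y0Space (X := BurgersSymmetry.C0k n k) κ A ε),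
        (∀ g v, (B g v).val = A g v.val) ∧
        (∀ v, Continuous fun g => B g v)) ∧
      (∀ v ∈ BurgersSymmetry.Y0 (X := BurgersSymmetry.C0k n k) κ A ε, BurgersSymmetry.IsC1 fun g => A g v)) ∧
    -- the case `X = Hᵏ(ℝᵈ)`
    (∃ A : BurgersSymmetry.SymGroup n →
        (BurgersSymmetry.Hk n k →L[ℝ] BurgersSymmetry.Hk n k),
      (∀ g v, (A g v).fn =ᵐ[volume] BurgersSymmetry.act p g v.fn) ∧
      Dense (BurgersSymmetry.Y0 (X := BurgersSymmetry.Hk n k) κ A ε : Set (BurgersSymmetry.Hk n k)) ∧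
      CompleteSpace (BurgersSymmetry.Y0Space (X := BurgersSymmetry.Hk n k) κ A ε) ∧
      (∀ v, Continuous fun g => A g v) ∧
      (∃ B : BurgersSymmetry.SymGroup n →
          (BurgersSymmetry.Y0Space (X := BurgersSymmetry.Hk n k) κ A ε →L[ℝ] BurgersSymmetry.Y0Space (X := BurgersSymmetry.Hk n k) κ A ε),
        (∀ g v, (B g v).val = A g v.val) ∧
        (∀ v, Continuous fun g => B g v)) ∧
      (∀ v ∈ BurgersSymmetry.Y0 (X := BurgersSymmetry.Hk n k) κ A ε, BurgersSymmetry.IsC1 fun g => A g v)) := by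
  have h₁ := BurgersSymmetry.Y0_properties (X := BurgersSymmetry.C0k n k) κ
    (BurgersSymmetry.Sym.actionC0k p n k) BurgersSymmetry.Sym.continuous_actionC0k ε
  have h₂ := BurgersSymmetry.Y0_properties (X := BurgersSymmetry.Hk n k) κ
    (BurgersSymmetry.Sym.actionHk p n k) BurgersSymmetry.Sym.continuous_actionHk ε
  refine ⟨⟨fun g => BurgersSymmetry.Sym.actionC0k p n k g,
      BurgersSymmetry.Sym.fn_opC0k (p := p) (n := n) (k := k), ?_⟩,
    ⟨fun g => BurgersSymmetry.Sym.actionHk p n k g,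
      BurgersSymmetry.Sym.fn_opHk (p := p) (n := n) (k := k), ?_⟩⟩
  · exact h₁
  · exact ⟨h₂.1, h₂.2.1, h₂.2.2.1, h₂.2.2.2.1, h₂.2.2.2.2⟩
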